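/- For graphs $G,F$, say that $G$ is $F$-free if no induced subgraph of $G$ is isomorphic to $F$. The bull is the graph with vertices $a,b,c,d,e$ and edges $ab,bc,ac,ad,be$; the chair is the graph with vertices $a,b,c,d,e$ and edges $ab,bc,cd,ce$. For a positive integer $k$, an instance of List $k$-Coloring is a finite simple graph $G$ with a list $L(v)\subseteq\{1,\dots,k\}$ for every vertex $v$; the task is to find a proper coloring $c$ of $G$ with $c(v)\in L(v)$ for every vertex $v$, or to report that there is none. There is an absolute constant $C$ such that for every integer $k\ge 3$ there is an algorithm that solves every instance of List $k$-Coloring whose graph is bull-free and chair-free in at most $\max(n,2)^{C k^2}$ steps, where $n$ is the number of vertices of the graph. In other words, List $k$-Coloring on $n$-vertex $(\mathrm{bull},\mathrm{chair})$-free graphs can be solved in time $n^{\mathcal O(k^2)}$. Here an algorithm is a program of a random access machine whose registers and memory cells hold natural numbers, whose instructions are: setting a register to a constant, addition and truncated subtraction of registers, reading and writing memory at an address held in a register, and conditionals and loops that test whether a register is zero; each instruction and each test is one step. The input is given as $n$, the adjacency matrix of $G$ and the $n\times k$ zero-one matrix of the lists. -/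

import Mathlib

/-- The bull: the triangle `0, 1, 2` with the pendant vertex `3` attached to `0` and the pendant
vertex `4` attached to `1`. -/
def bull : SimpleGraph (Fin 5) :=
  SimpleGraph.fromEdgeSet {s(0, 1), s(1, 2), s(0, 2), s(0, 3), s(1, 4)}

/-- The chair (also called the fork): the claw with centre `2` and leaves `1, 3, 4`, one of whose
edges is subdivided, that is, `0` is attached to the leaf `1`. -/
def chair : SimpleGraph (Fin 5) :=
  SimpleGraph.fromEdgeSet {s(0, 1), s(1, 2), s(2, 3), s(2, 4)}

/-- Neither the bull nor the chair is an induced subgraph of `G`. -/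
def BullChairFree {V : Type*} (G : SimpleGraph V) : Prop :=
  ¬ bull.IsIndContained G ∧ ¬ chair.IsIndContained G

/-- `c` is a proper coloring of `G` that gives every vertex a color from its list. -/
def IsListColoring {V : Type*} {k : ℕ} (G : SimpleGraph V) (L : V → Finset (Fin k))
    (c : V → Fin k) : Prop :=
  (∀ u v, G.Adj u v → c u ≠ c v) ∧ ∀ v, c v ∈ L v

/-- Programs of a random access machine. It has registers, of which a program names only finitely
many, and an unbounded memory; registers and memory cells hold natural numbers. Addition and
truncated subtraction are the only arithmetic (no multiplication), so that counting every
instruction as one step is the usual unit-cost measure, which agrees up to a polynomial with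
Turing machine time. -/
inductive Program : Type
  /-- Do nothing. -/
  | skip : Program
  /-- `reg r := c`, for a constant `c`. -/
  | const (r c : ℕ) : Program
  /-- `reg r := reg a + reg b`. -/
  | add (r a b : ℕ) : Program
  /-- `reg r := reg a - reg b`, truncated at `0`. -/
  | sub (r a b : ℕ) : Program
  /-- `reg r := mem (reg a)`. -/
  | load (r a : ℕ) : Program
  /-- `mem (reg a) := reg b`. -/
  | store (a b : ℕ) : Program
  /-- Run `p`, then `q`. -/
  | seq (p q : Program) : Program
  /-- If `reg r ≠ 0` then `p`, else `q`. -/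
  | cond (r : ℕ) (p q : Program) : Program
  /-- While `reg r ≠ 0`, run `p`. -/
  | loop (r : ℕ) (p : Program) : Program

/-- The contents of the registers and of the memory. -/
structure Store where
  reg : ℕ → ℕ
  mem : ℕ → ℕ

/-- `s` with the register `r` set to `x`. -/
def Store.setReg (s : Store) (r x : ℕ) : Store :=
  { s with reg := Function.update s.reg r x }

/-- `s` with the memory cell `a` set to `x`. -/
def Store.setMem (s : Store) (a x : ℕ) : Store :=
  { s with mem := Function.update s.mem a x }

/-- `Exec p s t s'`: the program `p`, started in `s`, halts in `s'` after exactly `t` steps. Every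
basic instruction and every test of a register (in a conditional or in a loop) is one step. -/
inductive Exec : Program → Store → ℕ → Store → Prop
  | skip (s : Store) : Exec .skip s 1 s
  | const (s : Store) (r c : ℕ) : Exec (.const r c) s 1 (s.setReg r c)
  | add (s : Store) (r a b : ℕ) : Exec (.add r a b) s 1 (s.setReg r (s.reg a + s.reg b))
  | sub (s : Store) (r a b : ℕ) : Exec (.sub r a b) s 1 (s.setReg r (s.reg a - s.reg b))
  | load (s : Store) (r a : ℕ) : Exec (.load r a) s 1 (s.setReg r (s.mem (s.reg a)))
  | store (s : Store) (a b : ℕ) : Exec (.store a b) s 1 (s.setMem (s.reg a) (s.reg b))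
  | seq {p q : Program} {s s' s'' : Store} {t t' : ℕ} :
      Exec p s t s' → Exec q s' t' s'' → Exec (.seq p q) s (t + t') s''
  | condTrue {r : ℕ} {p q : Program} {s s' : Store} {t : ℕ} :
      s.reg r ≠ 0 → Exec p s t s' → Exec (.cond r p q) s (t + 1) s'
  | condFalse {r : ℕ} {p q : Program} {s s' : Store} {t : ℕ} :
      s.reg r = 0 → Exec q s t s' → Exec (.cond r p q) s (t + 1) s'
  | loopStep {r : ℕ} {p : Program} {s s' s'' : Store} {t t' : ℕ} :
      s.reg r ≠ 0 → Exec p s t s' → Exec (.loop r p) s' t' s'' →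
        Exec (.loop r p) s (t + t' + 1) s''
  | loopDone {r : ℕ} {p : Program} {s : Store} :
      s.reg r = 0 → Exec (.loop r p) s 1 s

open Classical in
/-- The store that holds the instance `(G, L)`, where `G` has the vertices `0, …, n - 1` and the
colors are `0, …, k - 1`. Register `0` holds `n`. The first `n * n` memory cells hold the adjacency
matrix of `G`, row by row, and the next `n * k` cells hold the lists: the cell `n * n + v * k + i`
is `1` if `i ∈ L v` and `0` otherwise. Everything else is `0`. -/
noncomputable def inputStore {n k : ℕ} (G : SimpleGraph (Fin n)) (L : Fin n → Finset (Fin k)) :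
    Store where
  reg := fun r => if r = 0 then n else 0
  mem := fun a =>
    if (∃ u v : Fin n, a = (u : ℕ) * n + (v : ℕ) ∧ G.Adj u v) ∨
        (∃ (v : Fin n) (i : Fin k), a = n * n + (v : ℕ) * k + (i : ℕ) ∧ i ∈ L v)
    then 1 else 0

/-- The store `s` holds a correct answer to the instance `(G, L)`: either register `0` is `1` and
the first `n` memory cells hold a list coloring, or register `0` is `0` and there is none. -/
def IsAnswer {n k : ℕ} (G : SimpleGraph (Fin n)) (L : Fin n → Finset (Fin k)) (s : Store) : Prop :=
  (s.reg 0 = 1 ∧ ∃ c : Fin n → Fin k, IsListColoring G L c ∧ ∀ v : Fin n, s.mem v = c v) ∨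
  (s.reg 0 = 0 ∧ ¬ ∃ c : Fin n → Fin k, IsListColoring G L c)

/-! The algorithm is local consistency with `w = min n (pebbles k k)` pebbles. Start from all
`w`-tuples of vertex-color pairs without a conflict. As long as some position of a surviving tuple
cannot be reassigned to some vertex, delete the whole line of tuples that differ only there. What
survives is the largest closed set, found in time polynomial in `(n * k) ^ w` and the other input
parameters. A list coloring always leaves survivors, since the tuples that agree with it are closed
(`Closed.of_isListColoring`). The mathematical content is the converse, `Consistent.hasColoring`:
without induced bulls and chairs, `O(k ^ 2)` pebbles suffice.

The converse is an induction on the number of colors in use, for connected graphs. If no vertex has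
a stable triple of neighbors, every neighborhood has at most `2k` vertices, because three vertices
of a larger one would share a color. The breadth-first layers from the third one on contain no
stable triple (`IsLayering.no_stable_triple`), so all layers have size `O(k ^ 2)`, and a window of
two layers slides through the graph and colors it.

Otherwise a claw grows to a base: a maximal co-connected set `Q` that contains a stable triple and
has a common neighbor `z`. The other vertices are complete to `Q`, mixed on `Q`, or anticomplete to
`Q`. About `4k` pebbles decouple these parts (`exists_decoupling`). Pebbling `z` removes a color
from `Q`, and pebbling a vertex of `Q` removes one from the complete part. Every component of the
mixed part has a common neighbor in `Q` (`IsBase.exists_common`), so one more pebble removes a color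
from it. The anticomplete part consists of the layers from the third one on and is colored by the
sliding window. The induction hypothesis colors the rest, and the colorings fit together.

A coloring is extracted from the decision procedure by deleting colors from the lists while the
instance stays feasible. The machine part compiles a small language of bounded loops, whose running
time is bounded by a power of the largest number that occurs, with a loop depth independent of `k`.
-/

namespace BullChairFree

/-! ### Induced bulls and chairs from adjacencies. -/

variable {V : Type*} {G : SimpleGraph V}

theorem no_bull (h : BullChairFree G) {a b c d e : V} (hab : G.Adj a b) (hbc : G.Adj b c)
    (hac : G.Adj a c) (had : G.Adj a d) (hbe : G.Adj b e) (hbd : ¬ G.Adj b d) (hcd : ¬ G.Adj c d)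
    (hae : ¬ G.Adj a e) (hce : ¬ G.Adj c e) (hde : ¬ G.Adj d e) : False := by
  have hab' := hab.ne
  have hbc' := hbc.ne
  have hac' := hac.ne
  have had' := had.ne
  have hbe' := hbe.ne
  have hbd' : b ≠ d := by rintro rfl; exact hcd hbc.symm
  have hcd' : c ≠ d := by rintro rfl; exact hbd hbc
  have hae' : a ≠ e := by rintro rfl; exact hce hac.symm
  have hce' : c ≠ e := by rintro rfl; exact hae hac
  have hde' : d ≠ e := by rintro rfl; exact hae had
  refine h.1 ⟨⟨⟨![a, b, c, d, e], ?_⟩, ?_⟩⟩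
  · intro x y hxy
    fin_cases x <;> fin_cases y <;> simp [*, hab'.symm, hbc'.symm, hac'.symm, had'.symm, hbe'.symm,
      hbd'.symm, hcd'.symm, hae'.symm, hce'.symm, hde'.symm] at hxy ⊢
  · intro x y
    change G.Adj (![a, b, c, d, e] x) (![a, b, c, d, e] y) ↔ _
    fin_cases x <;> fin_cases y <;> simp [bull, *, hab.symm, hbc.symm, hac.symm, had.symm,
      hbe.symm, G.adj_comm d b, G.adj_comm d c, G.adj_comm e a, G.adj_comm e c, G.adj_comm e d]

theorem no_chair (h : BullChairFree G) {c p q r x : V} (hcp : G.Adj c p) (hcq : G.Adj c q)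
    (hcr : G.Adj c r) (hpx : G.Adj p x) (hqr' : q ≠ r) (hpq : ¬ G.Adj p q) (hpr : ¬ G.Adj p r)
    (hqr : ¬ G.Adj q r) (hcx : ¬ G.Adj c x) (hqx : ¬ G.Adj q x) (hrx : ¬ G.Adj r x) : False := by
  have hcp' := hcp.ne
  have hcq' := hcq.ne
  have hcr' := hcr.ne
  have hpx' := hpx.ne
  have hpq' : p ≠ q := by rintro rfl; exact hqx hpx
  have hpr' : p ≠ r := by rintro rfl; exact hrx hpx
  have hcx' : c ≠ x := by rintro rfl; exact hqx hcq.symm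
  have hqx' : q ≠ x := by rintro rfl; exact hcx hcq
  have hrx' : r ≠ x := by rintro rfl; exact hcx hcr
  refine h.2 ⟨⟨⟨![x, p, c, q, r], ?_⟩, ?_⟩⟩
  · intro y z hyz
    fin_cases y <;> fin_cases z <;> simp [*, hcp'.symm, hcq'.symm, hcr'.symm, hpx'.symm,
      hpq'.symm, hpr'.symm, hcx'.symm, hqx'.symm, hrx'.symm, hqr'.symm] at hyz ⊢
  · intro y z
    change G.Adj (![x, p, c, q, r] y) (![x, p, c, q, r] z) ↔ _
    fin_cases y <;> fin_cases z <;> simp [chair, *, hcp.symm, hcq.symm, hcr.symm, hpx.symm,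
      G.adj_comm x c, G.adj_comm x q, G.adj_comm x r, G.adj_comm q p, G.adj_comm r p, G.adj_comm r q]

theorem induce (h : BullChairFree G) (U : Set V) : BullChairFree (G.induce U) :=
  ⟨fun h' => h.1 (h'.trans ⟨SimpleGraph.Embedding.induce U⟩),
    fun h' => h.2 (h'.trans ⟨SimpleGraph.Embedding.induce U⟩)⟩

end BullChairFree

/-! ### Breadth-first layers of graphs without bulls and chairs. -/

/-- `d` is a breadth-first layering of `G` with root `v`. -/
structure IsLayering {V : Type*} (G : SimpleGraph V) (v : V) (d : V → ℕ) : Prop where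
  root : ∀ u, d u = 0 ↔ u = v
  le_succ : ∀ {u w}, G.Adj u w → d w ≤ d u + 1
  parent : ∀ {u i}, d u = i + 1 → ∃ r, G.Adj r u ∧ d r = i

theorem SimpleGraph.Connected.isLayering {V : Type*} {G : SimpleGraph V} (hG : G.Connected)
    (v : V) : IsLayering G v (G.dist v) where
  root u := by
    rw [hG.dist_eq_zero_iff, eq_comm]
  le_succ {u w} h := by
    have := hG.dist_triangle (u := v) (v := u) (w := w)
    rwa [SimpleGraph.dist_eq_one_iff_adj.2 h] at this
  parent {u i} h := by
    obtain ⟨p, hp⟩ := hG.exists_walk_length_eq_dist u v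
    rw [SimpleGraph.dist_comm, h] at hp
    cases p with
    | nil => simp at hp
    | @cons _ r _ har q =>
      refine ⟨r, har.symm, ?_⟩
      simp only [SimpleGraph.Walk.length_cons, add_left_inj] at hp
      have h1 : G.dist r v ≤ i := hp ▸ SimpleGraph.dist_le q
      have h2 := hG.dist_triangle (u := v) (v := r) (w := u)
      rw [SimpleGraph.dist_eq_one_iff_adj.2 har.symm, h, SimpleGraph.dist_comm] at h2
      rw [SimpleGraph.dist_comm]
      omega

namespace IsLayering

variable {V : Type*} {G : SimpleGraph V} {v : V} {d : V → ℕ}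

theorem not_adj (hd : IsLayering G v d) {u w : V} (h : d u + 2 ≤ d w) : ¬ G.Adj u w := fun h' => by
  have := hd.le_succ h'
  omega

theorem not_adj' (hd : IsLayering G v d) {u w : V} (h : d u + 2 ≤ d w) : ¬ G.Adj w u :=
  fun h' => hd.not_adj h h'.symm

/-- If `x` and `x'` were adjacent, a parent `r` of `x` would complete a forbidden subgraph: the
triangle `x, x', r` with pendants `y, y'` is a bull if `r` sees `x'`. Otherwise `x` is the centre of
a chair with leaves `y`, `r`, `x'` and with `y'` attached to `x'`. -/
theorem not_adj_of_private (hd : IsLayering G v d) (h : BullChairFree G) {i : ℕ}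
    {x x' y y' : V} (hx : d x = i + 1) (hx' : d x' = i + 1) (hy : d y = i + 2) (hy' : d y' = i + 2)
    (hxy : G.Adj x y) (hxy' : G.Adj x' y') (h₁ : ¬ G.Adj x y') (h₂ : ¬ G.Adj x' y)
    (hyy : ¬ G.Adj y y') : ¬ G.Adj x x' := by
  intro hxx
  obtain ⟨r, hr, hri⟩ := hd.parent hx
  by_cases hrx : G.Adj r x'
  · exact h.no_bull hxx hrx.symm hr.symm hxy hxy' h₂ (hd.not_adj (by omega)) h₁
      (hd.not_adj (by omega)) hyy
  · exact h.no_chair (x := y') hxx hxy hr.symm hxy' (by rintro rfl; omega) h₂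
      (fun h => hrx h.symm) (hd.not_adj' (by omega)) h₁ hyy (hd.not_adj (by omega))

/-- No layer has three vertices with private neighbors in the next layer that form a stable set. -/
theorem no_private_triple (hd : IsLayering G v d) (h : BullChairFree G) (i : ℕ)
    (x y : Fin 3 → V) (hx : ∀ a, d (x a) = i + 1) (hy : ∀ a, d (y a) = i + 2)
    (hxy : ∀ a b, G.Adj (x a) (y b) ↔ a = b) (hyy : ∀ a b, ¬ G.Adj (y a) (y b)) : False := by
  induction i generalizing x y with
  | zero =>
    have hxx : ∀ a b, ¬ G.Adj (x a) (x b) := by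
      intro a b
      by_cases hab : a = b
      · rw [hab]; exact G.loopless.irrefl _
      · exact hd.not_adj_of_private h (hx a) (hx b) (hy a) (hy b) ((hxy _ _).2 rfl)
          ((hxy _ _).2 rfl) (fun h => hab ((hxy _ _).1 h)) (fun h => hab ((hxy _ _).1 h).symm)
          (hyy _ _)
    have hv : ∀ a, G.Adj v (x a) := by
      intro a
      obtain ⟨r, hr, hr0⟩ := hd.parent (hx a)
      rwa [(hd.root r).1 hr0] at hr
    have hne : x 1 ≠ x 2 := fun h12 => by
      have := (hxy 1 1).2 rfl
      rw [h12, hxy] at this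
      exact absurd this (by decide)
    have hv0 : d v = 0 := (hd.root v).2 rfl
    -- In the first layer the root is a common parent, hence the centre of a chair with leaves `x 0,
    -- x 1, x 2` and with `y 0` attached to `x 0`.
    exact h.no_chair (hv 0) (hv 1) (hv 2) ((hxy 0 0).2 rfl) hne (hxx _ _) (hxx _ _) (hxx _ _)
      (hd.not_adj (by rw [hv0, hy])) (fun h => absurd ((hxy _ _).1 h) (by decide))
      (fun h => absurd ((hxy _ _).1 h) (by decide))
  | succ i ih =>
    have hxx : ∀ a b, ¬ G.Adj (x a) (x b) := by
      intro a b
      by_cases hab : a = b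
      · rw [hab]; exact G.loopless.irrefl _
      · exact hd.not_adj_of_private h (hx a) (hx b) (hy a) (hy b) ((hxy _ _).2 rfl)
          ((hxy _ _).2 rfl) (fun h => hab ((hxy _ _).1 h)) (fun h => hab ((hxy _ _).1 h).symm)
          (hyy _ _)
    choose r hr hri using fun a => hd.parent (hx a)
    -- The pattern moves one layer up: the `x a` are stable, and they are private to their parents.
    -- If `r a` also saw `x b`, then `r a` with `x a`, `x b`, its own parent `s`, and `y a` attached
    -- to `x a` would be a chair.
    refine ih r x hri hx (fun a b => ⟨fun hab => ?_, fun hab => hab ▸ hr a⟩) hxx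
    by_contra hne
    obtain ⟨s, hs, hsi⟩ := hd.parent (hri a)
    have h1 := hx a
    have h2 := hx b
    have h3 := hri a
    have h4 := hy a
    exact h.no_chair (hr a) hab hs.symm ((hxy a a).2 rfl) (by rintro rfl; omega) (hxx _ _)
      (hd.not_adj' (by omega)) (hd.not_adj' (by omega)) (hd.not_adj (by omega))
      (fun h => hne ((hxy _ _).1 h).symm) (hd.not_adj (by omega))

/-- The layers from the third one on have no stable triples. -/
theorem no_stable_triple (hd : IsLayering G v d) (h : BullChairFree G) {i : ℕ} (y : Fin 3 → V)
    (hinj : Function.Injective y) (hy : ∀ a, d (y a) = i + 3)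
    (hyy : ∀ a b, ¬ G.Adj (y a) (y b)) : False := by
  -- The parents lie in the second layer or deeper, so above `x a` there are `s` and then `t`. If `x
  -- a` had two children in the triple, they and `s` would be the leaves of a chair with `t`
  -- attached to `s`. The need for `t` is why the third layer is the first one covered.
  choose x hx hxi using fun a => hd.parent (hy a)
  refine hd.no_private_triple h (i + 1) x y hxi hy
    (fun a b => ⟨fun hab => ?_, fun hab => hab ▸ hx a⟩) hyy
  by_contra hne
  obtain ⟨s, hs, hsi⟩ := hd.parent (hxi a)
  obtain ⟨t, ht, hti⟩ := hd.parent hsi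
  have h1 := hxi a
  have h2 := hy a
  have h3 := hy b
  exact h.no_chair hs.symm (hx a) hab ht.symm (fun h => hne (hinj h)) (hd.not_adj (by omega))
    (hd.not_adj (by omega)) (hyy _ _) (hd.not_adj' (by omega)) (hd.not_adj' (by omega))
    (hd.not_adj' (by omega))

end IsLayering

/-! ### Co-connected sets and bases. -/

/-- The complement of the induced subgraph on `Q` is connected. -/
def CoConnected {V : Type*} (G : SimpleGraph V) (Q : Set V) : Prop :=
  ∀ T ⊆ Q, T.Nonempty → T ≠ Q → ∃ a ∈ T, ∃ b ∈ Q \ T, ¬ G.Adj a b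

/-- In the complement, `u` is joined to the connected set `Q` by the edge to `b`. This is how a
co-connected set that is not yet a base grows. -/
theorem CoConnected.insert {V : Type*} {G : SimpleGraph V} {Q : Set V} (hQ : CoConnected G Q)
    {u b : V} (hb : b ∈ Q) (hu : u ∉ Q) (hub : ¬ G.Adj u b) : CoConnected G (insert u Q) := by
  intro T hT hne hTQ
  by_cases h0 : (T ∩ Q).Nonempty
  · by_cases h1 : T ∩ Q = Q
    · have hQT : Q ⊆ T := by rw [← h1]; exact Set.inter_subset_left
      have huT : u ∉ T := fun huT => hTQ (Set.Subset.antisymm hT (Set.insert_subset huT hQT))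
      exact ⟨b, hQT hb, u, ⟨Set.mem_insert _ _, huT⟩, fun h => hub h.symm⟩
    · obtain ⟨a, ha, c, hc, hac⟩ := hQ _ Set.inter_subset_right h0 h1
      exact ⟨a, ha.1, c, ⟨Set.mem_insert_of_mem _ hc.1, fun h => hc.2 ⟨h, hc.1⟩⟩, hac⟩
  · obtain ⟨a, ha⟩ := hne
    have hau : a = u := by
      rcases hT ha with h | h
      · exact h
      · exact absurd ⟨a, ha, h⟩ h0
    subst hau
    exact ⟨a, ha, b, ⟨Set.mem_insert_of_mem _ hb, fun h => h0 ⟨b, h, hb⟩⟩, hub⟩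

/-- `Q` is a co-connected set with a stable triple and with the common neighbor `v`, and no
vertex can be added to it. -/
structure IsBase {V : Type*} (G : SimpleGraph V) (Q : Set V) (v : V) (q : Fin 3 → V) : Prop where
  coConnected : CoConnected G Q
  complete : ∀ a ∈ Q, G.Adj v a
  inj : Function.Injective q
  mem : ∀ i, q i ∈ Q
  stable : ∀ i j, ¬ G.Adj (q i) (q j)
  maximal : ∀ z u, (∀ a ∈ Q, G.Adj z a) → u ∉ Q → G.Adj z u → ∀ a ∈ Q, G.Adj u a

/-- Among the co-connected sets that contain the triple and have some common neighbor, take a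
maximal one. The common neighbor is not fixed in advance, so maximality applies to every common
neighbor: a neighbor outside that misses a vertex of the set could be added to it. -/
theorem exists_isBase {V : Type*} [Finite V] {G : SimpleGraph V} {v : V} {q : Fin 3 → V}
    (hinj : Function.Injective q) (hq : ∀ i j, ¬ G.Adj (q i) (q j)) (hv : ∀ i, G.Adj v (q i)) :
    ∃ Q z, IsBase G Q z q := by
  have hne : {Q : Set V | CoConnected G Q ∧ (∃ z, ∀ a ∈ Q, G.Adj z a) ∧ ∀ i, q i ∈ Q}.Nonempty := by
    refine ⟨Set.range q, ?_, ⟨v, ?_⟩, fun i => ⟨i, rfl⟩⟩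
    · intro T hT ⟨a, ha⟩ hTQ
      obtain ⟨i, rfl⟩ := hT ha
      obtain ⟨b, hb, hbT⟩ := Set.exists_of_ssubset (hT.ssubset_of_ne hTQ)
      obtain ⟨j, rfl⟩ := hb
      exact ⟨_, ha, _, ⟨⟨j, rfl⟩, hbT⟩, hq _ _⟩
    · rintro _ ⟨i, rfl⟩
      exact hv i
  obtain ⟨Q, hQ⟩ := (Set.toFinite _).exists_maximal hne
  obtain ⟨⟨hco, ⟨z, hz⟩, hmem⟩, hmax⟩ := hQ
  refine ⟨Q, z, hco, hz, hinj, hmem, hq, ?_⟩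
  intro z' u hz' hu hzu a ha
  by_contra hua
  have := hmax (y := insert u Q) ⟨hco.insert ha hu hua, ⟨z', ?_⟩, fun i => Set.mem_insert_of_mem _ (hmem i)⟩
    (Set.subset_insert _ _)
  · exact hu (this (Set.mem_insert _ _))
  · rintro b (rfl | hb)
    · exact hzu
    · exact hz' b hb

namespace IsBase

variable {V : Type*} {G : SimpleGraph V} {Q : Set V} {v : V} {q : Fin 3 → V}

/-- A vertex outside with a neighbor in the base misses only a clique of it. -/
theorem adj_of_missed (hQ : IsBase G Q v q) (h : BullChairFree G) {u a b b' : V} (hu : u ∉ Q)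
    (ha : a ∈ Q) (hua : G.Adj u a) (hb : b ∈ Q) (hub : ¬ G.Adj u b) (hb' : b' ∈ Q)
    (hub' : ¬ G.Adj u b') (hne : b ≠ b') : G.Adj b b' := by
  by_contra hbb
  have hvu : ¬ G.Adj v u := fun hvu => hub (hQ.maximal v u hQ.complete hu hvu b hb)
  -- Co-connectedness is applied to the missed vertices that have a missed non-neighbor. It yields
  -- such a `c` and a non-neighbor `e` of `c` outside this set. Then `u` sees `e`, since otherwise
  -- `c` would put `e` into the set. Now `v, e, c, c', u` span a bull if `e` sees `c'` and a chair
  -- if not.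
  obtain ⟨c, ⟨hc, huc, c', hc', huc', hcc', hcc⟩, e, ⟨he, heT⟩, hce⟩ := hQ.coConnected
    {c | c ∈ Q ∧ ¬ G.Adj u c ∧ ∃ c' ∈ Q, ¬ G.Adj u c' ∧ c ≠ c' ∧ ¬ G.Adj c c'}
    (fun c hc => hc.1) ⟨b, hb, hub, b', hb', hub', hne, hbb⟩
    (fun heq => by
      have : a ∈ {c | c ∈ Q ∧ ¬ G.Adj u c ∧ ∃ c' ∈ Q, ¬ G.Adj u c' ∧ c ≠ c' ∧ ¬ G.Adj c c'} := by
        rw [heq]; exact ha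
      exact this.2.1 hua)
  have hec : e ≠ c := by
    rintro rfl
    exact heT ⟨hc, huc, c', hc', huc', hcc', hcc⟩
  by_cases hue : G.Adj u e
  · by_cases hec' : G.Adj e c'
    · exact h.no_bull (hQ.complete e he) hec' (hQ.complete c' hc') (hQ.complete c hc) hue.symm
        (fun h => hce h.symm) (fun h => hcc h.symm) hvu (fun h => huc' h.symm)
        (fun h => huc h.symm)
    · exact h.no_chair (hQ.complete e he) (hQ.complete c hc) (hQ.complete c' hc') hue.symm hcc'
        (fun h => hce h.symm) hec' hcc hvu (fun h => huc h.symm) (fun h => huc' h.symm)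
  · exact heT ⟨he, hue, c, hc, huc, hec, fun h => hce h.symm⟩

/-- A connected set of vertices that have neighbors in the base, but are not complete to it, has a
common neighbor in the base. -/
theorem exists_common (hQ : IsBase G Q v q) (h : BullChairFree G) {K : Set V}
    (hK : (G.induce K).Preconnected) (hKQ : ∀ x ∈ K, x ∉ Q ∧ (∃ a ∈ Q, G.Adj x a) ∧ ∃ b ∈ Q, ¬ G.Adj x b) :
    ∃ a ∈ Q, ∀ x ∈ K, G.Adj x a := by
  by_contra! hcon
  obtain ⟨x, hx, hx0⟩ := hcon _ (hQ.mem 0)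
  obtain ⟨y, hy, hy1⟩ := hcon _ (hQ.mem 1)
  -- The triple is stable and missed vertices form a clique, so a vertex of `K` misses at most one
  -- of the `q i`.
  have hmiss : ∀ u ∈ K, ∀ i j, i ≠ j → ¬ G.Adj u (q i) → G.Adj u (q j) := by
    intro u hu i j hij hi
    by_contra hj
    obtain ⟨huQ, ⟨a, ha, hua⟩, -⟩ := hKQ u hu
    exact hQ.stable i j (hQ.adj_of_missed h huQ ha hua (hQ.mem i) hi (hQ.mem j) hj (hQ.inj.ne hij))
  -- An edge here would give a bull with triangle `u, w, q 2` and pendants `q 1` at `u` and `q 0` at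
  -- `w`.
  have hno : ∀ u ∈ K, ∀ w ∈ K, ¬ G.Adj u (q 0) → ¬ G.Adj w (q 1) → ¬ G.Adj u w := by
    intro u hu w hw hu0 hw1 huw
    exact h.no_bull huw (hmiss w hw 1 2 (by decide) hw1) (hmiss u hu 0 2 (by decide) hu0)
      (hmiss u hu 0 1 (by decide) hu0) (hmiss w hw 1 0 (by decide) hw1) hw1 (hQ.stable _ _) hu0
      (hQ.stable _ _) (hQ.stable _ _)
  have hvK : ∀ u ∈ K, ¬ G.Adj v u := by
    intro u hu hvu
    obtain ⟨huQ, -, b, hb, hub⟩ := hKQ u hu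
    exact hub (hQ.maximal v u hQ.complete huQ hvu b hb)
  -- The property spreads along walks in `K` from `x`. When both ends of an edge `u u'` see `q 0`,
  -- the witness `t` for `u` also serves `u'`, since otherwise the triangle `u, q 0, u'` with
  -- pendants `t` at `u` and `v` at `q 0` is a bull. At `y` the property contradicts `hmiss` or
  -- `hno`.
  have key : ∀ w : K, ¬ G.Adj w (q 0) ∨ ∃ u ∈ K, ¬ G.Adj u (q 0) ∧ G.Adj u w := by
    intro w
    obtain ⟨p⟩ := hK ⟨x, hx⟩ w
    have : ∀ (u w : K) (p : (G.induce K).Walk u w),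
        (¬ G.Adj u (q 0) ∨ ∃ t ∈ K, ¬ G.Adj t (q 0) ∧ G.Adj t u) →
        (¬ G.Adj w (q 0) ∨ ∃ t ∈ K, ¬ G.Adj t (q 0) ∧ G.Adj t w) := by
      intro u w p
      induction p with
      | nil => exact id
      | @cons u u' w huu p ih =>
        intro hu
        refine ih ?_
        have huu : G.Adj u u' := huu
        by_cases hu0 : G.Adj (u : V) (q 0)
        · obtain ⟨t, ht, ht0, htu⟩ := hu.resolve_left (not_not.2 hu0)
          by_cases hu'0 : G.Adj (u' : V) (q 0)
          · right
            refine ⟨t, ht, ht0, ?_⟩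
            by_contra htu'
            exact h.no_bull hu0 hu'0.symm huu htu.symm (hQ.complete _ (hQ.mem 0)).symm
              (fun h => ht0 h.symm) (fun h => htu' h.symm) (fun h => hvK u u.2 h.symm)
              (fun h => hvK u' u'.2 h.symm) (fun h => hvK t ht h.symm)
          · exact Or.inl hu'0
        · exact Or.inr ⟨u, u.2, hu0, huu⟩
    exact this _ _ p (Or.inl hx0)
  rcases key ⟨y, hy⟩ with hy0 | ⟨u, hu, hu0, huy⟩
  · exact hy0 (hmiss y hy 1 0 (by decide) hy1)
  · exact hno u hu y hy hu0 hy1 huy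

end IsBase

/-! ### Pebble games and how colorings of parts are obtained from them. -/

/-- A winning strategy of the duplicator in the `w`-pebble game for coloring `G`: a family of
finite partial colorings, closed under restriction, in which every member with fewer than `w`
vertices can be extended to any further vertex. -/
structure Consistent {V C : Type*} (G : SimpleGraph V) (w : ℕ) (H : Set (Finset (V × C))) :
    Prop where
  empty : ∅ ∈ H
  mono : ∀ {s t}, t ∈ H → s ⊆ t → s ∈ H
  func : ∀ {s u i j}, s ∈ H → (u, i) ∈ s → (u, j) ∈ s → i = j
  adj : ∀ {s u v i}, s ∈ H → (u, i) ∈ s → (v, i) ∈ s → ¬ G.Adj u v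
  ext : ∀ {s}, s ∈ H → s.card < w → ∀ u, ∃ i, ∃ t ∈ H, s ⊆ t ∧ (u, i) ∈ t

/-- The members of `H` that are compatible with `f`. -/
def residue {V C : Type*} (H : Set (Finset (V × C))) (f : Finset (V × C)) :
    Set (Finset (V × C)) :=
  {s | ∃ t ∈ H, s ⊆ t ∧ f ⊆ t}

/-- The members of `H` that live on `U`. -/
def restrict {V C : Type*} (H : Set (Finset (V × C))) (U : Set V) : Set (Finset (U × C)) :=
  {s | s.map ((Function.Embedding.subtype _).prodMap (Function.Embedding.refl C)) ∈ H}

/-- `U` has a proper coloring that picks, at every vertex, a color that `H` allows there. -/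
def HasColoring {V C : Type*} (G : SimpleGraph V) (H : Set (Finset (V × C))) (U : Set V) : Prop :=
  ∃ c : U → C, (∀ u : U, {(u.1, c u)} ∈ H) ∧ ∀ u w : U, G.Adj u w → c u ≠ c w

section

variable {V C : Type*} {G : SimpleGraph V} {w : ℕ} {H : Set (Finset (V × C))}

theorem HasColoring.mono {H' : Set (Finset (V × C))} (hH : H' ⊆ H) {U : Set V}
    (h : HasColoring G H' U) : HasColoring G H U := by
  obtain ⟨c, h1, h2⟩ := h
  exact ⟨c, fun u => hH (h1 u), h2⟩

theorem HasColoring.of_restrict {U : Set V}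
    (h : HasColoring (G.induce U) (restrict H U) Set.univ) : HasColoring G H U := by
  obtain ⟨c, h1, h2⟩ := h
  refine ⟨fun u => c ⟨u, trivial⟩, fun u => ?_, fun u w h => h2 ⟨u, trivial⟩ ⟨w, trivial⟩ h⟩
  simpa [restrict] using h1 ⟨u, trivial⟩

/-- Colorings of parts combine if adjacent vertices in different parts share no color. -/
theorem HasColoring.glue {X : Set V} {I : Type*} (π : X → I)
    (h : ∀ i, HasColoring G H {u | ∃ h : u ∈ X, π ⟨u, h⟩ = i})
    (hπ : ∀ u w : X, G.Adj u w → π u ≠ π w → ∀ i, {(u.1, i)} ∈ H → {(w.1, i)} ∉ H) :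
    HasColoring G H X := by
  choose c hc hadj using h
  refine ⟨fun u => c (π u) ⟨u, u.2, rfl⟩, fun u => hc (π u) ⟨u, u.2, rfl⟩, fun u w huw heq => ?_⟩
  by_cases hne : π u = π w
  · have : ∀ i (hi : π w = i), c (π w) ⟨w, w.2, rfl⟩ = c i ⟨w, w.2, hi⟩ := by
      rintro i rfl; rfl
    exact hadj _ _ _ huw (heq.trans (this _ hne.symm))
  · refine hπ u w huw hne _ (hc (π u) ⟨u, u.2, rfl⟩) ?_
    rw [show c (π u) ⟨u, u.2, rfl⟩ = _ from heq]
    exact hc (π w) ⟨w, w.2, rfl⟩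

theorem HasColoring.of_connected {X : Set V}
    (h : ∀ U ⊆ X, (G.induce U).Connected → HasColoring G H U) : HasColoring G H X := by
  refine HasColoring.glue (G.induce X).connectedComponentMk (fun K => h _ (fun u hu => hu.1) ?_) ?_
  · have hK := K.connected_toSimpleGraph
    let f : K.toSimpleGraph →g
        G.induce {u | ∃ h : u ∈ X, (G.induce X).connectedComponentMk ⟨u, h⟩ = K} :=
      ⟨fun u => ⟨u.1.1, u.1.2, u.2⟩, fun {a b} hab => hab⟩
    exact hK.map f (fun u => ⟨⟨⟨u.1, u.2.1⟩, u.2.2⟩, rfl⟩)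
  · intro u w huw hne
    exact absurd (SimpleGraph.ConnectedComponent.sound
      (SimpleGraph.Adj.reachable (G := G.induce X) huw)) hne

namespace Consistent

theorem residue_subset (hH : Consistent G w H) (f : Finset (V × C)) : residue H f ⊆ H :=
  fun _ ⟨_, ht, hs, _⟩ => hH.mono ht hs

/-- The pebbles of `f` are left on the board for good, and the game goes on with the remaining ones:
a position `s` is extended by extending `s ∪ f`. -/
theorem residual (hH : Consistent G w H) {f : Finset (V × C)} (hf : f ∈ H) :
    Consistent G (w - f.card) (residue H f) where
  empty := ⟨f, hf, by simp, by simp⟩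
  mono := fun ⟨t, ht, hs, hft⟩ hst => ⟨t, ht, hst.trans hs, hft⟩
  func := fun ⟨t, ht, hs, _⟩ h1 h2 => hH.func ht (hs h1) (hs h2)
  adj := fun ⟨t, ht, hs, _⟩ h1 h2 => hH.adj ht (hs h1) (hs h2)
  ext := by
    classical
    rintro s ⟨t, ht, hs, hft⟩ hw u
    obtain ⟨i, t', ht', hst, hu⟩ := hH.ext (s := s ∪ f) (hH.mono ht (Finset.union_subset hs hft))
      (by have := Finset.card_union_le s f; omega) u
    exact ⟨i, t', ⟨t', ht', subset_rfl, Finset.subset_union_right.trans hst⟩,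
      Finset.subset_union_left.trans hst, hu⟩

theorem restrict (hH : Consistent G w H) (U : Set V) :
    Consistent (G.induce U) w (restrict H U) where
  empty := by simpa [_root_.restrict] using hH.empty
  mono := fun ht hs => hH.mono ht (Finset.map_subset_map.2 hs)
  func := fun {s u i j} hs h1 h2 => hH.func (u := u.1) hs
    (Finset.mem_map.2 ⟨_, h1, rfl⟩) (Finset.mem_map.2 ⟨_, h2, rfl⟩)
  adj := fun {s u v i} hs h1 h2 => hH.adj (u := u.1) (v := v.1) (i := i) hs
    (Finset.mem_map.2 ⟨_, h1, rfl⟩) (Finset.mem_map.2 ⟨_, h2, rfl⟩)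
  ext := by
    intro s hs hw u
    classical
    obtain ⟨i, t, ht, hst, hu⟩ := hH.ext hs (by simpa using hw) u
    refine ⟨i, insert (u, i) s, hH.mono ht ?_, Finset.subset_insert _ _, Finset.mem_insert_self _ _⟩
    rw [Finset.map_insert]
    exact Finset.insert_subset hu hst

theorem exists_extension (hH : Consistent G w H) {s : Finset (V × C)} (hs : s ∈ H) (A : Finset V)
    (hw : s.card + A.card ≤ w) :
    ∃ t ∈ H, s ⊆ t ∧ (∀ a ∈ A, ∃ i, (a, i) ∈ t) ∧ t.card ≤ s.card + A.card := by
  classical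
  induction A using Finset.induction_on with
  | empty => exact ⟨s, hs, subset_rfl, by simp, by simp⟩
  | insert a A ha ih =>
    rw [Finset.card_insert_of_notMem ha] at hw ⊢
    obtain ⟨t, ht, hst, hA, hc⟩ := ih (by omega)
    obtain ⟨i, t', ht', htt, hi⟩ := hH.ext ht (by omega) a
    refine ⟨insert (a, i) t, hH.mono ht' (Finset.insert_subset hi htt),
      hst.trans (Finset.subset_insert _ _), ?_, ?_⟩
    · intro b hb
      rcases Finset.mem_insert.1 hb with rfl | hb
      · exact ⟨i, Finset.mem_insert_self _ _⟩
      · obtain ⟨j, hj⟩ := hA b hb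
        exact ⟨j, Finset.mem_insert_of_mem hj⟩
    · have := Finset.card_insert_le (a, i) t
      omega

theorem eq_of_residual (hH : Consistent G w H) {f : Finset (V × C)} {u : V} {i j : C}
    (hf : (u, i) ∈ f) (h : {(u, j)} ∈ residue H f) : j = i := by
  obtain ⟨t, ht, hs, hft⟩ := h
  exact hH.func ht (hs (Finset.mem_singleton_self _)) (hft hf)

/-- This is how colors disappear: pebbling a vertex forbids its color on all neighbors. -/
theorem not_adj_of_residual (hH : Consistent G w H) {f : Finset (V × C)} {u v : V} {i : C}
    (hf : (u, i) ∈ f) (h : {(v, i)} ∈ residue H f) : ¬ G.Adj u v := by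
  obtain ⟨t, ht, hs, hft⟩ := h
  exact hH.adj ht (hft hf) (hs (Finset.mem_singleton_self _))

variable [Fintype C]

/-- If `2 * Fintype.card C + 1` vertices are pebbled at once, three of them receive the same color
and therefore form a stable triple. -/
theorem card_le_of_no_stable_triple (hH : Consistent G w H) (hw : 2 * Fintype.card C + 1 ≤ w)
    (A : Finset V) (hA : ∀ y : Fin 3 → V, Function.Injective y → (∀ a, y a ∈ A) →
      ∃ a b, G.Adj (y a) (y b)) : A.card ≤ 2 * Fintype.card C := by
  classical
  by_contra! hlt
  obtain ⟨B, hBA, hB⟩ := Finset.exists_subset_card_eq hlt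
  obtain ⟨t, ht, -, hBt, -⟩ := hH.exists_extension hH.empty B (by simp; omega)
  obtain ⟨a₀, ha₀⟩ : B.Nonempty := Finset.card_pos.1 (by omega)
  have : Nonempty C := ⟨(hBt a₀ ha₀).choose⟩
  choose! c hc using hBt
  obtain ⟨i, -, hi⟩ := Finset.exists_lt_card_fiber_of_mul_lt_card_of_maps_to (s := B)
    (t := Finset.univ) (f := c) (n := 2) (fun _ _ => Finset.mem_univ _)
    (by rw [hB, Finset.card_univ]; omega)
  obtain ⟨x, hx, y, hy, z, hz, hxy, hxz, hyz⟩ := Finset.two_lt_card.1 hi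
  have hmem : ∀ a, ![x, y, z] a ∈ B ∧ c (![x, y, z] a) = i := by
    intro a
    fin_cases a
    · exact Finset.mem_filter.1 hx
    · exact Finset.mem_filter.1 hy
    · exact Finset.mem_filter.1 hz
  obtain ⟨a, b, hab⟩ := hA ![x, y, z]
    (by intro a b; fin_cases a <;> fin_cases b <;> simp [hxy, hxz, hyz, hxy.symm, hxz.symm, hyz.symm])
    (fun a => hBA (hmem a).1)
  have h1 := hc _ (hmem a).1
  have h2 := hc _ (hmem b).1
  rw [(hmem a).2] at h1
  rw [(hmem b).2] at h2
  exact hH.adj ht h1 h2 hab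

omit [Fintype C] in
/-- Layers of size at most `m` can be colored one after the other. -/
theorem hasColoring_of_layers (hH : Consistent G w H) {d : V → ℕ}
    (hd : ∀ {u v}, G.Adj u v → d v ≤ d u + 1) (i₀ m : ℕ)
    (hm : ∀ i, i₀ ≤ i → ∃ A : Finset V, A.card ≤ m ∧ ∀ u, d u = i → u ∈ A) (hw : 2 * m ≤ w) :
    HasColoring G H {u | i₀ ≤ d u} := by
  classical
  -- `P i f` says that `f` pebbles the whole layer `i₀ + i` with at most `m` pebbles. The next layer
  -- is pebbled while these are still in place, which needs `2 * m` pebbles, and then the old ones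
  -- are lifted. Edges stay within a layer or join consecutive ones, so each edge is seen by one
  -- window.
  let P : ℕ → Finset (V × C) → Prop := fun i f =>
    f ∈ H ∧ f.card ≤ m ∧ ∀ u, d u = i₀ + i → ∃ c, (u, c) ∈ f
  have ext : ∀ i f, f ∈ H → f.card ≤ m → ∃ g, P i g ∧ ∃ t ∈ H, f ⊆ t ∧ g ⊆ t := by
    intro i f hf hfm
    obtain ⟨A, hA, hAd⟩ := hm (i₀ + i) (by omega)
    obtain ⟨t, ht, hft, htA, -⟩ := hH.exists_extension hf A (by omega)
    refine ⟨t.filter (fun p => p.1 ∈ A), ⟨hH.mono ht (Finset.filter_subset _ _), ?_, ?_⟩,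
      t, ht, hft, Finset.filter_subset _ _⟩
    · refine (Finset.card_le_card_of_injOn Prod.fst
        (fun p hp => (Finset.mem_filter.1 hp).2) ?_).trans hA
      rintro ⟨u, i⟩ hp ⟨v, j⟩ hq (rfl : u = v)
      rw [hH.func ht (Finset.mem_filter.1 hp).1 (Finset.mem_filter.1 hq).1]
    · intro u hu
      obtain ⟨c, hc⟩ := htA u (hAd u hu)
      exact ⟨c, Finset.mem_filter.2 ⟨hc, hAd u hu⟩⟩
  obtain ⟨f₀, hf₀, -⟩ := ext 0 ∅ hH.empty (by simp)
  choose! g hg using fun i f (h : P i f) => ext (i + 1) f h.1 h.2.1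
  let F : ℕ → Finset (V × C) := fun i => Nat.rec f₀ g i
  have hF : ∀ i, P i (F i) := by
    intro i
    induction i with
    | zero => exact hf₀
    | succ i ih => exact (hg i _ ih).1
  have hc : ∀ u : {u | i₀ ≤ d u}, ∃ c, (u.1, c) ∈ F (d u - i₀) := by
    intro u
    exact (hF _).2.2 u (by have : i₀ ≤ d u := u.2; omega)
  choose c hc using hc
  have hstep : ∀ u v : {u | i₀ ≤ d u}, d u ≤ d v → G.Adj u v → c u ≠ c v := by
    intro u v hle huv heq
    have h1 := hc u
    have h2 := hc v
    rw [heq] at h1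
    have hu : i₀ ≤ d u := u.2
    have := hd huv
    by_cases hs : d v = d u
    · rw [hs] at h2
      exact hH.adj (hF _).1 h1 h2 huv
    · obtain ⟨t, ht, h3, h4⟩ := (hg _ _ (hF (d u - i₀))).2
      have hv : d v - i₀ = d u - i₀ + 1 := by omega
      rw [hv] at h2
      exact hH.adj ht (h3 h1) (h4 h2) huv
  refine ⟨c, fun u => hH.mono (hF _).1 (Finset.singleton_subset_iff.2 (hc u)), fun u v huv => ?_⟩
  rcases le_total (d u) (d v) with h | h
  · exact hstep u v h huv
  · exact (hstep v u h huv.symm).symm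

/-- A member of `H` on `Q` such that every color that `H` still allows on a further vertex of `Q`
has been used twice. -/
theorem exists_saturated [Finite V] (hH : Consistent G w H) (Q : Set V) :
    ∃ s ∈ H, s.card ≤ 2 * Fintype.card C ∧ ∀ q ∈ Q, ∀ i, {(q, i)} ∈ residue H s →
      (q, i) ∈ s ∨ ∃ a ∈ Q, ∃ b ∈ Q, a ≠ b ∧ (a, i) ∈ s ∧ (b, i) ∈ s := by
  classical
  obtain ⟨s, ⟨hsH, hsQ, hs2⟩, hmax⟩ := (Set.toFinite {s | s ∈ H ∧ (∀ p ∈ s, p.1 ∈ Q) ∧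
    ∀ i, (s.filter (fun p => p.2 = i)).card ≤ 2}).exists_maximal ⟨∅, hH.empty, by simp, by simp⟩
  refine ⟨s, hsH, ?_, ?_⟩
  · rw [Finset.card_eq_sum_card_fiberwise (f := Prod.snd) (t := Finset.univ) (by intro; simp)]
    refine (Finset.sum_le_card_nsmul _ _ 2 (fun i _ => hs2 i)).trans ?_
    rw [Finset.card_univ, smul_eq_mul, mul_comm]
  · rintro q hq i ⟨t, ht, hqt, hst⟩
    by_contra! hcon
    obtain ⟨hqs, hcon⟩ := hcon
    refine hqs (hmax (y := insert (q, i) s) ⟨hH.mono ht ?_, ?_, ?_⟩ (Finset.subset_insert _ _)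
      (Finset.mem_insert_self _ _))
    · exact Finset.insert_subset (hqt (Finset.mem_singleton_self _)) hst
    · intro p hp
      rcases Finset.mem_insert.1 hp with rfl | hp
      · exact hq
      · exact hsQ p hp
    · intro j
      rw [Finset.filter_insert]
      split_ifs with hij
      · refine (Finset.card_insert_le _ _).trans (Nat.succ_le_succ (Finset.card_le_one.2 ?_))
        rintro ⟨a, i₁⟩ ha ⟨b, i₂⟩ hb
        simp only [Finset.mem_filter] at ha hb hij
        obtain ⟨ha, rfl⟩ := ha
        obtain ⟨hb, rfl⟩ := hb
        subst hij
        by_contra hne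
        exact hcon a (hsQ _ ha) b (hsQ _ hb) (fun h => hne (by rw [h])) ha hb
      · exact hs2 j

end Consistent

end

/-! ### Sufficiently many pebbles yield a coloring: induction on the number of colors. -/

section

variable {V C : Type*} {G : SimpleGraph V} {w : ℕ} {H : Set (Finset (V × C))}

/-- The set of colors that `H` allows somewhere is contained in `S`. -/
def UsesOnly {V C : Type*} (H : Set (Finset (V × C))) (S : Finset C) : Prop :=
  ∀ u i, {(u, i)} ∈ H → i ∈ S

namespace Consistent

variable [Finite V] [Fintype C]

/-- Neighborhoods have no stable triple and hence at most `2k` vertices for `k` colors. So the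
layers `0`, `1`, `2` have at most `1`, `2k`, `4k ^ 2` vertices, and the later ones at most `2k` by
`no_stable_triple`. A window of two layers uses `8k ^ 2` pebbles. -/
theorem hasColoring_of_claw_free (hH : Consistent G w H) (h : BullChairFree G) (hG : G.Connected)
    (hclaw : ∀ v (q : Fin 3 → V), Function.Injective q → (∀ i, G.Adj v (q i)) →
      ∃ i j, G.Adj (q i) (q j)) (hC : 0 < Fintype.card C) (hw : 8 * Fintype.card C ^ 2 + 1 ≤ w) :
    HasColoring G H Set.univ := by
  classical
  have := Fintype.ofFinite V
  have hCC : Fintype.card C ≤ Fintype.card C ^ 2 := Nat.le_self_pow (by norm_num) _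
  obtain ⟨v⟩ := hG.nonempty
  have hd := hG.isLayering v
  have hnbr : ∀ u, (G.neighborFinset u).card ≤ 2 * Fintype.card C := fun u =>
    hH.card_le_of_no_stable_triple (by omega) _
      (fun y hy hyA => hclaw u y hy (fun i => (G.mem_neighborFinset u _).1 (hyA i)))
  have := hH.hasColoring_of_layers hd.le_succ 0 (4 * Fintype.card C ^ 2) ?_ (by omega)
  · simpa using this
  rintro i -
  rcases i with _ | _ | _ | i
  · exact ⟨{v}, by simp; omega, fun u hu => by simpa using (hd.root u).1 hu⟩
  · refine ⟨G.neighborFinset v, (hnbr v).trans (by omega), fun u hu => ?_⟩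
    obtain ⟨r, hr, hr0⟩ := hd.parent hu
    rw [(hd.root r).1 hr0] at hr
    simpa using hr
  · refine ⟨(G.neighborFinset v).biUnion (fun r => G.neighborFinset r), ?_, fun u hu => ?_⟩
    · calc _ ≤ (G.neighborFinset v).card * (2 * Fintype.card C) :=
            Finset.card_biUnion_le_card_mul _ _ _ (fun u _ => hnbr u)
        _ ≤ (2 * Fintype.card C) * (2 * Fintype.card C) := Nat.mul_le_mul_right _ (hnbr v)
        _ = _ := by ring
    · obtain ⟨r, hr, hr1⟩ := hd.parent hu
      obtain ⟨r', hr', hr0⟩ := hd.parent hr1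
      rw [(hd.root r').1 hr0] at hr'
      exact Finset.mem_biUnion.2 ⟨r, by simpa using hr', by simpa using hr⟩
  · refine ⟨Finset.univ.filter (fun u => G.dist v u = i + 3), ?_, fun u hu => by simpa using hu⟩
    refine (hH.card_le_of_no_stable_triple (by omega) _ (fun y hy hyA => ?_)).trans (by omega)
    by_contra! hcon
    exact hd.no_stable_triple h y hy (fun a => by simpa using hyA a) hcon

/-- The pebbles that decouple the pieces of a graph around a base from one another. -/
theorem exists_decoupling (hH : Consistent G w H) (h : BullChairFree G) (hG : G.Connected)
    {Q : Set V} {z : V} {q : Fin 3 → V} (hQ : IsBase G Q z q)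
    (hw : 4 * Fintype.card C + 2 ≤ w) :
    ∃ t ∈ H, t.card ≤ 4 * Fintype.card C + 2 ∧ (∃ i, (z, i) ∈ t) ∧ (∃ i, (q 0, i) ∈ t) ∧
      (∀ u, G.dist z u = 3 → ∃ i, (u, i) ∈ t) ∧
      ∀ a ∈ Q, ∀ u ∉ Q, ∀ i, G.Adj a u → {(a, i)} ∈ residue H t → {(u, i)} ∉ residue H t := by
  classical
  have := Fintype.ofFinite V
  have hd := hG.isLayering z
  have hN : (Finset.univ.filter (fun u => G.dist z u = 3)).card ≤ 2 * Fintype.card C := by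
    refine hH.card_le_of_no_stable_triple (by have : 0 ≤ Fintype.card C := Nat.zero_le _; omega) _
      (fun y hy hyA => ?_)
    by_contra! hcon
    exact hd.no_stable_triple h y hy (i := 0) (fun a => by simpa using hyA a) hcon
  -- The count is `2k` for the saturating pebbles, `2k` for the third layer and two for `z` and `q
  -- 0`.
  obtain ⟨s, hs, hsc, hsat⟩ := hH.exists_saturated Q
  have hA : (insert z (insert (q 0) (Finset.univ.filter (fun u => G.dist z u = 3)))).card ≤
      2 * Fintype.card C + 2 := by
    refine (Finset.card_insert_le _ _).trans ?_
    have := Finset.card_insert_le (q 0) (Finset.univ.filter (fun u => G.dist z u = 3))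
    omega
  obtain ⟨t, ht, hst, htA, htc⟩ := hH.exists_extension hs
    (insert z (insert (q 0) (Finset.univ.filter (fun u => G.dist z u = 3)))) (by omega)
  refine ⟨t, ht, by omega, htA z (by simp), htA (q 0) (by simp), fun u hu => htA u (by simp [hu]),
    ?_⟩
  intro a ha u hu i hau hai hui
  obtain ⟨t', ht', h1, h2⟩ := hai
  -- Either `a` carries a pebble of color `i`, which forbids `i` on `u`, or two vertices `b, b'` of
  -- `Q` carry one. In the latter case `u` misses both, so they are adjacent by `adj_of_missed`,
  -- although they have the same color.
  rcases hsat a ha i ⟨t', ht', h1, hst.trans h2⟩ with has | ⟨b, hb, b', hb', hne, hbs, hbs'⟩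
  · exact hH.not_adj_of_residual (hst has) hui hau
  · have h3 : ¬ G.Adj u b := fun hub => hH.not_adj_of_residual (hst hbs) hui hub.symm
    have h4 : ¬ G.Adj u b' := fun hub => hH.not_adj_of_residual (hst hbs') hui hub.symm
    exact hH.adj hs hbs hbs' (hQ.adj_of_missed h hu ha hau.symm hb h3 hb' h4 hne)

end Consistent

/-- By maximality, a neighbor of `z` lies in `Q` or is complete to `Q`, and a neighbor of a complete
vertex has the same property. So every vertex at distance at most two from `z` lies in `Q` or has a
neighbor there. -/
theorem IsBase.three_le_dist {G : SimpleGraph V} (hG : G.Connected) {Q : Set V} {z : V}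
    {q : Fin 3 → V} (hQ : IsBase G Q z q) {u : V} (hu : ∀ a ∈ Q, ¬ G.Adj u a) (huQ : u ∉ Q) :
    3 ≤ G.dist z u := by
  have hd := hG.isLayering z
  have hno : ∀ r, (∀ a ∈ Q, G.Adj r a) → ¬ G.Adj r u := fun r hr hru =>
    hu _ (hQ.mem 0) (hQ.maximal r u hr huQ hru _ (hQ.mem 0))
  by_contra! hlt
  obtain h0 | h1 | h2 : G.dist z u = 0 ∨ G.dist z u = 0 + 1 ∨ G.dist z u = 1 + 1 := by omega
  · rw [(hd.root u).1 h0] at hu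
    exact hu _ (hQ.mem 0) (hQ.complete _ (hQ.mem 0))
  · obtain ⟨r, hr, hr0⟩ := hd.parent h1
    rw [(hd.root r).1 hr0] at hr
    exact hno z hQ.complete hr
  · obtain ⟨r, hr, hr1⟩ := hd.parent h2
    obtain ⟨r', hr', hr0⟩ := hd.parent hr1
    rw [(hd.root r').1 hr0] at hr'
    by_cases hrQ : r ∈ Q
    · exact hu r hrQ hr.symm
    · exact hno r (hQ.maximal z r hQ.complete hrQ hr') hr

theorem IsBase.dist_le_two {G : SimpleGraph V} (hG : G.Connected) {Q : Set V} {z : V}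
    {q : Fin 3 → V} (hQ : IsBase G Q z q) {u a : V} (ha : a ∈ Q) (hu : G.Adj u a) :
    G.dist z u ≤ 2 := by
  have hd := hG.isLayering z
  have h0 := (hd.root z).2 rfl
  have h1 := hd.le_succ (hQ.complete a ha)
  have h2 := hd.le_succ hu.symm
  omega

end

/-- The number of pebbles that suffices for `k` colors, `j` of which are in use. -/
def pebbles (k j : ℕ) : ℕ := 8 * k ^ 2 + 1 + j * (4 * k + 3)

/-- Relative to a base, the vertices split into `Q`, the complete, the mixed and the anticomplete
ones. Each of the first two parts and each component of the third loses a color by a pebble, so `ih`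
applies. The fourth is colored layer by layer. -/
theorem hasColoring_step {k j : ℕ} (hk : 0 < k)
    (ih : ∀ {V : Type} [Finite V] {G : SimpleGraph V} {w : ℕ} {H : Set (Finset (V × Fin k))}
      {S : Finset (Fin k)}, BullChairFree G → Consistent G w H → UsesOnly H S → S.card ≤ j →
      pebbles k j ≤ w → HasColoring G H Set.univ)
    {V : Type} [Finite V] {G : SimpleGraph V} {w : ℕ} {H : Set (Finset (V × Fin k))}
    {S : Finset (Fin k)} (h : BullChairFree G) (hH : Consistent G w H) (hS : UsesOnly H S)
    (hj : S.card ≤ j + 1) (hw : pebbles k (j + 1) ≤ w) (hG : G.Connected) :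
    HasColoring G H Set.univ := by
  classical
  -- One color fewer pays for the `4 * k + 2` pebbles of `exists_decoupling` and one on a common
  -- neighbor.
  have hww : pebbles k j + (4 * k + 3) ≤ w := by
    unfold pebbles at *
    linarith [add_mul j 1 (4 * k + 3)]
  have hk1 : 8 * k ^ 2 + 1 ≤ pebbles k j := Nat.le_add_right _ _
  have hkk : k ≤ k ^ 2 := Nat.le_self_pow (by norm_num) _
  have part : ∀ {w' : ℕ} {H' : Set (Finset (V × Fin k))}, Consistent G w' H' → H' ⊆ H →
      pebbles k j ≤ w' → ∀ (U : Set V) (i : Fin k), i ∈ S → (∀ u ∈ U, {(u, i)} ∉ H') →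
      HasColoring G H' U := by
    intro w' H' hH' hsub hw' U i hi hU
    refine HasColoring.of_restrict (ih (S := S.erase i) (h.induce U) (hH'.restrict U) ?_
      (by rw [Finset.card_erase_of_mem hi]; omega) hw')
    intro u c hc
    have hc : {(u.1, c)} ∈ H' := by simpa [restrict] using hc
    exact Finset.mem_erase.2 ⟨by rintro rfl; exact hU u u.2 hc, hS _ _ (hsub hc)⟩
  by_cases hclaw : ∀ v (q : Fin 3 → V), Function.Injective q → (∀ i, G.Adj v (q i)) →
      ∃ i j, G.Adj (q i) (q j)
  · exact hH.hasColoring_of_claw_free h hG hclaw (by simpa using hk) (by simp; omega)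
  push Not at hclaw
  obtain ⟨v, q, hinj, hv, hq⟩ := hclaw
  obtain ⟨Q, z, hQ⟩ := exists_isBase hinj hq hv
  have hd := hG.isLayering z
  obtain ⟨t, ht, htc, ⟨iz, hz⟩, ⟨iq, hq0⟩, hN, hdec⟩ :=
    hH.exists_decoupling h hG hQ (by simp; omega)
  rw [Fintype.card_fin] at htc
  have hH₁ := hH.residual ht
  have hsub := hH.residue_subset t
  have hmemS : ∀ {u i}, (u, i) ∈ t → i ∈ S := fun hu =>
    hS _ _ (hH.mono ht (Finset.singleton_subset_iff.2 hu))
  refine HasColoring.mono hsub ?_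
  let π : V → Fin 4 := fun u => if u ∈ Q then 0 else if ∀ a ∈ Q, G.Adj u a then 1 else
    if ∃ a ∈ Q, G.Adj u a then 2 else 3
  have π0 : ∀ {u}, π u = 0 ↔ u ∈ Q := by
    intro u; simp only [π]; split_ifs <;> simp_all
  have π1 : ∀ {u}, π u = 1 → ∀ a ∈ Q, G.Adj u a := by
    intro u; simp only [π]; split_ifs <;> simp_all
  have π2 : ∀ {u}, π u = 2 → u ∉ Q ∧ (∃ a ∈ Q, G.Adj u a) ∧ ∃ b ∈ Q, ¬ G.Adj u b := by
    intro u; simp only [π]; split_ifs <;> simp_all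
  have π3 : ∀ {u}, π u = 3 → u ∉ Q ∧ ∀ a ∈ Q, ¬ G.Adj u a := by
    intro u; simp only [π]; split_ifs <;> simp_all
  refine HasColoring.glue (fun u => π u) ?_ ?_
  · intro i
    have hsimp : {u | ∃ _ : u ∈ Set.univ, π u = i} = {u | π u = i} := by simp
    rw [hsimp]
    fin_cases i
    · refine part hH₁ hsub (by omega) _ iz (hmemS hz) (fun u hu hu' => ?_)
      exact hH.not_adj_of_residual hz hu' (hQ.complete u (π0.1 hu))
    · refine part hH₁ hsub (by omega) _ iq (hmemS hq0) (fun u hu hu' => ?_)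
      exact hH.not_adj_of_residual hq0 hu' (π1 hu _ (hQ.mem 0)).symm
    -- Different components may put their extra pebble on different vertices of `Q`: only the colors
    -- allowed before that pebble matter for gluing, and there are no edges between components.
    · refine HasColoring.of_connected fun K hK hKc => ?_
      obtain ⟨a, ha, haK⟩ := hQ.exists_common h hKc.preconnected (fun x hx => π2 (hK hx))
      obtain ⟨i, t', ht', -, hat⟩ := hH₁.ext hH₁.empty (by simp; omega) a
      have hai : {(a, i)} ∈ residue H t := hH₁.mono ht' (Finset.singleton_subset_iff.2 hat)
      refine HasColoring.mono (hH₁.residue_subset _) (part (hH₁.residual hai)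
        ((hH₁.residue_subset _).trans hsub) (by simp; omega) K i (hS _ _ (hsub hai))
        (fun u hu hu' => ?_))
      exact hH₁.not_adj_of_residual (Finset.mem_singleton_self _) hu' (haK u hu).symm
    · have hset : {u | π u = 3} = {u | 3 ≤ G.dist z u} := by
        ext u
        refine ⟨fun hu => hQ.three_le_dist hG (π3 hu).2 (π3 hu).1, fun hu => ?_⟩
        have hQu : ∀ a ∈ Q, ¬ G.Adj u a := fun a ha hua => by
          have := hQ.dist_le_two hG ha hua
          have : 3 ≤ G.dist z u := hu
          omega
        have huQ : u ∉ Q := fun huQ => by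
          have := SimpleGraph.dist_eq_one_iff_adj.2 (hQ.complete u huQ)
          have : 3 ≤ G.dist z u := hu
          omega
        have h1 : ¬ ∀ a ∈ Q, G.Adj u a := fun hall => hQu _ (hQ.mem 0) (hall _ (hQ.mem 0))
        have h2 : ¬ ∃ a ∈ Q, G.Adj u a := fun ⟨a, ha, hua⟩ => hQu a ha hua
        simp [π, huQ, h1, h2]
      change HasColoring G _ {u | π u = 3}
      rw [hset]
      refine hH₁.hasColoring_of_layers hd.le_succ 3 (2 * k) (fun i hi => ?_) (by omega)
      have := Fintype.ofFinite V
      refine ⟨Finset.univ.filter (fun u => G.dist z u = i), ?_, fun u hu => by simpa using hu⟩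
      refine (hH.card_le_of_no_stable_triple (by simp; omega) _ (fun y hy hyA => ?_)).trans
        (by simp)
      by_contra! hcon
      obtain ⟨i, rfl⟩ := Nat.exists_eq_add_of_le' hi
      exact hd.no_stable_triple h y hy (fun a => by simpa using hyA a) hcon
  -- Edges that leave `Q` are decoupled by `hdec`. By maximality no edge joins a complete vertex to
  -- a mixed or anticomplete one. An edge from a mixed to an anticomplete vertex ends in the third
  -- layer, which is fully pebbled.
  · have hcross : ∀ u w, π u < π w → G.Adj u w → ∀ i, {(u, i)} ∈ residue H t →
        {(w, i)} ∉ residue H t := by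
      intro u w hlt huw i hu hw'
      have hwQ : w ∉ Q := fun hwQ => by
        rw [π0.2 hwQ] at hlt
        exact absurd hlt (Fin.not_lt_zero _)
      by_cases huQ : u ∈ Q
      · exact hdec u huQ w hwQ i huw hu hw'
      obtain h1 | h2 | h3 : π u = 1 ∨ π u = 2 ∨ π u = 3 := by
        have : π u ≠ 0 := fun h => huQ (π0.1 h)
        omega
      · have hwa := hQ.maximal u w (π1 h1) hwQ huw
        have : π w = 1 := by simp only [π, if_neg hwQ, if_pos hwa]
        omega
      · have hw3 : π w = 3 := by omega
        have hge := hQ.three_le_dist hG (π3 hw3).2 (π3 hw3).1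
        obtain ⟨a, ha, hua⟩ := (π2 h2).2.1
        have hle := hQ.dist_le_two hG ha hua
        have := hd.le_succ huw
        obtain ⟨i', hi'⟩ := hN w (by omega)
        rw [hH.eq_of_residual hi' hw'] at hu
        exact hH.not_adj_of_residual hi' hu huw.symm
      · omega
    intro u w huw hne i hu hw'
    rcases lt_or_gt_of_ne hne with hlt | hlt
    · exact hcross u w hlt huw i hu hw'
    · exact hcross w u hlt huw.symm i hw' hu

/-- Local consistency with sufficiently many pebbles decides list coloring of graphs without
induced bulls and chairs. -/
theorem Consistent.hasColoring {k : ℕ} (hk : 0 < k) (j : ℕ) {V : Type} [Finite V]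
    {G : SimpleGraph V} {w : ℕ} {H : Set (Finset (V × Fin k))} {S : Finset (Fin k)}
    (h : BullChairFree G) (hH : Consistent G w H) (hS : UsesOnly H S) (hj : S.card ≤ j)
    (hw : pebbles k j ≤ w) : HasColoring G H Set.univ := by
  induction j generalizing V w S with
  | zero =>
    have hV : IsEmpty V := ⟨fun u => by
      obtain ⟨i, t, ht, -, hi⟩ := hH.ext hH.empty (by unfold pebbles at hw; simp; omega) u
      have := hS _ _ (hH.mono ht (Finset.singleton_subset_iff.2 hi))
      rw [Finset.card_eq_zero.1 (Nat.le_zero.1 hj)] at this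
      simp at this⟩
    exact ⟨fun u => isEmptyElim u.1, fun u => isEmptyElim u.1, fun u => isEmptyElim u.1⟩
  | succ j ih =>
    refine HasColoring.of_connected fun U _ hU => HasColoring.of_restrict
      (hasColoring_step hk ih (h.induce U) (hH.restrict U) ?_ hj hw hU)
    intro u c hc
    exact hS u c (by simpa [_root_.restrict] using hc)

/-! ### Rules for counting the steps of machine programs. -/

/-- From `s`, the program `p` halts within `T` steps in a store with the property `Q`. -/
def Runs (p : Program) (s : Store) (T : ℕ) (Q : Store → Prop) : Prop :=
  ∃ t s', Exec p s t s' ∧ t ≤ T ∧ Q s'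

namespace Runs

variable {p q : Program} {s : Store} {T T' : ℕ} {Q Q' : Store → Prop}

theorem mono (h : Runs p s T Q) (hT : T ≤ T') (hQ : ∀ s', Q s' → Q' s') : Runs p s T' Q' := by
  obtain ⟨t, s', h, ht, hs'⟩ := h
  exact ⟨t, s', h, ht.trans hT, hQ _ hs'⟩

theorem const {r c : ℕ} (h : Q (s.setReg r c)) : Runs (.const r c) s 1 Q :=
  ⟨1, _, .const _ _ _, le_rfl, h⟩

theorem add {r a b : ℕ} (h : Q (s.setReg r (s.reg a + s.reg b))) : Runs (.add r a b) s 1 Q :=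
  ⟨1, _, .add _ _ _ _, le_rfl, h⟩

theorem sub {r a b : ℕ} (h : Q (s.setReg r (s.reg a - s.reg b))) : Runs (.sub r a b) s 1 Q :=
  ⟨1, _, .sub _ _ _ _, le_rfl, h⟩

theorem load {r a : ℕ} (h : Q (s.setReg r (s.mem (s.reg a)))) : Runs (.load r a) s 1 Q :=
  ⟨1, _, .load _ _ _, le_rfl, h⟩

theorem store {a b : ℕ} (h : Q (s.setMem (s.reg a) (s.reg b))) : Runs (.store a b) s 1 Q :=
  ⟨1, _, .store _ _ _, le_rfl, h⟩

theorem skip (h : Q s) : Runs .skip s 1 Q := ⟨1, _, .skip _, le_rfl, h⟩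

theorem seq (h : Runs p s T (fun s' => Runs q s' T' Q)) : Runs (.seq p q) s (T + T') Q := by
  obtain ⟨t, s', h, ht, t', s'', h', ht', hQ⟩ := h
  exact ⟨_, _, .seq h h', by omega, hQ⟩

theorem cond {r : ℕ} (h₁ : s.reg r ≠ 0 → Runs p s T Q) (h₂ : s.reg r = 0 → Runs q s T Q) :
    Runs (.cond r p q) s (T + 1) Q := by
  by_cases h : s.reg r = 0
  · obtain ⟨t, s', h', ht, hQ⟩ := h₂ h
    exact ⟨_, _, .condFalse h h', by omega, hQ⟩
  · obtain ⟨t, s', h', ht, hQ⟩ := h₁ h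
    exact ⟨_, _, .condTrue h h', by omega, hQ⟩

theorem loopDone {r : ℕ} (hr : s.reg r = 0) (h : Q s) : Runs (.loop r p) s 1 Q :=
  ⟨_, _, .loopDone hr, le_rfl, h⟩

theorem loopStep {r : ℕ} (hr : s.reg r ≠ 0)
    (h : Runs p s T (fun s' => Runs (.loop r p) s' T' Q)) :
    Runs (.loop r p) s (T + T' + 1) Q := by
  obtain ⟨t, s', h, ht, t', s'', h', ht', hQ⟩ := h
  exact ⟨_, _, .loopStep hr h h', by omega, hQ⟩

end Runs

theorem Store.reg_setReg (s : Store) (r x r' : ℕ) :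
    (s.setReg r x).reg r' = if r' = r then x else s.reg r' := by
  simp [Store.setReg, Function.update_apply]

@[simp]
theorem Store.mem_setReg (s : Store) (r x : ℕ) : (s.setReg r x).mem = s.mem := rfl

@[simp]
theorem Store.reg_setMem (s : Store) (a x : ℕ) : (s.setMem a x).reg = s.reg := rfl

theorem Store.mem_setMem (s : Store) (a x a' : ℕ) :
    (s.setMem a x).mem a' = if a' = a then x else s.mem a' := by
  simp [Store.setMem, Function.update_apply]

/-- The stores agree on the memory and on the registers below `d`. -/
def Agree (d : ℕ) (s s' : Store) : Prop :=
  s.mem = s'.mem ∧ ∀ r < d, s.reg r = s'.reg r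

theorem Agree.trans {d : ℕ} {s s' s'' : Store} (h : Agree d s s') (h' : Agree d s' s'') :
    Agree d s s'' :=
  ⟨h.1.trans h'.1, fun r hr => (h.2 r hr).trans (h'.2 r hr)⟩

theorem Agree.mono {d d' : ℕ} {s s' : Store} (h : Agree d s s') (hd : d' ≤ d) : Agree d' s s' :=
  ⟨h.1, fun r hr => h.2 r (by omega)⟩

theorem Agree.setReg_left {d : ℕ} {s s' : Store} (h : Agree d s s') {r : ℕ} (hr : d ≤ r) (x : ℕ) :
    Agree d (s.setReg r x) s' :=
  ⟨h.1, fun r' hr' => by rw [Store.reg_setReg, if_neg (by omega), h.2 r' hr']⟩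

/-! ### Expressions and their compilation. -/

/-- Arithmetic expressions over registers and memory. -/
inductive Expr : Type
  | var (r : ℕ) : Expr
  | lit (c : ℕ) : Expr
  | add (a b : Expr) : Expr
  | sub (a b : Expr) : Expr
  | mul (a b : Expr) : Expr
  | div (a b : Expr) : Expr
  | mod (a b : Expr) : Expr
  | read (a : Expr) : Expr

namespace Expr

/-- The value of an expression. -/
def eval (s : Store) : Expr → ℕ
  | var r => s.reg r
  | lit c => c
  | add a b => a.eval s + b.eval s
  | sub a b => a.eval s - b.eval s
  | mul a b => a.eval s * b.eval s
  | div a b => a.eval s / b.eval s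
  | mod a b => a.eval s % b.eval s
  | read a => s.mem (a.eval s)

/-- The number of steps in which an expression is computed. -/
def cost (s : Store) : Expr → ℕ
  | var _ => 2
  | lit _ => 1
  | add a b => a.cost s + (b.cost s + 1)
  | sub a b => a.cost s + (b.cost s + 1)
  | mul a b => a.cost s + (b.cost s + (1 + (1 + ((3 * b.eval s + 1) + (1 + 1)))))
  | div a b => a.cost s + (b.cost s + ((5 * a.eval s + 5 + 1) + (1 + 1)))
  | mod a b => a.cost s + (b.cost s + (5 * a.eval s + 5 + 1))
  | read a => a.cost s + 1

/-- All registers of the expression are below `d`. -/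
def Below (d : ℕ) : Expr → Prop
  | var r => r < d
  | lit _ => True
  | add a b => a.Below d ∧ b.Below d
  | sub a b => a.Below d ∧ b.Below d
  | mul a b => a.Below d ∧ b.Below d
  | div a b => a.Below d ∧ b.Below d
  | mod a b => a.Below d ∧ b.Below d
  | read a => a.Below d

/-- Every subexpression has a value of at most `B`. -/
def Bdd (B : ℕ) (s : Store) : Expr → Prop
  | var r => s.reg r ≤ B
  | lit c => c ≤ B
  | add a b => a.Bdd B s ∧ b.Bdd B s ∧ a.eval s + b.eval s ≤ B
  | sub a b => a.Bdd B s ∧ b.Bdd B s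
  | mul a b => a.Bdd B s ∧ b.Bdd B s ∧ a.eval s * b.eval s ≤ B
  | div a b => a.Bdd B s ∧ b.Bdd B s
  | mod a b => a.Bdd B s ∧ b.Bdd B s
  | read a => a.Bdd B s ∧ s.mem (a.eval s) ≤ B

/-- A bound for the cost of an expression relative to the size of the numbers. -/
def weight : Expr → ℕ
  | var _ => 2
  | lit _ => 1
  | add a b => a.weight + b.weight + 1
  | sub a b => a.weight + b.weight + 1
  | mul a b => a.weight + b.weight + 8
  | div a b => a.weight + b.weight + 13
  | mod a b => a.weight + b.weight + 11
  | read a => a.weight + 1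

theorem Bdd.eval_le {B : ℕ} {s : Store} {e : Expr} (h : e.Bdd B s) : e.eval s ≤ B := by
  induction e with
  | var r => exact h
  | lit c => exact h
  | add a b => exact h.2.2
  | sub a b iha => exact (Nat.sub_le _ _).trans (iha h.1)
  | mul a b => exact h.2.2
  | div a b iha => exact (Nat.div_le_self _ _).trans (iha h.1)
  | mod a b iha => exact (Nat.mod_le _ _).trans (iha h.1)
  | read a => exact h.2

theorem Bdd.cost_le {B : ℕ} {s : Store} {e : Expr} (h : e.Bdd B s) :
    e.cost s ≤ e.weight * (B + 1) := by
  induction e with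
  | var r => simp only [cost, weight]; omega
  | lit c => simp only [cost, weight]; omega
  | add a b iha ihb =>
    have := iha h.1; have := ihb h.2.1
    simp only [cost, weight, add_mul] at *; omega
  | sub a b iha ihb =>
    have := iha h.1; have := ihb h.2
    simp only [cost, weight, add_mul] at *; omega
  | mul a b iha ihb =>
    have := iha h.1; have := ihb h.2.1; have := h.2.1.eval_le
    simp only [cost, weight, add_mul] at *; omega
  | div a b iha ihb =>
    have := iha h.1; have := ihb h.2; have := h.1.eval_le
    simp only [cost, weight, add_mul] at *; omega
  | mod a b iha ihb =>
    have := iha h.1; have := ihb h.2; have := h.1.eval_le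
    simp only [cost, weight, add_mul] at *; omega
  | read a iha =>
    have := iha h.1
    simp only [cost, weight, add_mul] at *; omega

theorem Below.mono {d d' : ℕ} {e : Expr} (h : e.Below d) (hd : d ≤ d') : e.Below d' := by
  induction e with
  | var r => exact lt_of_lt_of_le h hd
  | lit c => trivial
  | read a iha => exact iha h
  | _ a b iha ihb => exact ⟨iha h.1, ihb h.2⟩

theorem eval_congr {d : ℕ} {s s' : Store} {e : Expr} (he : e.Below d) (h : Agree d s s') :
    e.eval s = e.eval s' := by
  induction e with
  | var r => exact h.2 r he
  | lit c => rfl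
  | read a iha => simp only [eval, iha he, h.1]
  | _ a b iha ihb => simp only [eval, iha he.1, ihb he.2]

theorem cost_congr {d : ℕ} {s s' : Store} {e : Expr} (he : e.Below d) (h : Agree d s s') :
    e.cost s = e.cost s' := by
  induction e with
  | var r => rfl
  | lit c => rfl
  | read a iha => simp only [cost, iha he]
  | _ a b iha ihb =>
    simp only [cost, iha he.1, ihb he.2, eval_congr he.1 h, eval_congr he.2 h]

/-- Division with remainder of register `d` by register `d + 1`: the remainder goes to register
`d` and the quotient to register `d + 2`. -/
def divMod (d : ℕ) : Program :=
  .cond (d + 1)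
    -- Register `d + 4` holds `x + 1 - y`, which is nonzero exactly when another subtraction of `y`
    -- from `x` is possible.
    (.seq (.const (d + 2) 0) <| .seq (.const (d + 3) 1) <| .seq (.add (d + 4) d (d + 3)) <|
      .seq (.sub (d + 4) (d + 4) (d + 1)) <|
      .loop (d + 4) <| .seq (.sub d d (d + 1)) <| .seq (.add (d + 2) (d + 2) (d + 3)) <|
        .seq (.add (d + 4) d (d + 3)) (.sub (d + 4) (d + 4) (d + 1)))
    -- For divisor zero the quotient is `0` and the dividend stays as the remainder, as in `Nat`.
    (.const (d + 2) 0)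

/-- The program that computes an expression into register `d`, using no registers below `d`. -/
def compile : Expr → ℕ → Program
  | var r, d => .seq (.const (d + 1) 0) (.add d r (d + 1))
  | lit c, d => .const d c
  | add a b, d => .seq (a.compile d) <| .seq (b.compile (d + 1)) (.add d d (d + 1))
  | sub a b, d => .seq (a.compile d) <| .seq (b.compile (d + 1)) (.sub d d (d + 1))
  | mul a b, d => .seq (a.compile d) <| .seq (b.compile (d + 1)) <| .seq (.const (d + 2) 0) <|
      .seq (.const (d + 3) 1) <|
      .seq (.loop (d + 1) (.seq (.add (d + 2) (d + 2) d) (.sub (d + 1) (d + 1) (d + 3)))) <|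
      .seq (.const (d + 3) 0) (.add d (d + 2) (d + 3))
  | div a b, d => .seq (a.compile d) <| .seq (b.compile (d + 1)) <| .seq (divMod d) <|
      .seq (.const (d + 3) 0) (.add d (d + 2) (d + 3))
  | mod a b, d => .seq (a.compile d) <| .seq (b.compile (d + 1)) (divMod d)
  | read a, d => .seq (a.compile d) (.load d d)

theorem runs_mulLoop (d : ℕ) (x : ℕ) : ∀ (y acc : ℕ) (s : Store), s.reg d = x →
    s.reg (d + 1) = y → s.reg (d + 2) = acc → s.reg (d + 3) = 1 →
    Runs (.loop (d + 1) (.seq (.add (d + 2) (d + 2) d) (.sub (d + 1) (d + 1) (d + 3)))) s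
      (3 * y + 1) (fun s' => Agree d s' s ∧ s'.reg (d + 2) = acc + x * y) := by
  intro y
  induction y with
  | zero =>
    intro acc s _ h1 h2 _
    exact Runs.loopDone h1 ⟨⟨rfl, fun _ _ => rfl⟩, by simpa using h2⟩
  | succ y ih =>
    intro acc s h0 h1 h2 h3
    refine (Runs.loopStep (T := 1 + 1) (T' := 3 * y + 1) (by omega)
      (Runs.seq (Runs.add (Runs.sub ?_)))).mono (by omega) (fun _ h => h)
    refine (ih (acc + x) _ ?_ ?_ ?_ ?_).mono le_rfl ?_
    · simp [Store.reg_setReg, h0]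
    · simp [Store.reg_setReg, h1, h3]
    · simp [Store.reg_setReg, h0, h2]
    · simp [Store.reg_setReg, h3]
    · rintro s' ⟨h4, h5⟩
      refine ⟨h4.trans ?_, by rw [h5]; ring⟩
      exact (Agree.setReg_left (Agree.setReg_left ⟨rfl, fun _ _ => rfl⟩ (by omega) _)
        (by omega) _)

theorem runs_divLoop (d : ℕ) {y : ℕ} (hy : 0 < y) : ∀ (m x q : ℕ) (s : Store), x ≤ m →
    s.reg d = x → s.reg (d + 1) = y → s.reg (d + 2) = q → s.reg (d + 3) = 1 →
    s.reg (d + 4) = x + 1 - y →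
    Runs (.loop (d + 4) <| .seq (.sub d d (d + 1)) <| .seq (.add (d + 2) (d + 2) (d + 3)) <|
        .seq (.add (d + 4) d (d + 3)) (.sub (d + 4) (d + 4) (d + 1))) s
      (5 * m + 1) (fun s' => Agree d s' s ∧ s'.reg d = x % y ∧ s'.reg (d + 2) = q + x / y) := by
  intro m
  induction m with
  | zero =>
    intro x q s hx h0 h1 h2 h3 h4
    obtain rfl : x = 0 := by omega
    exact Runs.loopDone (by omega) ⟨⟨rfl, fun _ _ => rfl⟩, by simpa using h0, by simpa using h2⟩
  | succ m ih =>
    intro x q s hx h0 h1 h2 h3 h4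
    by_cases hxy : x < y
    · refine (Runs.loopDone (by omega) ⟨⟨rfl, fun _ _ => rfl⟩, ?_, ?_⟩).mono (by omega)
        (fun _ h => h)
      · rw [h0, Nat.mod_eq_of_lt hxy]
      · rw [h2, Nat.div_eq_of_lt hxy, add_zero]
    refine (Runs.loopStep (T := 1 + (1 + (1 + 1))) (T' := 5 * m + 1) (by omega)
      (Runs.seq (Runs.sub (Runs.seq (Runs.add (Runs.seq (Runs.add (Runs.sub ?_)))))))).mono
      (by omega) (fun _ h => h)
    refine (ih (x - y) (q + 1) _ (by omega) ?_ ?_ ?_ ?_ ?_).mono le_rfl ?_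
    · simp [Store.reg_setReg, h0, h1]
    · simp [Store.reg_setReg, h1]
    · simp [Store.reg_setReg, h2, h3]
    · simp [Store.reg_setReg, h3]
    · simp [Store.reg_setReg, h0, h1, h3]
    · rintro s' ⟨h5, h6, h7⟩
      refine ⟨h5.trans ?_, ?_, ?_⟩
      · exact Agree.setReg_left (Agree.setReg_left (Agree.setReg_left (Agree.setReg_left
          ⟨rfl, fun _ _ => rfl⟩ (by omega) _) (by omega) _) (by omega) _) (by omega) _
      · rw [h6, ← Nat.mod_eq_sub_mod (by omega)]
      · rw [h7, Nat.div_eq_sub_div hy (by omega : y ≤ x)]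
        omega

theorem runs_divMod {d x y : ℕ} {s : Store} (h0 : s.reg d = x) (h1 : s.reg (d + 1) = y) :
    Runs (divMod d) s (5 * x + 5 + 1)
      (fun s' => Agree d s' s ∧ s'.reg d = x % y ∧ s'.reg (d + 2) = x / y) := by
  refine Runs.cond (fun hne => ?_) (fun heq => ?_)
  · refine (Runs.seq (Runs.const (Runs.seq (Runs.const (Runs.seq (Runs.add
      (Runs.seq (Runs.sub (?_ : Runs _ _ (5 * x + 1) _)))))))) ).mono (by omega) (fun _ h => h)
    refine (runs_divLoop d (y := y) (by omega) x x 0 _ le_rfl ?_ ?_ ?_ ?_ ?_).mono le_rfl ?_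
    · simp [Store.reg_setReg, h0]
    · simp [Store.reg_setReg, h1]
    · simp [Store.reg_setReg]
    · simp [Store.reg_setReg]
    · simp [Store.reg_setReg, h0, h1]
    · rintro s' ⟨h2, h3, h4⟩
      refine ⟨h2.trans ?_, h3, by omega⟩
      exact Agree.setReg_left (Agree.setReg_left (Agree.setReg_left (Agree.setReg_left
          ⟨rfl, fun _ _ => rfl⟩ (by omega) _) (by omega) _) (by omega) _) (by omega) _
  · refine (Runs.const ?_).mono (by omega) (fun _ h => h)
    have hy : y = 0 := by omega
    refine ⟨Agree.setReg_left ⟨rfl, fun _ _ => rfl⟩ (by omega) _, ?_, ?_⟩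
    · simp [Store.reg_setReg, h0, hy]
    · simp [Store.reg_setReg, hy]

/-- The common beginning of all binary operations: computing `b` above register `d` leaves the value
of `a` in `d` intact. -/
theorem runs_pair {a b : Expr} {d : ℕ} {s : Store} (ha : a.Below d) (hb : b.Below d)
    (iha : ∀ {d : ℕ} {s : Store}, a.Below d →
      Runs (a.compile d) s (a.cost s) (fun s' => Agree d s' s ∧ s'.reg d = a.eval s))
    (ihb : ∀ {d : ℕ} {s : Store}, b.Below d →
      Runs (b.compile d) s (b.cost s) (fun s' => Agree d s' s ∧ s'.reg d = b.eval s))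
    {p : Program} {T : ℕ} {Q : Store → Prop} (h : ∀ s', Agree d s' s → s'.reg d = a.eval s →
      s'.reg (d + 1) = b.eval s → Runs p s' T Q) :
    Runs (.seq (a.compile d) (.seq (b.compile (d + 1)) p)) s (a.cost s + (b.cost s + T)) Q := by
  refine Runs.seq ((iha ha).mono le_rfl ?_)
  rintro s₁ ⟨h1, h2⟩
  refine Runs.seq ((ihb (hb.mono (Nat.le_succ d))).mono (cost_congr hb h1).le ?_)
  rintro s₂ ⟨h3, h4⟩
  refine h s₂ ((h3.mono (Nat.le_succ d)).trans h1) ?_ ?_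
  · rw [h3.2 d (Nat.lt_succ_self d), h2]
  · rw [h4, eval_congr hb h1]

theorem runs_compile {e : Expr} {d : ℕ} {s : Store} (he : e.Below d) :
    Runs (e.compile d) s (e.cost s) (fun s' => Agree d s' s ∧ s'.reg d = e.eval s) := by
  induction e generalizing d s with
  | var r =>
    have hr : r < d := he
    refine Runs.seq (Runs.const (Runs.add ⟨?_, ?_⟩))
    · exact Agree.setReg_left (Agree.setReg_left ⟨rfl, fun _ _ => rfl⟩ (by omega) _) (by omega) _
    · simp [Store.reg_setReg, eval]
      omega
  | lit c =>
    exact Runs.const ⟨Agree.setReg_left ⟨rfl, fun _ _ => rfl⟩ le_rfl _, by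
      simp [Store.reg_setReg, eval]⟩
  | add a b iha ihb =>
    refine runs_pair he.1 he.2 iha ihb (fun s' h1 h2 h3 => ?_)
    exact Runs.add ⟨h1.setReg_left le_rfl _, by simp [Store.reg_setReg, eval, h2, h3]⟩
  | sub a b iha ihb =>
    refine runs_pair he.1 he.2 iha ihb (fun s' h1 h2 h3 => ?_)
    exact Runs.sub ⟨h1.setReg_left le_rfl _, by simp [Store.reg_setReg, eval, h2, h3]⟩
  | mul a b iha ihb =>
    refine runs_pair he.1 he.2 iha ihb (fun s' h1 h2 h3 => ?_)
    refine Runs.seq (Runs.const (Runs.seq (Runs.const (Runs.seq ?_))))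
    refine (runs_mulLoop d (a.eval s) (b.eval s) 0 _ ?_ ?_ ?_ ?_).mono le_rfl ?_
    · simp [Store.reg_setReg, h2]
    · simp [Store.reg_setReg, h3]
    · simp [Store.reg_setReg]
    · simp [Store.reg_setReg]
    · rintro s₂ ⟨h4, h5⟩
      refine Runs.seq (Runs.const (Runs.add ⟨?_, ?_⟩))
      · refine Agree.setReg_left (Agree.setReg_left (h4.trans ?_) (by omega) _) (by omega) _
        exact Agree.setReg_left (Agree.setReg_left h1 (by omega) _) (by omega) _
      · simp [Store.reg_setReg, eval, h5]
  | div a b iha ihb =>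
    refine runs_pair he.1 he.2 iha ihb (fun s' h1 h2 h3 => ?_)
    refine Runs.seq ((runs_divMod h2 h3).mono le_rfl ?_)
    rintro s₂ ⟨h4, -, h5⟩
    refine Runs.seq (Runs.const (Runs.add ⟨?_, ?_⟩))
    · exact Agree.setReg_left (Agree.setReg_left (h4.trans h1) (by omega) _) (by omega) _
    · simp [Store.reg_setReg, eval, h5]
  | mod a b iha ihb =>
    refine runs_pair he.1 he.2 iha ihb (fun s' h1 h2 h3 => ?_)
    refine (runs_divMod h2 h3).mono le_rfl ?_
    rintro s₂ ⟨h4, h5, -⟩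
    exact ⟨h4.trans h1, h5⟩
  | read a iha =>
    refine Runs.seq ((iha he).mono le_rfl ?_)
    rintro s' ⟨h1, h2⟩
    exact Runs.load ⟨h1.setReg_left le_rfl _, by simp [Store.reg_setReg, eval, h2, h1.1]⟩

end Expr

/-! ### Commands with bounded loops and their compilation. -/

/-- Commands with assignments, conditionals and bounded loops. In `forBelow r e c`, the register `r`
runs through the numbers below the initial value of `e`. -/
inductive Cmd : Type
  | skip : Cmd
  | assign (r : ℕ) (e : Expr) : Cmd
  | write (a e : Expr) : Cmd
  | seq (c₁ c₂ : Cmd) : Cmd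
  | ite (e : Expr) (c₁ c₂ : Cmd) : Cmd
  | forBelow (r : ℕ) (e : Expr) (c : Cmd) : Cmd

/-- The store after `f 0`, …, `f (i - 1)`. -/
def iterStore (f : ℕ → Store → Store) (s : Store) : ℕ → Store
  | 0 => s
  | i + 1 => f i (iterStore f s i)

namespace Cmd

/-- The effect of a command. -/
def run : Cmd → Store → Store
  | skip, s => s
  | assign r e, s => s.setReg r (e.eval s)
  | write a e, s => s.setMem (a.eval s) (e.eval s)
  | seq c₁ c₂, s => c₂.run (c₁.run s)
  | ite e c₁ c₂, s => if e.eval s ≠ 0 then c₁.run s else c₂.run s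
  | .forBelow r e c, s => iterStore (fun i s' => c.run (s'.setReg r i)) s (e.eval s)

/-- The store at the beginning of the `i`-th iteration of `forBelow r e c`. -/
def before (r : ℕ) (c : Cmd) (s : Store) (i : ℕ) : Store :=
  iterStore (fun i s' => c.run (s'.setReg r i)) s i

/-- The number of steps of a command. -/
def cost : Cmd → Store → ℕ
  | skip, _ => 1
  | assign _ e, s => e.cost s + (1 + 1)
  | write a e, s => a.cost s + (e.cost s + 1)
  | seq c₁ c₂, s => c₁.cost s + c₂.cost (c₁.run s)
  | ite e c₁ c₂, s => e.cost s + ((if e.eval s ≠ 0 then c₁.cost s else c₂.cost s) + 1)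
  | .forBelow r e c, s =>
    e.cost s + (1 + (∑ i ∈ Finset.range (e.eval s), (c.cost ((before r c s i).setReg r i) + 6) + 1))

/-- All registers of the command are below `d`. -/
def Below (d : ℕ) : Cmd → Prop
  | skip => True
  | assign r e => r < d ∧ e.Below d
  | write a e => a.Below d ∧ e.Below d
  | seq c₁ c₂ => c₁.Below d ∧ c₂.Below d
  | ite e c₁ c₂ => e.Below d ∧ c₁.Below d ∧ c₂.Below d
  | .forBelow r e c => r < d ∧ e.Below d ∧ c.Below d

/-- All values that occur in the execution of the command are at most `B`. -/
def Bdd (B : ℕ) : Cmd → Store → Prop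
  | skip, _ => True
  | assign _ e, s => e.Bdd B s
  | write a e, s => a.Bdd B s ∧ e.Bdd B s
  | seq c₁ c₂, s => c₁.Bdd B s ∧ c₂.Bdd B (c₁.run s)
  | ite e c₁ c₂, s => e.Bdd B s ∧ if e.eval s ≠ 0 then c₁.Bdd B s else c₂.Bdd B s
  | .forBelow r e c, s => e.Bdd B s ∧ ∀ i < e.eval s, c.Bdd B ((before r c s i).setReg r i)

/-- The nesting depth of the loops, where the computation of an expression counts as a loop. -/
def depth : Cmd → ℕ
  | skip => 1
  | assign _ _ => 1
  | write _ _ => 1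
  | seq c₁ c₂ => max c₁.depth c₂.depth
  | ite _ c₁ c₂ => max c₁.depth c₂.depth
  | .forBelow _ _ c => c.depth + 1

/-- A bound for the cost of a command relative to the size of the numbers. -/
def weight : Cmd → ℕ
  | skip => 1
  | assign _ e => e.weight + 2
  | write a e => a.weight + e.weight + 1
  | seq c₁ c₂ => c₁.weight + c₂.weight
  | ite e c₁ c₂ => e.weight + c₁.weight + c₂.weight + 1
  | .forBelow _ e c => e.weight + c.weight + 8

theorem one_le_depth (c : Cmd) : 1 ≤ c.depth := by
  induction c with
  | seq c₁ c₂ ih₁ _ => exact ih₁.trans (le_max_left _ _)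
  | ite e c₁ c₂ ih₁ _ => exact ih₁.trans (le_max_left _ _)
  | forBelow r e c ih => exact ih.trans (Nat.le_succ _)
  | _ => exact le_rfl

/-- A loop makes at most `B` iterations because its bound is one of the values that occur, so each
nesting level contributes one factor `B + 1`. -/
theorem Bdd.cost_le {B : ℕ} {c : Cmd} {s : Store} (h : c.Bdd B s) :
    c.cost s ≤ c.weight * (B + 1) ^ c.depth := by
  have pos : ∀ d, 1 ≤ (B + 1) ^ d := fun d => Nat.one_le_pow d _ (Nat.succ_pos B)
  have lin : ∀ {d}, 1 ≤ d → B + 1 ≤ (B + 1) ^ d := fun hd =>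
    Nat.le_self_pow (Nat.one_le_iff_ne_zero.1 hd) _
  induction c generalizing s with
  | skip => simp only [cost, weight, depth, pow_one]; omega
  | assign r e =>
    have := Expr.Bdd.cost_le h
    simp only [cost, weight, depth, pow_one, add_mul] at *; omega
  | write a e =>
    have := Expr.Bdd.cost_le h.1
    have := Expr.Bdd.cost_le h.2
    simp only [cost, weight, depth, pow_one, add_mul] at *; omega
  | seq c₁ c₂ ih₁ ih₂ =>
    rw [cost, weight, depth, add_mul]
    refine Nat.add_le_add ((ih₁ h.1).trans ?_) ((ih₂ h.2).trans ?_)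
    · exact Nat.mul_le_mul_left _ (Nat.pow_le_pow_right (by omega) (le_max_left _ _))
    · exact Nat.mul_le_mul_left _ (Nat.pow_le_pow_right (by omega) (le_max_right _ _))
  | ite e c₁ c₂ ih₁ ih₂ =>
    have h1 : e.cost s ≤ e.weight * (B + 1) ^ (max c₁.depth c₂.depth) :=
      (Expr.Bdd.cost_le h.1).trans
        (Nat.mul_le_mul_left _ (lin ((one_le_depth c₁).trans (le_max_left _ _))))
    have h2 : (if e.eval s ≠ 0 then c₁.cost s else c₂.cost s) ≤
        (c₁.weight + c₂.weight) * (B + 1) ^ (max c₁.depth c₂.depth) := by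
      have h3 := h.2
      split_ifs at h3 ⊢ with he
      · exact (ih₁ h3).trans (Nat.mul_le_mul (Nat.le_add_right _ _)
          (Nat.pow_le_pow_right (by omega) (le_max_left _ _)))
      · exact (ih₂ h3).trans (Nat.mul_le_mul (Nat.le_add_left _ _)
          (Nat.pow_le_pow_right (by omega) (le_max_right _ _)))
    have h3 := pos (max c₁.depth c₂.depth)
    simp only [cost, weight, depth, add_mul] at *
    omega
  | forBelow r e c ih =>
    have h1 : e.cost s ≤ e.weight * (B + 1) ^ (c.depth + 1) :=
      (Expr.Bdd.cost_le h.1).trans (Nat.mul_le_mul_left _ (lin (by omega)))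
    have h2 : ∑ i ∈ Finset.range (e.eval s), (c.cost ((before r c s i).setReg r i) + 6) ≤
        (c.weight + 6) * (B + 1) ^ (c.depth + 1) := by
      refine (Finset.sum_le_card_nsmul _ _ ((c.weight + 6) * (B + 1) ^ c.depth) ?_).trans ?_
      · intro i hi
        have := ih (h.2 i (Finset.mem_range.1 hi))
        have := pos c.depth
        rw [add_mul]
        omega
      · rw [Finset.card_range, smul_eq_mul, pow_succ, mul_comm, ← mul_assoc]
        exact Nat.mul_le_mul_left _ (h.1.eval_le.trans (Nat.le_succ _))
    have h3 := pos (c.depth + 1)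
    simp only [cost, weight, depth, add_mul] at *
    omega

/-- The program of a command; it preserves the registers from the bound of the registers of the
command to `d - 1`. -/
def compile : Cmd → ℕ → Program
  | skip, _ => .skip
  | assign r e, d => .seq (e.compile d) <| .seq (.const (d + 1) 0) (.add r d (d + 1))
  | write a e, d => .seq (a.compile d) <| .seq (e.compile (d + 1)) (.store d (d + 1))
  | seq c₁ c₂, d => .seq (c₁.compile d) (c₂.compile d)
  | ite e c₁ c₂, d => .seq (e.compile d) (.cond d (c₁.compile d) (c₂.compile d))
  -- Register `d` counts the remaining and `d + 1` the completed iterations. The body is compiled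
  -- above the counters, and `r` is reloaded in every iteration, so the body may overwrite it.
  | .forBelow r e c, d => .seq (e.compile d) <| .seq (.const (d + 1) 0) <| .loop d <|
      .seq (.const (d + 2) 0) <| .seq (.add r (d + 1) (d + 2)) <| .seq (c.compile (d + 2)) <|
      .seq (.const (d + 2) 1) <| .seq (.add (d + 1) (d + 1) (d + 2)) (.sub d d (d + 2))

/-- The store `s'` represents `s` and has the same auxiliary registers below `d` as `s₀`. -/
def Represents (d₀ d : ℕ) (s₀ s s' : Store) : Prop :=
  Agree d₀ s' s ∧ ∀ r, d₀ ≤ r → r < d → s'.reg r = s₀.reg r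

theorem Represents.setReg_left {d₀ d : ℕ} {s₀ s s' : Store} (h : Represents d₀ d s₀ s s')
    (hd : d₀ ≤ d) {r : ℕ} (hr : d ≤ r) (x : ℕ) : Represents d₀ d s₀ s (s'.setReg r x) :=
  ⟨h.1.setReg_left (by omega) x, fun r' h1 h2 => by
    rw [Store.reg_setReg, if_neg (by omega), h.2 r' h1 h2]⟩

theorem Represents.setReg {d₀ d : ℕ} {s₀ s s' : Store} (h : Represents d₀ d s₀ s s')
    {r : ℕ} (hr : r < d₀) (x : ℕ) : Represents d₀ d s₀ (s.setReg r x) (s'.setReg r x) :=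
  ⟨⟨h.1.1, fun r' h1 => by rw [Store.reg_setReg, Store.reg_setReg, h.1.2 r' h1]⟩,
    fun r' h1 h2 => by rw [Store.reg_setReg, if_neg (by omega), h.2 r' h1 h2]⟩

theorem Represents.of_agree {d₀ d : ℕ} {s₀ s s' s'' : Store} (h : Represents d₀ d s₀ s s')
    (hd : d₀ ≤ d) (h' : Agree d s'' s') : Represents d₀ d s₀ s s'' :=
  ⟨(h'.mono hd).trans h.1, fun r h1 h2 => (h'.2 r h2).trans (h.2 r h1 h2)⟩

theorem runs_expr {e : Expr} {d₀ d : ℕ} {s₀ s s' : Store} (he : e.Below d₀) (hd : d₀ ≤ d)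
    (h : Represents d₀ d s₀ s s') :
    Runs (e.compile d) s' (e.cost s)
      (fun s'' => Represents d₀ d s₀ s s'' ∧ s''.reg d = e.eval s) :=
  (Expr.runs_compile (he.mono hd)).mono (Expr.cost_congr he h.1).le (fun s'' ⟨h1, h2⟩ =>
    ⟨h.of_agree hd h1, by rw [h2, Expr.eval_congr he h.1]⟩)

theorem runs_compile {c : Cmd} {d₀ d : ℕ} {s₀ s s' : Store} (hc : c.Below d₀) (hd : d₀ ≤ d)
    (h : Represents d₀ d s₀ s s') :
    Runs (c.compile d) s' (c.cost s) (fun s'' => Represents d₀ d s₀ (c.run s) s'') := by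
  induction c generalizing d s₀ s s' with
  | skip => exact Runs.skip h
  | assign r e =>
    refine Runs.seq ((runs_expr hc.2 hd h).mono le_rfl ?_)
    rintro s₁ ⟨h1, h2⟩
    refine Runs.seq (Runs.const (Runs.add ?_))
    have := (h1.setReg_left hd (Nat.le_succ d) 0).setReg hc.1 (e.eval s)
    simpa [Store.reg_setReg, h2, run] using this
  | write a e =>
    refine Runs.seq ((runs_expr hc.1 hd h).mono le_rfl ?_)
    rintro s₁ ⟨h1, h2⟩
    have h1' : Represents d₀ (d + 1) s₁ s s₁ := ⟨h1.1, fun _ _ _ => rfl⟩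
    refine Runs.seq ((runs_expr hc.2 (by omega) h1').mono le_rfl ?_)
    rintro s₂ ⟨h3, h4⟩
    refine Runs.store ⟨⟨?_, fun r hr => h3.1.2 r hr⟩, fun r hr1 hr2 => ?_⟩
    · have h5 := h3.2 d hd (Nat.lt_succ_self d)
      simp only [run, Store.setMem, h3.1.1, h4, h5, h2]
    · exact (h3.2 r hr1 (by omega)).trans (h1.2 r hr1 hr2)
  | seq c₁ c₂ ih₁ ih₂ =>
    exact Runs.seq ((ih₁ hc.1 hd h).mono le_rfl (fun s₁ h1 => ih₂ hc.2 hd h1))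
  | ite e c₁ c₂ ih₁ ih₂ =>
    refine Runs.seq ((runs_expr hc.1 hd h).mono le_rfl ?_)
    rintro s₁ ⟨h1, h2⟩
    refine Runs.cond (fun hne => ?_) (fun heq => ?_)
    · rw [h2] at hne
      simpa only [run, if_pos hne] using ih₁ hc.2.1 hd h1
    · rw [h2] at heq
      simpa only [run, heq, ne_eq, not_true_eq_false, if_false] using ih₂ hc.2.2 hd h1
  | forBelow r e c ih =>
    refine Runs.seq ((runs_expr hc.2.1 hd h).mono le_rfl ?_)
    rintro s₁ ⟨h1, h2⟩
    refine Runs.seq (Runs.const ?_)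
    -- Induction on the number `m` of remaining iterations.
    have key : ∀ (m i : ℕ) (s₁ : Store), i + m = e.eval s → s₁.reg d = m → s₁.reg (d + 1) = i →
        Represents d₀ d s₀ (before r c s i) s₁ →
        Runs (.loop d <| .seq (.const (d + 2) 0) <| .seq (.add r (d + 1) (d + 2)) <|
          .seq (c.compile (d + 2)) <| .seq (.const (d + 2) 1) <|
          .seq (.add (d + 1) (d + 1) (d + 2)) (.sub d d (d + 2))) s₁
          (∑ i ∈ Finset.Ico i (e.eval s), (c.cost ((before r c s i).setReg r i) + 6) + 1)
          (fun s'' => Represents d₀ d s₀ ((Cmd.forBelow r e c).run s) s'') := by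
      intro m
      induction m with
      | zero =>
        intro i s₁ him hm hi hr
        refine (Runs.loopDone hm ?_).mono (by omega) (fun _ h => h)
        rw [add_zero] at him
        rw [him] at hr
        exact hr
      | succ m ihm =>
        intro i s₁ him hm hi hr
        have hrd : r < d₀ := hc.1
        rw [Finset.sum_eq_sum_Ico_succ_bot (by omega)]
        refine (Runs.loopStep (T := 1 + (1 + (c.cost ((before r c s i).setReg r i) + (1 + (1 + 1)))))
          (by omega) (Runs.seq (Runs.const (Runs.seq (Runs.add (Runs.seq ?_)))))).mono
          (T := _ + (∑ i ∈ Finset.Ico (i + 1) (e.eval s),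
            (c.cost ((before r c s i).setReg r i) + 6) + 1) + 1) (by omega) (fun _ h => h)
        have hr₂ := (hr.setReg_left hd (by omega : d ≤ d + 2) 0).setReg hrd i
        rw [show (s₁.setReg (d + 2) 0).reg (d + 1) + (s₁.setReg (d + 2) 0).reg (d + 2) = i by
          simp [Store.reg_setReg, hi]]
        -- The reference store is the current one here, so that the body is known to preserve the
        -- two loop counters along with the counters of the enclosing loops.
        refine (ih (d := d + 2) (s₀ := (s₁.setReg (d + 2) 0).setReg r i) hc.2.2 (by omega)
          ⟨hr₂.1, fun _ _ _ => rfl⟩).mono le_rfl ?_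
        intro s₂ h3
        have h3d : s₂.reg d = m + 1 := by
          rw [h3.2 d hd (by omega), Store.reg_setReg, Store.reg_setReg, if_neg (by omega),
            if_neg (by omega), hm]
        have h3d' : s₂.reg (d + 1) = i := by
          rw [h3.2 (d + 1) (by omega) (by omega), Store.reg_setReg, Store.reg_setReg,
            if_neg (by omega), if_neg (by omega), hi]
        refine Runs.seq (Runs.const (Runs.seq (Runs.add (Runs.sub ?_))))
        refine ihm (i + 1) _ (by omega) ?_ ?_ ?_
        · simp [Store.reg_setReg, h3d]
        · simp [Store.reg_setReg, h3d']
        · have h4 : Represents d₀ d s₀ (before r c s (i + 1)) s₂ :=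
            ⟨h3.1, fun r' hr1 hr2 => (h3.2 r' hr1 (by omega)).trans (hr₂.2 r' hr1 hr2)⟩
          exact ((h4.setReg_left hd (by omega) _).setReg_left hd (by omega) _).setReg_left hd
            le_rfl _
    rw [Finset.range_eq_Ico]
    refine key (e.eval s) 0 _ (by omega) ?_ ?_ ?_
    · simp [Store.reg_setReg, h2]
    · simp [Store.reg_setReg]
    · exact h1.setReg_left hd (by omega) _

/-- The registers that a command may change. -/
def targets : Cmd → List ℕ
  | skip => []
  | assign r _ => [r]
  | write _ _ => []
  | seq c₁ c₂ => c₁.targets ++ c₂.targets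
  | ite _ c₁ c₂ => c₁.targets ++ c₂.targets
  | .forBelow r _ c => r :: c.targets

theorem reg_run {c : Cmd} {r : ℕ} (hr : r ∉ c.targets) (s : Store) :
    (c.run s).reg r = s.reg r := by
  induction c generalizing s with
  | skip => rfl
  | assign r' e =>
    rw [run, Store.reg_setReg, if_neg]
    simpa [targets] using hr
  | write a e => rfl
  | seq c₁ c₂ ih₁ ih₂ =>
    simp only [targets, List.mem_append, not_or] at hr
    rw [run, ih₂ hr.2, ih₁ hr.1]
  | ite e c₁ c₂ ih₁ ih₂ =>
    simp only [targets, List.mem_append, not_or] at hr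
    rw [run]
    split_ifs
    · exact ih₁ hr.1 s
    · exact ih₂ hr.2 s
  | forBelow r' e c ih =>
    simp only [targets, List.mem_cons, not_or] at hr
    rw [run]
    generalize e.eval s = m
    induction m with
    | zero => rfl
    | succ m ihm => rw [iterStore, ih hr.2, Store.reg_setReg, if_neg hr.1, ihm]

end Cmd

/-- From `s`, the command `c` deals only with numbers up to `B` and ends in a store with the
property `Q`. -/
def Ok (B : ℕ) (c : Cmd) (s : Store) (Q : Store → Prop) : Prop :=
  c.Bdd B s ∧ Q (c.run s)

namespace Ok

variable {B : ℕ} {c c₁ c₂ : Cmd} {s : Store} {Q Q' : Store → Prop}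

theorem mono (h : Ok B c s Q) (hQ : ∀ s', Q s' → Q' s') : Ok B c s Q' := ⟨h.1, hQ _ h.2⟩

theorem frame (h : Ok B c s Q) :
    Ok B c s (fun s' => Q s' ∧ ∀ r, r ∉ c.targets → s'.reg r = s.reg r) :=
  ⟨h.1, h.2, fun _ hr => Cmd.reg_run hr s⟩

theorem skip (h : Q s) : Ok B .skip s Q := ⟨trivial, h⟩

theorem assign {r : ℕ} {e : Expr} (he : e.Bdd B s) (h : Q (s.setReg r (e.eval s))) :
    Ok B (.assign r e) s Q := ⟨he, h⟩

theorem write {a e : Expr} (ha : a.Bdd B s) (he : e.Bdd B s)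
    (h : Q (s.setMem (a.eval s) (e.eval s))) : Ok B (.write a e) s Q := ⟨⟨ha, he⟩, h⟩

theorem seq (h : Ok B c₁ s (fun s' => Ok B c₂ s' Q)) : Ok B (.seq c₁ c₂) s Q :=
  ⟨⟨h.1, h.2.1⟩, h.2.2⟩

theorem ite {e : Expr} (he : e.Bdd B s) (h₁ : e.eval s ≠ 0 → Ok B c₁ s Q)
    (h₂ : e.eval s = 0 → Ok B c₂ s Q) : Ok B (.ite e c₁ c₂) s Q := by
  by_cases h : e.eval s = 0
  · obtain ⟨h3, h4⟩ := h₂ h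
    exact ⟨⟨he, by rwa [if_neg (not_not.2 h)]⟩, by rwa [Cmd.run, if_neg (not_not.2 h)]⟩
  · obtain ⟨h3, h4⟩ := h₁ h
    exact ⟨⟨he, by rwa [if_pos h]⟩, by rwa [Cmd.run, if_pos h]⟩

/-- The rule for loops with the invariant `I`. -/
theorem for_loop {r : ℕ} {e : Expr} (I : ℕ → Store → Prop) (he : e.Bdd B s) (h0 : I 0 s)
    (hstep : ∀ i < e.eval s, ∀ s', I i s' → Ok B c (s'.setReg r i) (I (i + 1)))
    (hQ : ∀ s', I (e.eval s) s' → Q s') : Ok B (.forBelow r e c) s Q := by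
  have key : ∀ i ≤ e.eval s, I i (Cmd.before r c s i) := by
    intro i
    induction i with
    | zero => exact fun _ => h0
    | succ i ih => exact fun hi => (hstep i hi _ (ih (by omega))).2
  exact ⟨⟨he, fun i hi => (hstep i hi _ (key i hi.le)).1⟩, hQ _ (key _ le_rfl)⟩

/-- An execution of a command is an execution of its compiled program. -/
theorem exists_exec {d : ℕ} (h : Ok B c s Q) (hc : c.Below d) :
    ∃ t s' s'', Exec (c.compile d) s t s' ∧ t ≤ c.weight * (B + 1) ^ c.depth ∧ Q s'' ∧
      Agree d s' s'' := by
  obtain ⟨t, s', h1, h2, h3⟩ := Cmd.runs_compile (s₀ := s) (s := s) (s' := s) hc le_rfl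
    ⟨⟨rfl, fun _ _ => rfl⟩, fun _ _ _ => rfl⟩
  exact ⟨t, s', c.run s, h1, h2.trans h.1.cost_le, h.2, h3.1⟩

end Ok

/-! ### Tuples as numbers, and closed sets of tuples. -/

/-- The `j`-th digit of `c` to the base `N`. -/
def digit (N c j : ℕ) : ℕ := c / N ^ j % N

section

variable {n k w : ℕ}

/-- The number of a pair of a vertex and a color. -/
def pairCode (x : Fin n × Fin k) : ℕ := x.1 * k + x.2

theorem pairCode_eq (x : Fin n × Fin k) : pairCode x = finProdFinEquiv x := by
  rw [finProdFinEquiv_apply_val, pairCode]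
  ring

theorem pairCode_lt (x : Fin n × Fin k) : pairCode x < n * k := by
  rw [pairCode_eq]
  exact Fin.isLt _

theorem exists_pairCode {p : ℕ} (hp : p < n * k) : ∃ x : Fin n × Fin k, pairCode x = p :=
  ⟨finProdFinEquiv.symm ⟨p, hp⟩, by rw [pairCode_eq, Equiv.apply_symm_apply]⟩

theorem pairCode_injective : Function.Injective (pairCode : Fin n × Fin k → ℕ) := by
  intro x y h
  rw [pairCode_eq, pairCode_eq] at h
  exact finProdFinEquiv.injective (Fin.ext h)

theorem pairCode_div (x : Fin n × Fin k) : pairCode x / k = x.1 := by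
  have := x.2.isLt
  rw [pairCode, add_comm, Nat.add_mul_div_right _ _ (by omega), Nat.div_eq_of_lt this, zero_add]

theorem pairCode_mod (x : Fin n × Fin k) : pairCode x % k = x.2 := by
  rw [pairCode, add_comm, Nat.add_mul_mod_self_right, Nat.mod_eq_of_lt x.2.isLt]

/-- The number of a tuple of pairs. -/
def tupleCode (f : Fin w → Fin n × Fin k) : ℕ := ∑ j, pairCode (f j) * (n * k) ^ (j : ℕ)

theorem tupleCode_eq (f : Fin w → Fin n × Fin k) :
    tupleCode f = finFunctionFinEquiv (fun j => finProdFinEquiv (f j)) := by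
  simp only [tupleCode, finFunctionFinEquiv_apply, pairCode_eq]

theorem tupleCode_lt (f : Fin w → Fin n × Fin k) : tupleCode f < (n * k) ^ w := by
  rw [tupleCode_eq]
  exact Fin.isLt _

theorem exists_tupleCode {c : ℕ} (hc : c < (n * k) ^ w) :
    ∃ f : Fin w → Fin n × Fin k, tupleCode f = c := by
  refine ⟨fun j => finProdFinEquiv.symm (finFunctionFinEquiv.symm ⟨c, hc⟩ j), ?_⟩
  rw [tupleCode_eq]
  simp only [Equiv.apply_symm_apply]

theorem digit_tupleCode (f : Fin w → Fin n × Fin k) (j : Fin w) :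
    digit (n * k) (tupleCode f) j = pairCode (f j) := by
  have h := congrFun (finFunctionFinEquiv.symm_apply_apply (fun j => finProdFinEquiv (f j))) j
  rw [pairCode_eq, ← h, tupleCode_eq]
  rfl

theorem tupleCode_injective : Function.Injective (tupleCode : (Fin w → Fin n × Fin k) → ℕ) := by
  intro f g h
  funext j
  have := digit_tupleCode f j
  rw [h, digit_tupleCode] at this
  exact (pairCode_injective this).symm

theorem tupleCode_update (f : Fin w → Fin n × Fin k) (j : Fin w) (x : Fin n × Fin k) :
    tupleCode (Function.update f j x) + pairCode (f j) * (n * k) ^ (j : ℕ) =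
      tupleCode f + pairCode x * (n * k) ^ (j : ℕ) := by
  rw [tupleCode, tupleCode, ← Finset.add_sum_erase _ _ (Finset.mem_univ j),
    ← Finset.add_sum_erase (a := j) _ (fun i => pairCode (f i) * _) (Finset.mem_univ j),
    Finset.sum_congr rfl (g := fun i : Fin w => pairCode (f i) * (n * k) ^ (i : ℕ))]
  · rw [Function.update_self]
    ring
  · intro i hi
    rw [Function.update_of_ne (Finset.ne_of_mem_erase hi)]

/-- A line in direction `j` is thus an arithmetic progression from its point with digit `0` at `j`,
so the program can run through it without decoding tuples. -/
theorem add_mul_pow_eq_tupleCode (f : Fin w → Fin n × Fin k) (j : Fin w)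
    (h0 : digit (n * k) (tupleCode f) j = 0) (x : Fin n × Fin k) :
    tupleCode f + pairCode x * (n * k) ^ (j : ℕ) = tupleCode (Function.update f j x) := by
  rw [← tupleCode_update, ← digit_tupleCode, h0]
  simp

theorem add_mul_pow_lt {c j p : ℕ} (hc : c < (n * k) ^ w) (hj : j < w)
    (h0 : digit (n * k) c j = 0) (hp : p < n * k) : c + p * (n * k) ^ j < (n * k) ^ w := by
  obtain ⟨f, rfl⟩ := exists_tupleCode hc
  obtain ⟨x, rfl⟩ := exists_pairCode hp
  have := add_mul_pow_eq_tupleCode f ⟨j, hj⟩ h0 x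
  rw [show (n * k) ^ j = (n * k) ^ ((⟨j, hj⟩ : Fin w) : ℕ) from rfl, this]
  exact tupleCode_lt _

/-- If some pair may stand at position `j` of `c`, then for every vertex some color may. -/
def LineClosed (n k : ℕ) (A : Set ℕ) (j c : ℕ) : Prop :=
  ∀ p < n * k, c + p * (n * k) ^ j ∈ A → ∀ u < n, ∃ i < k, c + (u * k + i) * (n * k) ^ j ∈ A

/-- A set of (numbers of) tuples that contain no two bad pairs and in which every entry can be
exchanged for an entry with any given vertex. -/
structure Closed (n k w : ℕ) (Bad : ℕ → ℕ → Prop) (A : Set ℕ) : Prop where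
  lt : ∀ c ∈ A, c < (n * k) ^ w
  good : ∀ c ∈ A, ∀ j₁ < w, ∀ j₂ < w, ¬ Bad (digit (n * k) c j₁) (digit (n * k) c j₂)
  line : ∀ j < w, ∀ c < (n * k) ^ w, digit (n * k) c j = 0 → LineClosed n k A j c

/-- The pairs of assignments that no list coloring contains. -/
def Conflict (G : SimpleGraph (Fin n)) (L : Fin n → Finset (Fin k)) (x y : Fin n × Fin k) : Prop :=
  x.2 ∉ L x.1 ∨ (x.2 ≠ y.2 ∧ x.1 = y.1) ∨ (x.2 = y.2 ∧ G.Adj x.1 y.1)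

variable {G : SimpleGraph (Fin n)} {L : Fin n → Finset (Fin k)} {Bad : ℕ → ℕ → Prop} {A : Set ℕ}

/-- An entry can be exchanged for any vertex `u` together with its color `c u`, so the tuples that
agree with `c` satisfy all conditions. -/
theorem Closed.of_isListColoring
    (hBad : ∀ x y : Fin n × Fin k, Bad (pairCode x) (pairCode y) ↔ Conflict G L x y)
    {c : Fin n → Fin k} (hc : IsListColoring G L c) :
    Closed n k w Bad {a | ∃ f : Fin w → Fin n × Fin k, tupleCode f = a ∧
      ∀ j, (f j).2 = c (f j).1} where
  lt := by
    rintro _ ⟨f, rfl, -⟩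
    exact tupleCode_lt f
  good := by
    rintro _ ⟨f, rfl, hf⟩ j₁ h₁ j₂ h₂
    have e₁ := digit_tupleCode f ⟨j₁, h₁⟩
    have e₂ := digit_tupleCode f ⟨j₂, h₂⟩
    dsimp only at e₁ e₂
    rw [e₁, e₂, hBad]
    rintro (h | ⟨h, h'⟩ | ⟨h, h'⟩)
    · exact h (hf _ ▸ hc.2 _)
    · exact h (by rw [hf, hf, h'])
    · rw [hf, hf] at h
      exact hc.1 _ _ h' h
  line := by
    rintro j hj a ha h0 p hp ⟨f, hfa, hf⟩ u hu
    obtain ⟨g, rfl⟩ := exists_tupleCode ha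
    obtain ⟨x, rfl⟩ := exists_pairCode hp
    have key := add_mul_pow_eq_tupleCode g ⟨j, hj⟩ h0
    have hfg : f = Function.update g ⟨j, hj⟩ x := tupleCode_injective (hfa.trans (key x))
    refine ⟨c ⟨u, hu⟩, (c _).isLt, Function.update g ⟨j, hj⟩ (⟨u, hu⟩, c ⟨u, hu⟩),
      (key (⟨u, hu⟩, c ⟨u, hu⟩)).symm, fun j' => ?_⟩
    by_cases hj' : j' = ⟨j, hj⟩
    · rw [hj', Function.update_self]
    · have := hf j'
      rw [hfg, Function.update_of_ne hj'] at this
      rwa [Function.update_of_ne hj']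

/-- The partial colorings that are contained in a tuple of `A`. -/
def tupleFamily (n k w : ℕ) (A : Set ℕ) : Set (Finset (Fin n × Fin k)) :=
  {s | ∃ f : Fin w → Fin n × Fin k, tupleCode f ∈ A ∧ ∀ x ∈ s, ∃ j, f j = x}

theorem Closed.not_conflict (hA : Closed n k w Bad A)
    (hBad : ∀ x y : Fin n × Fin k, Bad (pairCode x) (pairCode y) ↔ Conflict G L x y)
    {s : Finset (Fin n × Fin k)} (hs : s ∈ tupleFamily n k w A) {x y : Fin n × Fin k}
    (hx : x ∈ s) (hy : y ∈ s) : ¬ Conflict G L x y := by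
  obtain ⟨f, hf, hfs⟩ := hs
  obtain ⟨j₁, rfl⟩ := hfs x hx
  obtain ⟨j₂, rfl⟩ := hfs y hy
  rw [← hBad, ← digit_tupleCode, ← digit_tupleCode]
  exact hA.good _ hf _ j₁.isLt _ j₂.isLt

/-- Entries may repeat, so a tuple stands for all sets of pairs that occur in it. A set with fewer
than `w` pairs leaves a position free, and closedness under lines reassigns that position to the new
vertex. -/
theorem Closed.consistent (hA : Closed n k w Bad A) (hne : A.Nonempty)
    (hBad : ∀ x y : Fin n × Fin k, Bad (pairCode x) (pairCode y) ↔ Conflict G L x y) :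
    Consistent G w (tupleFamily n k w A) where
  empty := by
    obtain ⟨a, ha⟩ := hne
    obtain ⟨f, rfl⟩ := exists_tupleCode (hA.lt a ha)
    exact ⟨f, ha, by simp⟩
  mono := fun ⟨f, hf, h⟩ hst => ⟨f, hf, fun x hx => h x (hst hx)⟩
  func := by
    intro s u i j hs hi hj
    by_contra hij
    exact hA.not_conflict hBad hs hi hj (Or.inr (Or.inl ⟨hij, rfl⟩))
  adj := fun hs hu hv huv => hA.not_conflict hBad hs hu hv (Or.inr (Or.inr ⟨rfl, huv⟩))
  ext := by
    classical
    rintro s ⟨f, hf, hfs⟩ hsw u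
    have hw : 0 < w := by omega
    have : Nonempty (Fin w) := ⟨⟨0, hw⟩⟩
    choose! J hJ using hfs
    obtain ⟨j, hj⟩ : ∃ j : Fin w, j ∉ s.image J := by
      by_contra! hcon
      have := Finset.card_le_card (fun j _ => hcon j : (Finset.univ : Finset (Fin w)) ⊆ s.image J)
      have := Finset.card_image_le (s := s) (f := J)
      simp at *
      omega
    have hpos : 0 < n * k := lt_of_le_of_lt (Nat.zero_le _) (pairCode_lt (f j))
    -- Lines are addressed by their point with digit `0` at `j`, so the entry at `j` is first reset
    -- to the pair with number `0`.
    obtain ⟨x₀, hx₀⟩ := exists_pairCode hpos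
    have h0 : digit (n * k) (tupleCode (Function.update f j x₀)) j = 0 := by
      rw [digit_tupleCode, Function.update_self, hx₀]
    have key := add_mul_pow_eq_tupleCode _ j h0
    simp only [Function.update_idem] at key
    obtain ⟨i, hi, hA'⟩ := hA.line j j.isLt _ (tupleCode_lt _) h0 (pairCode (f j)) (pairCode_lt _)
      (by rw [key, Function.update_eq_self]; exact hf) u u.isLt
    have := key (u, ⟨i, hi⟩)
    simp only [pairCode] at this
    rw [this] at hA'
    refine ⟨⟨i, hi⟩, insert (u, ⟨i, hi⟩) s, ⟨_, hA', fun x hx => ?_⟩, Finset.subset_insert _ _,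
      Finset.mem_insert_self _ _⟩
    rcases Finset.mem_insert.1 hx with rfl | hx
    · exact ⟨j, Function.update_self ..⟩
    · refine ⟨J x, ?_⟩
      rw [Function.update_of_ne, hJ x hx]
      rintro rfl
      exact hj (Finset.mem_image_of_mem _ hx)

/-- With `n` pebbles the whole graph is pebbled at once. In the other case the structure theory
applies. -/
theorem Closed.exists_isListColoring (hk : 0 < k) (h : BullChairFree G)
    (hA : Closed n k w Bad A) (hne : A.Nonempty)
    (hBad : ∀ x y : Fin n × Fin k, Bad (pairCode x) (pairCode y) ↔ Conflict G L x y)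
    (hw : n ≤ w ∨ pebbles k k ≤ w) : ∃ c, IsListColoring G L c := by
  have hH := hA.consistent hne hBad
  have hL : ∀ {v i}, {(v, i)} ∈ tupleFamily n k w A → i ∈ L v := by
    intro v i hvi
    by_contra hcon
    exact hA.not_conflict hBad hvi (Finset.mem_singleton_self _) (Finset.mem_singleton_self _)
      (Or.inl hcon)
  rcases hw with hw | hw
  · obtain ⟨t, ht, -, htc, -⟩ := hH.exists_extension hH.empty Finset.univ (by simpa using hw)
    choose c hc using fun v => htc v (Finset.mem_univ v)
    refine ⟨c, fun u v huv heq => ?_, fun v => hL (hH.mono ht (Finset.singleton_subset_iff.2 (hc v)))⟩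
    have := hc u
    rw [heq] at this
    exact hH.adj ht this (hc v) huv
  · obtain ⟨c, h1, h2⟩ := Consistent.hasColoring hk k h hH (S := Finset.univ)
      (fun _ _ _ => Finset.mem_univ _) (by simp) hw
    exact ⟨fun v => c ⟨v, trivial⟩, fun u v huv => h2 ⟨u, trivial⟩ ⟨v, trivial⟩ huv,
      fun v => hL (h1 ⟨v, trivial⟩)⟩

end

/-! ### The table of conflict-free tuples. -/

namespace Algorithm

/-- The registers that describe the instance have the right values. -/
structure Env (n k w : ℕ) (s : Store) : Prop where
  reg_zero : s.reg 0 = n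
  reg_one : s.reg 1 = n * k
  reg_two : s.reg 2 = w
  reg_three : s.reg 3 = (n * k) ^ w
  reg_four : s.reg 4 = n * n + n * k
  reg_five : s.reg 5 = n * n

/-- `B` bounds all numbers that occur. -/
structure Large (n k w B : ℕ) : Prop where
  k_pos : 0 < k
  k_le : k ≤ B
  w_le : w ≤ B
  table_le : n * n + n * k + (n * k) ^ w ≤ B

/-- The store `s` differs from `s₀` only in the table and in the local registers. -/
structure Inv (n k w : ℕ) (s₀ s : Store) : Prop where
  env : Env n k w s
  regs : ∀ r < 8, s.reg r = s₀.reg r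
  low : ∀ a < n * n + n * k, s.mem a = s₀.mem a
  le_one : ∀ a, s.mem a ≤ 1

theorem Env.setReg {n k w : ℕ} {s : Store} (h : Env n k w s) {r : ℕ} (hr : 6 ≤ r) (x : ℕ) :
    Env n k w (s.setReg r x) := by
  obtain ⟨h0, h1, h2, h3, h4, h5⟩ := h
  constructor <;> rw [Store.reg_setReg, if_neg (by omega)] <;> assumption

theorem Inv.setReg {n k w : ℕ} {s₀ s : Store} (h : Inv n k w s₀ s) {r : ℕ} (hr : 8 ≤ r) (x : ℕ) :
    Inv n k w s₀ (s.setReg r x) where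
  env := h.env.setReg (by omega) x
  regs r' hr' := by rw [Store.reg_setReg, if_neg (by omega), h.regs r' hr']
  low := h.low
  le_one := h.le_one

theorem Inv.setMem {n k w : ℕ} {s₀ s : Store} (h : Inv n k w s₀ s) {a x : ℕ}
    (ha : n * n + n * k ≤ a) (hx : x ≤ 1) : Inv n k w s₀ (s.setMem a x) where
  env := ⟨h.env.1, h.env.2, h.env.3, h.env.4, h.env.5, h.env.6⟩
  regs := h.regs
  low a' ha' := by rw [Store.mem_setMem, if_neg (by omega), h.low a' ha']
  le_one a' := by
    rw [Store.mem_setMem]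
    split_ifs
    · exact hx
    · exact h.le_one a'

/-- The codes of the tuples that are alive. -/
def table (n k w : ℕ) (s : Store) : Set ℕ :=
  {c | c < (n * k) ^ w ∧ s.mem (n * n + n * k + c) ≠ 0}

/-- The expression is nonzero if and only if the two values differ. -/
def differ (a b : Expr) : Expr := .add (.sub a b) (.sub b a)

theorem eval_differ {s : Store} {a b : Expr} : (differ a b).eval s = 0 ↔ a.eval s = b.eval s := by
  simp only [differ, Expr.eval]
  omega

theorem bdd_differ {B : ℕ} {s : Store} {a b : Expr} (ha : a.Bdd B s) (hb : b.Bdd B s) :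
    (differ a b).Bdd B s := by
  refine ⟨⟨ha, hb⟩, ⟨hb, ha⟩, ?_⟩
  have := ha.eval_le
  have := hb.eval_le
  simp only [Expr.eval]
  omega

def initTable : Cmd := .forBelow 9 (.var 3) (.write (.add (.var 4) (.var 9)) (.lit 1))

def kill : Cmd := .write (.add (.var 4) (.var 9)) (.lit 0)

/-- Kill the tuple in register `9` if the pairs in the registers `14` and `15` are in conflict. -/
def checkPair (k : ℕ) : Cmd :=
  .ite (.read (.add (.var 5) (.var 14)))
    (.ite (differ (.mod (.var 14) (.lit k)) (.mod (.var 15) (.lit k)))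
      (.ite (differ (.div (.var 14) (.lit k)) (.div (.var 15) (.lit k))) .skip kill)
      (.ite (.read (.add (.mul (.div (.var 14) (.lit k)) (.var 0)) (.div (.var 15) (.lit k))))
        kill .skip))
    kill

/-- Registers `10` and `12` hold the powers of the base `n * k` for the two positions that are
compared, and `14` and `15` receive the digits there. -/
def checkRow (k : ℕ) : Cmd :=
  .forBelow 13 (.var 2) <| .seq (.assign 14 (.mod (.div (.var 9) (.var 10)) (.var 1))) <|
    .seq (.assign 15 (.mod (.div (.var 9) (.var 12)) (.var 1))) <|
    .seq (checkPair k) (.assign 12 (.mul (.var 12) (.var 1)))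

/-- Kill the tuple in register `9` if it contains a conflict. -/
def checkTuple (k : ℕ) : Cmd :=
  .seq (.assign 10 (.lit 1)) <| .forBelow 11 (.var 2) <| .seq (.assign 12 (.lit 1)) <|
    .seq (checkRow k) (.assign 10 (.mul (.var 10) (.var 1)))

def checkAll (k : ℕ) : Cmd := .forBelow 9 (.var 3) (checkTuple k)

/-- The pairs that are in conflict according to the memory `m`. -/
def Bad (n k : ℕ) (m : ℕ → ℕ) (p q : ℕ) : Prop :=
  m (n * n + p) = 0 ∨ (p % k ≠ q % k ∧ p / k = q / k) ∨ (p % k = q % k ∧ m (p / k * n + q / k) ≠ 0)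

variable {n k w B : ℕ} {s₀ s : Store}

theorem ok_initTable (hB : Large n k w B) (hs : Inv n k w s₀ s) :
    Ok B initTable s (fun s' => Inv n k w s₀ s' ∧
      ∀ c < (n * k) ^ w, s'.mem (n * n + n * k + c) ≠ 0) := by
  have hT := hB.table_le
  have hk := hB.k_pos
  have hk' := hB.k_le
  refine Ok.for_loop (fun i s' => Inv n k w s₀ s' ∧ ∀ c < i, s'.mem (n * n + n * k + c) ≠ 0)
    ?_ ⟨hs, by simp⟩ ?_ (fun s' h => by rwa [Expr.eval, hs.env.reg_three] at h)
  · simp only [Expr.Bdd, hs.env.reg_three]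
    omega
  · rintro i hi s' ⟨h1, h2⟩
    simp only [Expr.eval, hs.env.reg_three] at hi
    have e4 := h1.env.reg_four
    refine Ok.write ?_ ?_ ⟨?_, ?_⟩
    · simp [Expr.Bdd, Expr.eval, Store.reg_setReg, e4]
      omega
    · simp only [Expr.Bdd]; omega
    · exact (h1.setReg (by omega) _).setMem (by simp [Expr.eval, Store.reg_setReg, e4]) le_rfl
    · intro c hc
      simp only [Expr.eval, Store.mem_setMem, Store.mem_setReg]
      split_ifs with h
      · simp
      · simp [Store.reg_setReg, e4] at h
        exact h2 c (by omega)

theorem div_lt_of_lt_mul {p : ℕ} (hp : p < n * k) : p / k < n :=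
  Nat.div_lt_of_lt_mul (by rwa [mul_comm])

theorem mul_add_lt {u v m l : ℕ} (hu : u < m) (hv : v < l) : u * l + v < m * l := by
  calc u * l + v < u * l + l := by omega
    _ = (u + 1) * l := by ring
    _ ≤ m * l := Nat.mul_le_mul_right _ hu

theorem ok_kill {c : ℕ} (hB : Large n k w B) (hs : Inv n k w s₀ s) (hc : c < (n * k) ^ w)
    (h9 : s.reg 9 = c) : Ok B kill s (fun s' => s' = s.setMem (n * n + n * k + c) 0) := by
  have hT := hB.table_le
  refine Ok.write ?_ (Nat.zero_le _) ?_
  · simp only [Expr.Bdd, Expr.eval, hs.env.reg_four, h9]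
    omega
  · simp only [Expr.eval, hs.env.reg_four, h9]

theorem ok_checkPair {c p q : ℕ} (hB : Large n k w B) (hs : Inv n k w s₀ s) (hc : c < (n * k) ^ w)
    (hp : p < n * k) (hq : q < n * k) (h9 : s.reg 9 = c) (h14 : s.reg 14 = p)
    (h15 : s.reg 15 = q) :
    Ok B (checkPair k) s (fun s' => (¬ Bad n k s₀.mem p q ∧ s' = s) ∨
      (Bad n k s₀.mem p q ∧ s' = s.setMem (n * n + n * k + c) 0)) := by
  have hT := hB.table_le
  have hk := hB.k_pos
  have hk' := hB.k_le
  have e0 := hs.env.reg_zero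
  have e5 := hs.env.reg_five
  have hkill : ∀ {Q : Store → Prop}, Q (s.setMem (n * n + n * k + c) 0) → Ok B kill s Q :=
    fun hQ => (ok_kill hB hs hc h9).mono (fun s' h => h ▸ hQ)
  have hle : ∀ a, s.mem a ≤ B := fun a => (hs.le_one a).trans (by omega)
  have hpn := div_lt_of_lt_mul hp
  have hqn := div_lt_of_lt_mul hq
  have hnn : p / k * n + q / k < n * n := mul_add_lt hpn hqn
  have hnn' : p / k * n ≤ n * n := (Nat.le_add_right _ _).trans hnn.le
  have hnle : n ≤ n * n := Nat.le_mul_self n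
  have bp : ∀ (e : Expr), e = .var 14 ∨ e = .var 15 → e.Bdd B s := by
    rintro e (rfl | rfl) <;> simp only [Expr.Bdd] <;> omega
  have bk : (Expr.lit k).Bdd B s := hk'
  refine Ok.ite ?_ (fun h1 => ?_) (fun h1 => ?_)
  · refine ⟨⟨?_, bp _ (Or.inl rfl), ?_⟩, hle _⟩ <;> simp only [Expr.Bdd, Expr.eval] <;> omega
  · simp only [Expr.eval, e5, h14, hs.low (n * n + p) (by omega)] at h1
    refine Ok.ite (bdd_differ ⟨bp _ (Or.inl rfl), bk⟩ ⟨bp _ (Or.inr rfl), bk⟩) (fun h2 => ?_)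
      (fun h2 => ?_)
    · rw [Ne, eval_differ] at h2
      simp only [Expr.eval, h14, h15] at h2
      refine Ok.ite (bdd_differ ⟨bp _ (Or.inl rfl), bk⟩ ⟨bp _ (Or.inr rfl), bk⟩) (fun h3 => ?_)
        (fun h3 => ?_)
      · rw [Ne, eval_differ] at h3
        simp only [Expr.eval, h14, h15] at h3
        refine Ok.skip (Or.inl ⟨?_, rfl⟩)
        simp [Bad, h1, h2, h3]
      · rw [eval_differ] at h3
        simp only [Expr.eval, h14, h15] at h3
        exact hkill (Or.inr ⟨Or.inr (Or.inl ⟨h2, h3⟩), rfl⟩)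
    · rw [eval_differ] at h2
      simp only [Expr.eval, h14, h15] at h2
      refine Ok.ite ?_ (fun h3 => ?_) (fun h3 => ?_)
      · refine ⟨⟨⟨⟨bp _ (Or.inl rfl), bk⟩, ?_, ?_⟩, ⟨bp _ (Or.inr rfl), bk⟩, ?_⟩, hle _⟩ <;>
          simp only [Expr.Bdd, Expr.eval, h14, h15, e0] <;> omega
      · simp only [Expr.eval, h14, h15, e0, hs.low (p / k * n + q / k) (by omega)] at h3
        exact hkill (Or.inr ⟨Or.inr (Or.inr ⟨h2, h3⟩), rfl⟩)
      · simp only [Expr.eval, h14, h15, e0, hs.low (p / k * n + q / k) (by omega)] at h3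
        refine Ok.skip (Or.inl ⟨?_, rfl⟩)
        simp [Bad, h1, h2, h3]
  · simp only [Expr.eval, e5, h14, hs.low (n * n + p) (by omega)] at h1
    exact hkill (Or.inr ⟨Or.inl h1, rfl⟩)

/-- The store `s'` arises from `s` by killing the tuple `c` unless `P` holds. -/
structure Checked (n k w : ℕ) (s₀ : Store) (c : ℕ) (s : Store) (P : Prop) (s' : Store) : Prop where
  inv : Inv n k w s₀ s'
  reg_nine : s'.reg 9 = c
  other : ∀ c', c' ≠ c → s'.mem (n * n + n * k + c') = s.mem (n * n + n * k + c')
  iff : s'.mem (n * n + n * k + c) ≠ 0 ↔ s.mem (n * n + n * k + c) ≠ 0 ∧ P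

theorem Checked.setReg {c : ℕ} {P : Prop} {s' : Store} (h : Checked n k w s₀ c s P s') {r : ℕ}
    (hr : 10 ≤ r) (x : ℕ) : Checked n k w s₀ c s P (s'.setReg r x) where
  inv := h.inv.setReg (by omega) x
  reg_nine := by rw [Store.reg_setReg, if_neg (by omega), h.reg_nine]
  other := h.other
  iff := h.iff

theorem Checked.congr {c : ℕ} {P P' : Prop} {s' : Store} (h : Checked n k w s₀ c s P s')
    (hP : P ↔ P') : Checked n k w s₀ c s P' s' where
  inv := h.inv
  reg_nine := h.reg_nine
  other := h.other
  iff := by rw [h.iff, hP]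

theorem Checked.setMem {c : ℕ} {P P' : Prop} {s' : Store} (h : Checked n k w s₀ c s P s')
    (hP' : ¬ P') : Checked n k w s₀ c s P' (s'.setMem (n * n + n * k + c) 0) where
  inv := h.inv.setMem (by omega) (by omega)
  reg_nine := h.reg_nine
  other c' hc' := by rw [Store.mem_setMem, if_neg (by omega), h.other c' hc']
  iff := by simp [Store.mem_setMem, hP']

/-- The base may be `0`, where powers are not monotone, since `0 ^ 0 = 1`. The hypothesis then
forces `w = 0`. -/
theorem pow_le_of_le (hw : w ≠ 0 → 0 < n * k) {j : ℕ} (hj : j ≤ w) :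
    (n * k) ^ j ≤ (n * k) ^ w := by
  rcases Nat.eq_zero_or_pos (n * k) with h | h
  · have : w = 0 := by
      by_contra h'
      have := hw h'
      omega
    obtain rfl : j = w := by omega
    exact le_rfl
  · exact Nat.pow_le_pow_right h hj

theorem ok_checkRow {c j : ℕ} {P : Prop} (hB : Large n k w B) (hc : c < (n * k) ^ w)
    (hj : j < w) {s' : Store} (h : Checked n k w s₀ c s P s') (h10 : s'.reg 10 = (n * k) ^ j)
    (h12 : s'.reg 12 = 1) :
    Ok B (checkRow k) s' (Checked n k w s₀ c s (P ∧ ∀ j₂ < w,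
      ¬ Bad n k s₀.mem (digit (n * k) c j) (digit (n * k) c j₂))) := by
  have hT := hB.table_le
  have hN : 0 < n * k := by
    by_contra h0
    rw [Nat.eq_zero_of_not_pos h0, zero_pow (by omega)] at hc
    omega
  have e2 := h.inv.env.reg_two
  refine Ok.for_loop (fun i s₁ => Checked n k w s₀ c s (P ∧ ∀ j₂ < i,
      ¬ Bad n k s₀.mem (digit (n * k) c j) (digit (n * k) c j₂)) s₁ ∧
      s₁.reg 10 = (n * k) ^ j ∧ s₁.reg 12 = (n * k) ^ i) ?_ ⟨h.congr (by simp), h10, by simpa⟩ ?_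
      (fun s₁ h₁ => by rw [Expr.eval, e2] at h₁; exact h₁.1)
  · simp only [Expr.Bdd, e2]
    exact hB.w_le
  · rintro i hi s₁ ⟨h1, h2, h3⟩
    simp only [Expr.eval, e2] at hi
    have e1 := h1.inv.env.reg_one
    have e9 := h1.reg_nine
    have hji := pow_le_of_le (fun _ => hN) hj.le
    have hii := pow_le_of_le (fun _ => hN) hi.le
    have hii' := pow_le_of_le (fun _ => hN) hi
    rw [pow_succ] at hii'
    refine Ok.seq (Ok.assign ?_ (Ok.seq (Ok.assign ?_ (Ok.seq ?_))))
    · simp [Expr.Bdd, Store.reg_setReg, e1, e9, h2]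
      omega
    · simp [Expr.Bdd, Store.reg_setReg, e1, e9, h3]
      omega
    · have v1 : (Expr.mod (.div (.var 9) (.var 10)) (.var 1)).eval (s₁.setReg 13 i) =
          digit (n * k) c j := by
        simp [Expr.eval, Store.reg_setReg, e1, e9, h2, digit]
      have v2 : (Expr.mod (.div (.var 9) (.var 12)) (.var 1)).eval
          ((s₁.setReg 13 i).setReg 14 (digit (n * k) c j)) = digit (n * k) c i := by
        simp [Expr.eval, Store.reg_setReg, e1, e9, h3, digit]
      rw [v1, v2]
      have h4 := ((h1.setReg (r := 13) (by omega) i).setReg (r := 14) (by omega)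
        (digit (n * k) c j)).setReg (r := 15) (by omega) (digit (n * k) c i)
      refine (ok_checkPair hB h4.inv hc (Nat.mod_lt _ hN) (Nat.mod_lt _ hN) h4.reg_nine
        (by simp [Store.reg_setReg]; rfl) (by simp [Store.reg_setReg]; rfl)).mono (fun s₂ h₂ => ?_)
      have hreg : s₂.reg 1 = n * k ∧ s₂.reg 12 = (n * k) ^ i ∧ s₂.reg 10 = (n * k) ^ j := by
        rcases h₂ with ⟨-, rfl⟩ | ⟨-, rfl⟩ <;> simp [Store.reg_setReg, e1, h2, h3]
      refine Ok.assign ?_ ⟨?_, ?_, ?_⟩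
      · simp only [Expr.Bdd, Expr.eval, hreg]
        have : n * k ≤ B := by omega
        exact ⟨by omega, this, by omega⟩
      · refine Checked.setReg ?_ (by omega) _
        rcases h₂ with ⟨hbad, rfl⟩ | ⟨hbad, rfl⟩
        · refine h4.congr ?_
          rw [Nat.forall_lt_succ_right]
          tauto
        · refine h4.setMem ?_
          rw [Nat.forall_lt_succ_right]
          tauto
      · simp [Store.reg_setReg, hreg]
      · simp [Store.reg_setReg, hreg, Expr.eval, pow_succ]

/-- The tuple with the number `c` contains no conflict. -/
def Good (n k w : ℕ) (m : ℕ → ℕ) (c : ℕ) : Prop :=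
  ∀ j₁ < w, ∀ j₂ < w, ¬ Bad n k m (digit (n * k) c j₁) (digit (n * k) c j₂)

theorem ok_checkTuple {c : ℕ} (hB : Large n k w B) (hc : c < (n * k) ^ w)
    (h : Inv n k w s₀ s) (h9 : s.reg 9 = c) :
    Ok B (checkTuple k) s (Checked n k w s₀ c s (Good n k w s₀.mem c)) := by
  have hT := hB.table_le
  have hk := hB.k_pos
  have hk' := hB.k_le
  have e2 := h.env.reg_two
  refine Ok.seq (Ok.assign (by simp only [Expr.Bdd]; omega) ?_)
  have e2' : (s.setReg 10 (Expr.eval s (.lit 1))).reg 2 = w := by simp [Store.reg_setReg, e2]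
  refine Ok.for_loop (fun i s₁ => Checked n k w s₀ c s (∀ j₁ < i, ∀ j₂ < w,
      ¬ Bad n k s₀.mem (digit (n * k) c j₁) (digit (n * k) c j₂)) s₁ ∧
      s₁.reg 10 = (n * k) ^ i) ?_ ⟨?_, ?_⟩ ?_
      (fun s₁ h₁ => by rw [Expr.eval, e2'] at h₁; exact h₁.1)
  · simp only [Expr.Bdd, e2']
    exact hB.w_le
  · refine Checked.setReg ⟨h, h9, fun _ _ => rfl, by simp⟩ (by omega) _
  · simp [Store.reg_setReg, Expr.eval]
  · rintro i hi s₁ ⟨h1, h2⟩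
    replace hi : i < w := e2' ▸ hi
    refine Ok.seq (Ok.assign (by simp only [Expr.Bdd]; omega) (Ok.seq ?_))
    refine (ok_checkRow hB hc hi ((h1.setReg (r := 11) (by omega) i).setReg (r := 12) (by omega) 1)
      (by simp [Store.reg_setReg, h2]) (by simp [Store.reg_setReg])).frame.mono ?_
    rintro s₂ ⟨h3, h4⟩
    have hN : 0 < n * k := by
      by_contra h0
      rw [Nat.eq_zero_of_not_pos h0, zero_pow (by omega)] at hc
      omega
    have hii := pow_le_of_le (fun _ => hN) hi.le
    have hii' := pow_le_of_le (fun _ => hN) hi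
    rw [pow_succ] at hii'
    have e1 := h3.inv.env.reg_one
    have e10 : s₂.reg 10 = (n * k) ^ i := by
      rw [h4 10 (by simp [checkRow, checkPair, kill, Cmd.targets])]
      simp [Store.reg_setReg, h2]
    refine Ok.assign ?_ ⟨?_, ?_⟩
    · simp only [Expr.Bdd, Expr.eval, e1, e10]
      have : n * k ≤ B := by omega
      exact ⟨by omega, this, by omega⟩
    · refine Checked.setReg (h3.congr ?_) (by omega) _
      exact Nat.forall_lt_succ_right.symm
    · simp [Store.reg_setReg, e1, e10, Expr.eval, pow_succ]

theorem ok_checkAll (hB : Large n k w B) (hs : Inv n k w s₀ s)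
    (hinit : ∀ c < (n * k) ^ w, s.mem (n * n + n * k + c) ≠ 0) :
    Ok B (checkAll k) s (fun s' => Inv n k w s₀ s' ∧
      table n k w s' = {c | c < (n * k) ^ w ∧ Good n k w s₀.mem c}) := by
  have hT := hB.table_le
  have e3 := hs.env.reg_three
  refine Ok.for_loop (fun i s₁ => Inv n k w s₀ s₁ ∧ ∀ c < (n * k) ^ w,
      (s₁.mem (n * n + n * k + c) ≠ 0 ↔ (c < i → Good n k w s₀.mem c))) ?_ ⟨hs, ?_⟩ ?_ ?_
  · simp only [Expr.Bdd, e3]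
    omega
  · intro c hc
    simp [hinit c hc]
  · rintro i hi s₁ ⟨h1, h2⟩
    simp only [Expr.eval, e3] at hi
    refine (ok_checkTuple hB hi (h1.setReg (r := 9) (by omega) i) (by simp [Store.reg_setReg])).mono
      (fun s₂ h3 => ⟨h3.inv, fun c hc => ?_⟩)
    by_cases hci : c = i
    · subst hci
      rw [h3.iff, Store.mem_setReg, h2 c hc]
      simp
    · rw [h3.other c hci, Store.mem_setReg, h2 c hc]
      have : c < i + 1 ↔ c < i := by omega
      rw [this]
  · rintro s₁ ⟨h1, h2⟩
    refine ⟨h1, ?_⟩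
    rw [Expr.eval, e3] at h2
    ext c
    simp only [table, Set.mem_ofPred_eq]
    refine and_congr_right fun hc => ?_
    rw [h2 c hc]
    simp [hc]

end Algorithm

/-! ### Pruning the table to the largest closed set. -/

namespace Algorithm

/-- Set register `14` if a color is alive for the vertex in register `13`. -/
def checkVertex (k : ℕ) : Cmd :=
  .seq (.assign 14 (.lit 0)) <| .forBelow 15 (.lit k) <|
    .ite (.read (.add (.var 4) (.add (.var 11)
      (.mul (.add (.mul (.var 13) (.lit k)) (.var 15)) (.var 9)))))
    (.assign 14 (.lit 1)) .skip

/-- Set register `12` if the line is closed. -/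
def checkLine (k : ℕ) : Cmd :=
  .seq (.assign 12 (.lit 1)) <| .forBelow 13 (.var 0) <| .seq (checkVertex k) <|
    .ite (.var 14) .skip (.assign 12 (.lit 0))

def killLine : Cmd :=
  .forBelow 16 (.var 1) (.write (.add (.var 4) (.add (.var 11) (.mul (.var 16) (.var 9)))) (.lit 0))

/-- Kill the line through the tuple in register `11` in the direction given by the power of the
base in register `9`, unless it is closed. -/
def lineStep (k : ℕ) : Cmd :=
  .ite (.mod (.div (.var 11) (.var 9)) (.var 1)) .skip <|
    .seq (checkLine k) (.ite (.var 12) .skip killLine)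

def round (k : ℕ) : Cmd :=
  .seq (.assign 9 (.lit 1)) <| .forBelow 10 (.var 2) <| .seq (.forBelow 11 (.var 3) (lineStep k)) <|
    .assign 9 (.mul (.var 9) (.var 1))

/-- As many rounds as there are tuples suffice, since every round that does not start from a closed
table kills a tuple. -/
def rounds (k : ℕ) : Cmd := .forBelow 17 (.var 3) (round k)

/-- Set register `8` if some tuple is alive. -/
def result : Cmd :=
  .seq (.assign 8 (.lit 0)) <| .forBelow 9 (.var 3) <|
    .ite (.read (.add (.var 4) (.var 9))) (.assign 8 (.lit 1)) .skip

/-- Set register `8` if the instance has a list coloring. -/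
def decideColorable (k : ℕ) : Cmd :=
  .seq initTable <| .seq (checkAll k) <| .seq (rounds k) result

variable {n k w B : ℕ} {s₀ s : Store}

theorem table_congr {s' : Store} (h : s'.mem = s.mem) : table n k w s' = table n k w s := by
  simp only [table, h]

theorem table_setReg (r x : ℕ) : table n k w (s.setReg r x) = table n k w s := rfl

theorem pos_of_lt_pow {c j : ℕ} (hj : j < w) (hc : c < (n * k) ^ w) : 0 < n * k := by
  by_contra h0
  rw [Nat.eq_zero_of_not_pos h0, zero_pow (by omega)] at hc
  omega

/-- The local registers of a line. -/
structure OnLine (n k w : ℕ) (s₀ : Store) (c j : ℕ) (s s' : Store) : Prop where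
  inv : Inv n k w s₀ s'
  mem : s'.mem = s.mem
  reg_nine : s'.reg 9 = (n * k) ^ j
  reg_eleven : s'.reg 11 = c

theorem OnLine.setReg {c j : ℕ} {s' : Store} (h : OnLine n k w s₀ c j s s') {r : ℕ} (hr : 12 ≤ r)
    (x : ℕ) : OnLine n k w s₀ c j s (s'.setReg r x) where
  inv := h.inv.setReg (by omega) x
  mem := h.mem
  reg_nine := by rw [Store.reg_setReg, if_neg (by omega), h.reg_nine]
  reg_eleven := by rw [Store.reg_setReg, if_neg (by omega), h.reg_eleven]

theorem ok_checkVertex {c j u : ℕ} (hB : Large n k w B) (hj : j < w) (hc : c < (n * k) ^ w)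
    (h0 : digit (n * k) c j = 0) (hu : u < n) {s' : Store} (h : OnLine n k w s₀ c j s s')
    (h13 : s'.reg 13 = u) :
    Ok B (checkVertex k) s' (fun s'' => OnLine n k w s₀ c j s s'' ∧ s''.reg 14 ≤ 1 ∧
      (s''.reg 14 ≠ 0 ↔ ∃ i < k, c + (u * k + i) * (n * k) ^ j ∈ table n k w s)) := by
  have hT := hB.table_le
  have hk := hB.k_pos
  have hk' := hB.k_le
  have hjj := pow_le_of_le (fun _ => pos_of_lt_pow hj hc) hj.le
  refine Ok.seq (Ok.assign (Nat.zero_le _) ?_)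
  refine Ok.for_loop (fun i s'' => OnLine n k w s₀ c j s s'' ∧ s''.reg 13 = u ∧ s''.reg 14 ≤ 1 ∧
      (s''.reg 14 ≠ 0 ↔ ∃ i' < i, c + (u * k + i') * (n * k) ^ j ∈ table n k w s)) hk'
      ⟨h.setReg (by omega) _, by simp [Store.reg_setReg, h13], by simp [Store.reg_setReg, Expr.eval],
        by simp [Store.reg_setReg, Expr.eval]⟩ ?_ (fun s'' h1 => ⟨h1.1, h1.2.2⟩)
  rintro i hi s₁ ⟨h1, h2, h3, h4⟩
  simp only [Expr.eval] at hi
  have e4 := h1.inv.env.reg_four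
  have e9 := h1.reg_nine
  have e11 := h1.reg_eleven
  have hui := mul_add_lt hu hi
  have hlt := add_mul_pow_lt hc hj h0 hui
  have hmem : (Expr.read (.add (.var 4) (.add (.var 11)
      (.mul (.add (.mul (.var 13) (.lit k)) (.var 15)) (.var 9))))).eval (s₁.setReg 15 i) =
      s.mem (n * n + n * k + (c + (u * k + i) * (n * k) ^ j)) := by
    simp [Expr.eval, Store.reg_setReg, e4, e9, e11, h2, h1.mem]
  have hiff : s.mem (n * n + n * k + (c + (u * k + i) * (n * k) ^ j)) ≠ 0 ↔
      c + (u * k + i) * (n * k) ^ j ∈ table n k w s := by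
    simp only [table, Set.mem_ofPred_eq, hlt, true_and]
  refine Ok.ite ?_ (fun h5 => ?_) (fun h5 => ?_)
  · have hle := (h1.inv.le_one (n * n + n * k + (c + (u * k + i) * (n * k) ^ j)))
    simp [Expr.Bdd, Expr.eval, Store.reg_setReg, e4, e9, e11, h2]
    have := Nat.le_add_right (u * k) i
    have h7 : (n * k) ≤ n * n + n * k := Nat.le_add_left _ _
    have h8 : n ≤ n * k := Nat.le_mul_of_pos_right n hk
    exact ⟨⟨by omega, ⟨by omega, ⟨⟨⟨by omega, hk', by omega⟩, by omega, by omega⟩, by omega, by omega⟩,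
      by omega⟩, by omega⟩, by omega⟩
  · rw [hmem, hiff] at h5
    refine Ok.assign (by simp only [Expr.Bdd]; omega) ⟨(h1.setReg (by omega) _).setReg (by omega) _,
      by simp [Store.reg_setReg, h2], by simp [Store.reg_setReg, Expr.eval], ?_⟩
    simp only [Store.reg_setReg, Expr.eval, if_true, ne_eq, one_ne_zero, not_false_eq_true, true_iff]
    exact ⟨i, Nat.lt_succ_self i, h5⟩
  · rw [hmem] at h5
    have h6 := hiff.not.1 (not_not.2 h5)
    refine Ok.skip ⟨h1.setReg (by omega) _, by simp [Store.reg_setReg, h2],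
      by simp [Store.reg_setReg, h3], ?_⟩
    rw [Store.reg_setReg, if_neg (by omega), h4, Nat.exists_lt_succ_right]
    exact (or_iff_left h6).symm

theorem ok_checkLine {c j : ℕ} (hB : Large n k w B) (hj : j < w) (hc : c < (n * k) ^ w)
    (h0 : digit (n * k) c j = 0) (h : OnLine n k w s₀ c j s s) :
    Ok B (checkLine k) s (fun s' => OnLine n k w s₀ c j s s' ∧ s'.reg 12 ≤ 1 ∧
      (s'.reg 12 ≠ 0 ↔ ∀ u < n, ∃ i < k, c + (u * k + i) * (n * k) ^ j ∈ table n k w s)) := by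
  have hT := hB.table_le
  have hk := hB.k_pos
  have hk' := hB.k_le
  have e0 := h.inv.env.reg_zero
  refine Ok.seq (Ok.assign (by simp only [Expr.Bdd]; omega) ?_)
  have e0' : (s.setReg 12 (Expr.eval s (.lit 1))).reg 0 = n := by simp [Store.reg_setReg, e0]
  refine Ok.for_loop (fun i s' => OnLine n k w s₀ c j s s' ∧ s'.reg 12 ≤ 1 ∧
      (s'.reg 12 ≠ 0 ↔ ∀ u < i, ∃ i < k, c + (u * k + i) * (n * k) ^ j ∈ table n k w s)) ?_
      ⟨h.setReg (by omega) _, by simp [Store.reg_setReg, Expr.eval],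
        by simp [Store.reg_setReg, Expr.eval]⟩ ?_ (fun s' h1 => by
          rw [Expr.eval, e0'] at h1; exact h1)
  · simp only [Expr.Bdd, e0']
    have : n ≤ n * n := Nat.le_mul_self n
    omega
  · rintro u hu s₁ ⟨h1, h2, h3⟩
    replace hu : u < n := e0' ▸ hu
    refine Ok.seq ((ok_checkVertex hB hj hc h0 hu (h1.setReg (r := 13) (by omega) u)
      (by simp [Store.reg_setReg])).frame.mono ?_)
    rintro s₂ ⟨⟨h4, h5, h6⟩, h7⟩
    have e12 : s₂.reg 12 = s₁.reg 12 := by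
      rw [h7 12 (by simp [checkVertex, Cmd.targets])]
      simp [Store.reg_setReg]
    refine Ok.ite (by simp only [Expr.Bdd]; omega) (fun h8 => ?_) (fun h8 => ?_)
    · refine Ok.skip ⟨h4, by omega, ?_⟩
      rw [e12, h3, Nat.forall_lt_succ_right]
      have := h6.1 h8
      tauto
    · refine Ok.assign (Nat.zero_le _) ⟨h4.setReg (by omega) _, by simp [Store.reg_setReg, Expr.eval],
        ?_⟩
      simp only [Store.reg_setReg, Expr.eval, if_true, ne_eq, not_true_eq_false, false_iff]
      exact fun hall => h6.2 (hall u (Nat.lt_succ_self u)) h8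

theorem ok_killLine {c j : ℕ} (hB : Large n k w B) (hj : j < w) (hc : c < (n * k) ^ w)
    (h0 : digit (n * k) c j = 0) (h : OnLine n k w s₀ c j s s) :
    Ok B killLine s (fun s' => Inv n k w s₀ s' ∧
      table n k w s' = table n k w s \ {a | ∃ p < n * k, a = c + p * (n * k) ^ j}) := by
  have hT := hB.table_le
  have e1 := h.inv.env.reg_one
  have hjj := pow_le_of_le (fun _ => pos_of_lt_pow hj hc) hj.le
  refine Ok.for_loop (fun i s' => Inv n k w s₀ s' ∧ s'.reg 9 = (n * k) ^ j ∧ s'.reg 11 = c ∧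
      table n k w s' = table n k w s \ {a | ∃ p < i, a = c + p * (n * k) ^ j}) ?_
      ⟨h.inv, h.reg_nine, h.reg_eleven, by simp⟩ ?_ (fun s' h1 => by
        rw [Expr.eval, e1] at h1; exact ⟨h1.1, h1.2.2.2⟩)
  · simp only [Expr.Bdd, e1]
    omega
  · rintro p hp s₁ ⟨h1, h2, h3, h4⟩
    replace hp : p < n * k := e1 ▸ hp
    have e4 := h1.env.reg_four
    have hlt := add_mul_pow_lt hc hj h0 hp
    have haddr : (Expr.add (.var 4) (.add (.var 11) (.mul (.var 16) (.var 9)))).eval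
        (s₁.setReg 16 p) = n * n + n * k + (c + p * (n * k) ^ j) := by
      simp [Expr.eval, Store.reg_setReg, e4, h2, h3]
    refine Ok.write ?_ (Nat.zero_le _) ?_
    · simp [Expr.Bdd, Expr.eval, Store.reg_setReg, e4, h2, h3]
      omega
    · rw [haddr]
      refine ⟨(h1.setReg (by omega) _).setMem (by omega) (Nat.zero_le _), h2, h3, ?_⟩
      have : table n k w s \ {a | ∃ p' < p + 1, a = c + p' * (n * k) ^ j} =
          table n k w s₁ \ {c + p * (n * k) ^ j} := by
        rw [h4]
        ext a
        simp only [Set.mem_sdiff, Set.mem_ofPred_eq, Set.mem_singleton_iff,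
          Nat.exists_lt_succ_right, not_or, and_assoc]
      rw [this]
      ext a
      simp only [table, Set.mem_sdiff, Set.mem_ofPred_eq, Set.mem_singleton_iff, Store.mem_setMem,
        Store.mem_setReg, Expr.eval]
      by_cases ha : a = c + p * (n * k) ^ j
      · simp [ha]
      · rw [if_neg (by omega)]
        simp [ha]

/-- Only tuples that no closed set contains have been killed, among them all that contain a
conflict. -/
structure Sound (n k w : ℕ) (s₀ s : Store) : Prop where
  inv : Inv n k w s₀ s
  closed_subset : ∀ X, Closed n k w (Bad n k s₀.mem) X → X ⊆ table n k w s
  good : ∀ c ∈ table n k w s, Good n k w s₀.mem c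

theorem Sound.congr {s' : Store} (h : Sound n k w s₀ s) (hs' : Inv n k w s₀ s')
    (hmem : s'.mem = s.mem) : Sound n k w s₀ s' where
  inv := hs'
  closed_subset X hX := by rw [table_congr hmem]; exact h.closed_subset X hX
  good := by rw [table_congr hmem]; exact h.good

/-- Killing is sound: if a closed set inside the table contained a point of the line, its own
exchange property would supply, for every vertex, a color on the line within the table, and the line
would have passed the check. -/
theorem ok_lineStep {c j : ℕ} (hB : Large n k w B) (hj : j < w) (hc : c < (n * k) ^ w)
    (h : Sound n k w s₀ s) (h9 : s.reg 9 = (n * k) ^ j) (h11 : s.reg 11 = c) :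
    Ok B (lineStep k) s (fun s' => Sound n k w s₀ s' ∧ table n k w s' ⊆ table n k w s ∧
      (table n k w s' = table n k w s → digit (n * k) c j = 0 →
        LineClosed n k (table n k w s) j c)) := by
  have hT := hB.table_le
  have hk := hB.k_pos
  have hk' := hB.k_le
  have e1 := h.inv.env.reg_one
  have hjj := pow_le_of_le (fun _ => pos_of_lt_pow hj hc) hj.le
  have hdig : (Expr.mod (.div (.var 11) (.var 9)) (.var 1)).eval s = digit (n * k) c j := by
    simp [Expr.eval, e1, h9, h11, digit]
  refine Ok.ite ?_ (fun h1 => ?_) (fun h1 => ?_)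
  · simp only [Expr.Bdd, e1, h9, h11]
    omega
  · rw [hdig] at h1
    exact Ok.skip ⟨h, subset_rfl, fun _ h2 => absurd h2 h1⟩
  · rw [hdig] at h1
    refine Ok.seq ((ok_checkLine hB hj hc h1 ⟨h.inv, rfl, h9, h11⟩).mono ?_)
    rintro s₁ ⟨h2, h3, h4⟩
    have htab := table_congr (n := n) (k := k) (w := w) h2.mem
    refine Ok.ite (by simp only [Expr.Bdd]; omega) (fun h5 => ?_) (fun h5 => ?_)
    · exact Ok.skip ⟨h.congr h2.inv h2.mem, htab.subset, fun _ _ _ _ _ => h4.1 h5⟩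
    · have h6 : ¬ ∀ u < n, ∃ i < k, c + (u * k + i) * (n * k) ^ j ∈ table n k w s :=
        fun hall => h4.2 hall h5
      refine (ok_killLine hB hj hc h1 ⟨h2.inv, rfl, h2.reg_nine, h2.reg_eleven⟩).mono ?_
      rintro s₂ ⟨h7, h8⟩
      rw [htab] at h8
      refine ⟨⟨h7, fun X hX a ha => ?_, fun a ha => h.good a ?_⟩, ?_, fun heq _ p hp hpa => ?_⟩
      · rw [h8]
        refine ⟨h.closed_subset X hX ha, ?_⟩
        rintro ⟨p, hp, rfl⟩
        refine h6 fun u hu => ?_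
        obtain ⟨i, hi, hX'⟩ := hX.line j hj c hc h1 p hp ha u hu
        exact ⟨i, hi, h.closed_subset X hX hX'⟩
      · rw [h8] at ha
        exact ha.1
      · rw [h8]
        exact Set.sdiff_subset
      -- If killing the line does not change the table, then no point of the line was alive, and it
      -- is closed for a trivial reason.
      · rw [← heq, h8] at hpa
        exact absurd ⟨p, hp, rfl⟩ hpa.2

/-- The table changes during the round, but it only shrinks. If it is the same at the end, it was
the same throughout, and all line checks were made on one and the same table. -/
theorem ok_round (hB : Large n k w B) (h : Sound n k w s₀ s) :
    Ok B (round k) s (fun s' => Sound n k w s₀ s' ∧ table n k w s' ⊆ table n k w s ∧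
      (table n k w s' = table n k w s → Closed n k w (Bad n k s₀.mem) (table n k w s))) := by
  have hT := hB.table_le
  have hk := hB.k_pos
  have hk' := hB.k_le
  refine Ok.seq (Ok.assign (by simp only [Expr.Bdd]; omega) ?_)
  have e2' : (s.setReg 9 (Expr.eval s (.lit 1))).reg 2 = w := by
    simp [Store.reg_setReg, h.inv.env.reg_two]
  refine Ok.for_loop (fun i s' => Sound n k w s₀ s' ∧ table n k w s' ⊆ table n k w s ∧
      s'.reg 9 = (n * k) ^ i ∧ (table n k w s' = table n k w s → ∀ j < i, ∀ c < (n * k) ^ w,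
      digit (n * k) c j = 0 → LineClosed n k (table n k w s) j c)) ?_
      ⟨h.congr (h.inv.setReg (by omega) _) rfl, (table_congr rfl).subset,
        by simp [Store.reg_setReg, Expr.eval], by simp⟩ ?_ ?_
  · simp only [Expr.Bdd, e2']
    exact hB.w_le
  · rintro j hj s₁ ⟨h1, h2, h3, h4⟩
    replace hj : j < w := e2' ▸ hj
    have e3 : (s₁.setReg 10 j).reg 3 = (n * k) ^ w := by
      simp [Store.reg_setReg, h1.inv.env.reg_three]
    refine Ok.seq (Ok.for_loop (fun i s' => Sound n k w s₀ s' ∧ table n k w s' ⊆ table n k w s₁ ∧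
      s'.reg 9 = (n * k) ^ j ∧ (table n k w s' = table n k w s₁ → ∀ c < i,
      digit (n * k) c j = 0 → LineClosed n k (table n k w s₁) j c)) ?_
      ⟨h1.congr (h1.inv.setReg (by omega) _) rfl, (table_congr rfl).subset,
        by simp [Store.reg_setReg, h3], by simp⟩ ?_ ?_)
    · simp only [Expr.Bdd, e3]
      omega
    · rintro c hc s₂ ⟨h5, h6, h7, h8⟩
      replace hc : c < (n * k) ^ w := e3 ▸ hc
      refine (ok_lineStep hB hj hc (h5.congr (h5.inv.setReg (r := 11) (by omega) c) rfl)
        (by simp [Store.reg_setReg, h7]) (by simp [Store.reg_setReg])).frame.mono ?_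
      rintro s₃ ⟨⟨h9, h10, h11⟩, h12⟩
      have htab : table n k w (s₂.setReg 11 c) = table n k w s₂ := table_congr rfl
      rw [htab] at h10 h11
      refine ⟨h9, h10.trans h6, ?_, fun heq => ?_⟩
      · rw [h12 9 (by simp [lineStep, checkLine, checkVertex, killLine, Cmd.targets])]
        simp [Store.reg_setReg, h7]
      · have heq₂ : table n k w s₂ = table n k w s₁ := h6.antisymm (heq ▸ h10)
        rw [Nat.forall_lt_succ_right]
        refine ⟨h8 heq₂, ?_⟩
        rw [← heq₂]
        exact h11 (heq.trans heq₂.symm)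
    · rintro s₂ ⟨h5, h6, h7, h8⟩
      rw [Expr.eval, e3] at h8
      have e1 := h5.inv.env.reg_one
      have hv : (Expr.mul (.var 9) (.var 1)).eval s₂ = (n * k) ^ (j + 1) := by
        simp [Expr.eval, h7, e1, pow_succ]
      refine Ok.assign ?_ ⟨h5.congr (h5.inv.setReg (by omega) _) rfl, ?_, ?_, fun heq => ?_⟩
      -- The base `0` is treated separately here, because no tuple is at hand to rule it out.
      · have hpos : w ≠ 0 → 0 < n * k ∨ (n * k) ^ w = 0 := fun hw => by
          rcases Nat.eq_zero_or_pos (n * k) with h0 | h0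
          · exact Or.inr (by rw [h0, zero_pow hw])
          · exact Or.inl h0
        have : n * k ≤ B := by omega
        rcases hpos (by omega) with h0 | h0
        · have hjj := pow_le_of_le (fun _ => h0) hj.le
          have hjj' := pow_le_of_le (fun _ => h0) hj
          rw [pow_succ] at hjj'
          simp only [Expr.Bdd, Expr.eval, h7, e1]
          exact ⟨by omega, this, by omega⟩
        · have h0' : n * k = 0 := by
            by_contra hne
            exact pow_ne_zero w hne h0
          have : (n * k) ^ j ≤ 1 := by
            rw [h0']
            exact pow_le_one₀ (by omega) (by omega)
          simp only [Expr.Bdd, Expr.eval, h7, e1]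
          refine ⟨by omega, by omega, ?_⟩
          rw [h0', mul_zero]
          omega
      · rw [table_setReg]
        exact h6.trans h2
      · rw [Store.reg_setReg, if_pos rfl, hv]
      · rw [table_setReg] at heq
        have heq₁ : table n k w s₁ = table n k w s := h2.antisymm (heq ▸ h6)
        rw [Nat.forall_lt_succ_right]
        refine ⟨h4 heq₁, ?_⟩
        rw [← heq₁]
        exact h8 (heq.trans heq₁.symm)
  · rintro s' ⟨h1, h2, -, h3⟩
    rw [Expr.eval, e2'] at h3
    exact ⟨h1, h2, fun heq => ⟨fun c hc => hc.1, h.good, h3 heq⟩⟩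

theorem ok_rounds (hB : Large n k w B) (h : Sound n k w s₀ s) :
    Ok B (rounds k) s (fun s' => Sound n k w s₀ s' ∧
      Closed n k w (Bad n k s₀.mem) (table n k w s')) := by
  have hT := hB.table_le
  have e3 := h.inv.env.reg_three
  have hfin : ∀ s', (table n k w s').Finite := fun s' =>
    (Set.finite_lt_nat ((n * k) ^ w)).subset fun c hc => hc.1
  refine Ok.for_loop (fun i s' => Sound n k w s₀ s' ∧
    (Closed n k w (Bad n k s₀.mem) (table n k w s') ∨ (table n k w s').ncard + i ≤ (n * k) ^ w))
    ?_ ⟨h, Or.inr ?_⟩ ?_ ?_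
  · simp only [Expr.Bdd, e3]
    omega
  · rw [add_zero, ← Set.ncard_Iio_nat ((n * k) ^ w)]
    exact Set.ncard_le_ncard (fun c hc => hc.1) (Set.finite_lt_nat _)
  · rintro i - s₁ ⟨h1, h2⟩
    refine (ok_round hB (h1.congr (h1.inv.setReg (r := 17) (by omega) i) rfl)).mono ?_
    rintro s₂ ⟨h3, h4, h5⟩
    rw [table_setReg] at h4 h5
    refine ⟨h3, ?_⟩
    by_cases hcl : Closed n k w (Bad n k s₀.mem) (table n k w s₁)
    · left
      -- A closed table survives the next round, because no member of a closed set is ever killed.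
      rwa [h4.antisymm (h3.closed_subset _ hcl)]
    · right
      have := Set.ncard_lt_ncard (h4.ssubset_of_ne fun heq => hcl (h5 heq)) (hfin s₁)
      have := h2.resolve_left hcl
      omega
  · rintro s' ⟨h1, h2⟩
    refine ⟨h1, h2.elim id fun h3 => ?_⟩
    rw [Expr.eval, e3] at h3
    -- If every round has killed a tuple, none is left, and the empty table is closed.
    have hempty : table n k w s' = ∅ := (Set.ncard_eq_zero (hfin s')).1 (by omega)
    rw [hempty]
    exact ⟨fun _ h => h.elim, fun _ h => h.elim, fun _ _ _ _ _ _ _ h => h.elim⟩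

theorem ok_result (hB : Large n k w B) (h : Inv n k w s₀ s) :
    Ok B result s (fun s' => Inv n k w s₀ s' ∧ s'.reg 8 ≤ 1 ∧
      (s'.reg 8 ≠ 0 ↔ (table n k w s).Nonempty)) := by
  have hT := hB.table_le
  have hk := hB.k_pos
  have hk' := hB.k_le
  have e3' : (s.setReg 8 (Expr.eval s (.lit 0))).reg 3 = (n * k) ^ w := by
    simp [Store.reg_setReg, h.env.reg_three]
  refine Ok.seq (Ok.assign (Nat.zero_le _) ?_)
  refine Ok.for_loop (fun i s' => Inv n k w s₀ s' ∧ s'.mem = s.mem ∧ s'.reg 8 ≤ 1 ∧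
      (s'.reg 8 ≠ 0 ↔ ∃ c < i, c ∈ table n k w s)) ?_
      ⟨h.setReg (by omega) _, rfl, by simp [Store.reg_setReg, Expr.eval],
        by simp [Store.reg_setReg, Expr.eval]⟩ ?_ ?_
  · simp only [Expr.Bdd, e3']
    omega
  · rintro c hc s₁ ⟨h1, h2, h3, h4⟩
    replace hc : c < (n * k) ^ w := e3' ▸ hc
    have e4 := h1.env.reg_four
    have hmem : (Expr.read (.add (.var 4) (.var 9))).eval (s₁.setReg 9 c) =
        s.mem (n * n + n * k + c) := by
      simp [Expr.eval, Store.reg_setReg, e4, h2]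
    have hiff : s.mem (n * n + n * k + c) ≠ 0 ↔ c ∈ table n k w s := by
      simp only [table, Set.mem_ofPred_eq, hc, true_and]
    refine Ok.ite ?_ (fun h5 => ?_) (fun h5 => ?_)
    · have := h1.le_one (n * n + n * k + c)
      simp [Expr.Bdd, Expr.eval, Store.reg_setReg, e4]
      omega
    · rw [hmem, hiff] at h5
      refine Ok.assign (by simp only [Expr.Bdd]; omega)
        ⟨(h1.setReg (by omega) _).setReg (by omega) _, h2, by simp [Store.reg_setReg, Expr.eval], ?_⟩
      simp only [Store.reg_setReg, Expr.eval, if_true, ne_eq, one_ne_zero, not_false_eq_true,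
        true_iff]
      exact ⟨c, Nat.lt_succ_self c, h5⟩
    · rw [hmem] at h5
      have h6 := hiff.not.1 (not_not.2 h5)
      refine Ok.skip ⟨h1.setReg (by omega) _, h2, by simp [Store.reg_setReg, h3], ?_⟩
      rw [Store.reg_setReg, if_neg (by omega), h4, Nat.exists_lt_succ_right]
      exact (or_iff_left h6).symm
  · rintro s' ⟨h1, -, h3, h4⟩
    rw [Expr.eval, e3'] at h4
    exact ⟨h1, h3, h4.trans ⟨fun ⟨c, _, hc⟩ => ⟨c, hc⟩, fun ⟨c, hc⟩ => ⟨c, hc.1, hc⟩⟩⟩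

theorem ok_decideColorable (hB : Large n k w B) (h : Inv n k w s s) :
    Ok B (decideColorable k) s (fun s' => Inv n k w s s' ∧ s'.reg 8 ≤ 1 ∧
      (s'.reg 8 ≠ 0 ↔ ∃ A : Set ℕ, Closed n k w (Bad n k s.mem) A ∧ A.Nonempty)) := by
  refine Ok.seq ((ok_initTable hB h).mono ?_)
  rintro s₁ ⟨h1, h2⟩
  refine Ok.seq ((ok_checkAll hB h1 h2).mono ?_)
  rintro s₂ ⟨h3, h4⟩
  have hsound : Sound n k w s s₂ := by
    refine ⟨h3, fun X hX c hc => ?_, fun c hc => ?_⟩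
    · rw [h4]
      exact ⟨hX.lt c hc, hX.good c hc⟩
    · rw [h4] at hc
      exact hc.2
  refine Ok.seq ((ok_rounds hB hsound).mono ?_)
  rintro s₃ ⟨h5, h6⟩
  refine (ok_result hB h5.inv).mono ?_
  rintro s₄ ⟨h7, h8, h9⟩
  refine ⟨h7, h8, h9.trans ⟨fun hne => ⟨_, h6, hne⟩, ?_⟩⟩
  rintro ⟨A, hA, hne⟩
  exact hne.mono (h5.closed_subset A hA)

end Algorithm

/-! ### From deciding to finding a coloring. -/

namespace Algorithm

/-- The lists that are stored in the memory `m`. -/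
def listOf (n k : ℕ) (m : ℕ → ℕ) (v : Fin n) : Finset (Fin k) :=
  Finset.univ.filter fun i => m (n * n + pairCode (v, i)) ≠ 0

/-- The memory `m` holds the adjacency matrix of `G`. -/
def HoldsGraph {n : ℕ} (G : SimpleGraph (Fin n)) (m : ℕ → ℕ) : Prop :=
  ∀ x : Fin n × Fin n, m (pairCode x) ≠ 0 ↔ G.Adj x.1 x.2

variable {n k w B : ℕ} {s₀ s : Store} {G : SimpleGraph (Fin n)} {L : Fin n → Finset (Fin k)}
  {m : ℕ → ℕ}

theorem mem_listOf {x : Fin n × Fin k} :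
    x.2 ∈ listOf n k m x.1 ↔ m (n * n + pairCode x) ≠ 0 := by
  simp [listOf]

theorem listOf_congr {m' : ℕ → ℕ} (h : ∀ p < n * k, m' (n * n + p) = m (n * n + p)) :
    listOf n k m' = listOf n k m := by
  funext v
  ext i
  rw [mem_listOf (x := (v, i)), mem_listOf (x := (v, i)), h _ (pairCode_lt _)]

theorem HoldsGraph.congr {m' : ℕ → ℕ} (h : HoldsGraph G m) (hm : ∀ a < n * n, m' a = m a) :
    HoldsGraph G m' := fun x => by rw [hm _ (pairCode_lt x), h x]

theorem bad_iff (h : HoldsGraph G m) (x y : Fin n × Fin k) :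
    Bad n k m (pairCode x) (pairCode y) ↔ Conflict G (listOf n k m) x y := by
  simp only [Bad, Conflict, pairCode_div, pairCode_mod, mem_listOf, not_not, ne_eq, Fin.val_inj,
    ← h (x.1, y.1)]
  rfl

theorem exists_closed_iff (hk : 0 < k) (hG : BullChairFree G) (h : HoldsGraph G m) (hwn : w ≤ n)
    (hw : n ≤ w ∨ pebbles k k ≤ w) :
    (∃ A : Set ℕ, Closed n k w (Bad n k m) A ∧ A.Nonempty) ↔
      ∃ c, IsListColoring G (listOf n k m) c := by
  constructor
  · rintro ⟨A, hA, hne⟩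
    exact hA.exists_isListColoring hk hG hne (bad_iff h) hw
  · rintro ⟨c, hc⟩
    exact ⟨_, Closed.of_isListColoring (bad_iff h) hc, _,
      -- The closed set is nonempty because `w ≤ n` provides a vertex for every position, also when
      -- `n = 0`.
      fun j => (j.castLE hwn, c (j.castLE hwn)), rfl, fun _ => rfl⟩

theorem _root_.IsListColoring.mono {L' : Fin n → Finset (Fin k)} {c : Fin n → Fin k}
    (h : IsListColoring G L' c) (hL : ∀ v, L' v ⊆ L v) : IsListColoring G L c :=
  ⟨h.1, fun v => hL v (h.2 v)⟩

/-- Colors have been removed from the lists such that, among the first `i` pairs, only those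
remain that every list coloring uses. -/
structure Filtered (n k w : ℕ) (G : SimpleGraph (Fin n)) (L : Fin n → Finset (Fin k)) (i : ℕ)
    (s : Store) : Prop where
  env : Env n k w s
  le_one : ∀ a, s.mem a ≤ 1
  graph : HoldsGraph G s.mem
  subset : ∀ v, listOf n k s.mem v ⊆ L v
  colorable : (∃ c, IsListColoring G L c) → ∃ c, IsListColoring G (listOf n k s.mem) c
  critical : ∀ x : Fin n × Fin k, pairCode x < i → x.2 ∈ listOf n k s.mem x.1 →
    ∀ c, IsListColoring G (listOf n k s.mem) c → c x.1 = x.2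

/-- Remove the color of the pair in register `6` from the list of its vertex, unless this makes
the instance infeasible. -/
def filterStep (k : ℕ) : Cmd :=
  .seq (.assign 7 (.read (.add (.var 5) (.var 6)))) <|
    .seq (.write (.add (.var 5) (.var 6)) (.lit 0)) <| .seq (decideColorable k) <|
    .ite (.var 8) .skip (.write (.add (.var 5) (.var 6)) (.var 7))

theorem Inv.refl (h : Env n k w s) (h' : ∀ a, s.mem a ≤ 1) : Inv n k w s s :=
  ⟨h, fun _ _ => rfl, fun _ _ => rfl, h'⟩

theorem Inv.holdsGraph (h : Inv n k w s₀ s) (hG : HoldsGraph G s₀.mem) : HoldsGraph G s.mem :=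
  hG.congr fun a ha => h.low a (by omega)

theorem Inv.listOf_eq (h : Inv n k w s₀ s) : listOf n k s.mem = listOf n k s₀.mem :=
  listOf_congr fun p hp => h.low _ (by omega)

theorem ok_decide (hB : Large n k w B) (hG : BullChairFree G) (hwn : w ≤ n)
    (hw : n ≤ w ∨ pebbles k k ≤ w) (he : Env n k w s) (h1 : ∀ a, s.mem a ≤ 1)
    (hm : HoldsGraph G s.mem) :
    Ok B (decideColorable k) s (fun s' => Inv n k w s s' ∧ s'.reg 8 ≤ 1 ∧
      (s'.reg 8 ≠ 0 ↔ ∃ c, IsListColoring G (listOf n k s.mem) c)) := by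
  simpa only [exists_closed_iff hB.k_pos hG hm hwn hw] using
    ok_decideColorable hB (Inv.refl he h1)

/-- A color is put back only if no coloring avoids it. Colorings for smaller lists are colorings for
the larger ones, so earlier pairs stay critical. An infeasible instance gets all its colors back. -/
theorem ok_filterStep {i : ℕ} (hB : Large n k w B) (hG : BullChairFree G) (hwn : w ≤ n)
    (hw : n ≤ w ∨ pebbles k k ≤ w) (h : Filtered n k w G L i s) (hi : i < n * k) :
    Ok B (filterStep k) (s.setReg 6 i) (Filtered n k w G L (i + 1)) := by
  have hT := hB.table_le
  have e5 := h.env.reg_five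
  have hpos : 0 < (n * k) ^ w := Nat.pow_pos (by omega)
  refine Ok.seq (Ok.assign ?_ ?_)
  · have := h.le_one (n * n + i)
    simp [Expr.Bdd, Expr.eval, Store.reg_setReg, e5]
    omega
  have hv : (Expr.read (.add (.var 5) (.var 6))).eval (s.setReg 6 i) = s.mem (n * n + i) := by
    simp [Expr.eval, Store.reg_setReg, e5]
  rw [hv]
  set s₁ := (s.setReg 6 i).setReg 7 (s.mem (n * n + i)) with hs₁
  have env₁ : Env n k w s₁ := (h.env.setReg (by omega) _).setReg (by omega) _
  have e6 : s₁.reg 6 = i := by simp [hs₁, Store.reg_setReg]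
  have e7 : s₁.reg 7 = s.mem (n * n + i) := by simp [hs₁, Store.reg_setReg]
  have m₁ : s₁.mem = s.mem := rfl
  refine Ok.seq (Ok.write ?_ (Nat.zero_le _) ?_)
  · simp only [Expr.Bdd, Expr.eval, e6, env₁.reg_five]
    omega
  have ha : (Expr.add (.var 5) (.var 6)).eval s₁ = n * n + i := by
    simp only [Expr.eval, e6, env₁.reg_five]
  rw [ha]
  set s₂ := s₁.setMem (n * n + i) ((Expr.lit 0).eval s₁) with hs₂
  have m₂ : ∀ a, s₂.mem a = if a = n * n + i then 0 else s.mem a := fun a => by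
    rw [hs₂, Store.mem_setMem, m₁]
    rfl
  have env₂ : Env n k w s₂ := ⟨env₁.1, env₁.2, env₁.3, env₁.4, env₁.5, env₁.6⟩
  have le₂ : ∀ a, s₂.mem a ≤ 1 := fun a => by
    rw [m₂]
    split_ifs
    · exact Nat.zero_le _
    · exact h.le_one a
  have graph₂ : HoldsGraph G s₂.mem := h.graph.congr fun a ha => by rw [m₂, if_neg (by omega)]
  have mem₂ : ∀ x : Fin n × Fin k, x.2 ∈ listOf n k s₂.mem x.1 ↔
      x.2 ∈ listOf n k s.mem x.1 ∧ pairCode x ≠ i := fun x => by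
    rw [mem_listOf, mem_listOf, m₂]
    by_cases hx : pairCode x = i
    · simp [hx]
    · rw [if_neg (by omega)]
      simp [hx]
  have sub₂ : ∀ v, listOf n k s₂.mem v ⊆ listOf n k s.mem v := fun v j hj =>
    ((mem₂ (v, j)).1 hj).1
  refine Ok.seq ((ok_decide hB hG hwn hw env₂ le₂ graph₂).mono ?_)
  rintro s₃ ⟨h3, h8, hiff⟩
  have l₃ := h3.listOf_eq
  have g₃ := h3.holdsGraph graph₂
  refine Ok.ite (by simp only [Expr.Bdd]; omega) (fun h9 => ?_) (fun h9 => ?_)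
  · refine Ok.skip ⟨h3.env, h3.le_one, g₃, fun v => ?_, fun _ => ?_, fun x hx hxl c hc => ?_⟩
    · rw [l₃]
      exact (sub₂ v).trans (h.subset v)
    · rw [l₃]
      exact hiff.1 h9
    · rw [l₃] at hxl hc
      rw [mem₂] at hxl
      exact h.critical x (by omega) hxl.1 c (hc.mono sub₂)
  · have h10 : ¬ ∃ c, IsListColoring G (listOf n k s₂.mem) c := fun h' => hiff.2 h' h9
    have e6' : s₃.reg 6 = i := (h3.regs 6 (by omega)).trans e6
    have e7' : s₃.reg 7 = s.mem (n * n + i) := (h3.regs 7 (by omega)).trans e7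
    refine Ok.write ?_ ?_ ?_
    · simp only [Expr.Bdd, Expr.eval, e6', h3.env.reg_five]
      omega
    · have := h.le_one (n * n + i)
      simp only [Expr.Bdd, e7']
      omega
    have ha' : (Expr.add (.var 5) (.var 6)).eval s₃ = n * n + i := by
      simp only [Expr.eval, e6', h3.env.reg_five]
    rw [ha', Expr.eval, e7']
    have l₄ : listOf n k (s₃.setMem (n * n + i) (s.mem (n * n + i))).mem = listOf n k s.mem :=
      listOf_congr fun p hp => by
        rw [Store.mem_setMem]
        split_ifs with h11
        · rw [h11]
        · rw [h3.low _ (by omega), m₂, if_neg h11]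
    refine ⟨⟨h3.env.1, h3.env.2, h3.env.3, h3.env.4, h3.env.5, h3.env.6⟩, fun a => ?_,
      g₃.congr fun a ha => ?_, fun v => ?_, ?_, fun x hx hxl c hc => ?_⟩
    · rw [Store.mem_setMem]
      split_ifs
      · exact h.le_one _
      · exact h3.le_one _
    · rw [Store.mem_setMem, if_neg (by omega)]
    · rw [l₄]
      exact h.subset v
    · rw [l₄]
      exact h.colorable
    · rw [l₄] at hxl hc
      rcases Nat.lt_succ_iff_lt_or_eq.1 hx with hx | hx
      · exact h.critical x hx hxl c hc
      · by_contra hne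
        refine h10 ⟨c, hc.1, fun v => (mem₂ (v, c v)).2 ⟨hc.2 v, fun hv => hne ?_⟩⟩
        have := pairCode_injective (hv.trans hx.symm)
        rw [← this]

/-- Remove colors from the lists as long as the instance remains feasible. -/
def filter (k : ℕ) : Cmd := .forBelow 6 (.var 1) (filterStep k)

theorem ok_filter (hB : Large n k w B) (hG : BullChairFree G) (hwn : w ≤ n)
    (hw : n ≤ w ∨ pebbles k k ≤ w) (h : Filtered n k w G L 0 s) :
    Ok B (filter k) s (Filtered n k w G L (n * k)) := by
  have hT := hB.table_le
  have e1 := h.env.reg_one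
  refine Ok.for_loop (fun i s' => Filtered n k w G L i s') ?_ h (fun i hi s' h1 => ?_)
    (fun s' h1 => by rwa [Expr.eval, e1] at h1)
  · simp only [Expr.Bdd, e1]
    omega
  · rw [Expr.eval, e1] at hi
    exact ok_filterStep hB hG hwn hw h1 hi

/-- Write down the coloring that the lists describe. -/
def output (k : ℕ) : Cmd :=
  .forBelow 6 (.var 1) <| .ite (.read (.add (.var 5) (.var 6)))
    (.write (.div (.var 6) (.lit k)) (.mod (.var 6) (.lit k))) .skip

/-- All remaining pairs are used by every coloring, so the lists of a feasible instance determine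
it. The answer overwrites part of the adjacency matrix, but not the lists, which start at `n * n`.
-/
theorem ok_output (hB : Large n k w B) (h : Filtered n k w G L (n * k) s) :
    Ok B (output k) s (fun s' => s'.reg 8 = s.reg 8 ∧
      ∀ c, IsListColoring G (listOf n k s.mem) c → ∀ v : Fin n, s'.mem v = c v) := by
  have hT := hB.table_le
  have hk := hB.k_pos
  have hk' := hB.k_le
  have e1 := h.env.reg_one
  refine Ok.for_loop (fun i s' => Env n k w s' ∧ s'.reg 8 = s.reg 8 ∧
    (∀ a, n * n ≤ a → s'.mem a = s.mem a) ∧ ∀ c, IsListColoring G (listOf n k s.mem) c →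
      ∀ v : Fin n, pairCode (v, c v) < i → s'.mem v = c v) ?_ ⟨h.env, rfl, fun _ _ => rfl, ?_⟩ ?_ ?_
  · simp only [Expr.Bdd, e1]
    omega
  · intro c _ v hv
    omega
  · rintro i hi s₁ ⟨h1, h2, h3, h4⟩
    rw [Expr.eval, e1] at hi
    obtain ⟨x, rfl⟩ := exists_pairCode hi
    have e5 := h1.reg_five
    have hread : (Expr.read (.add (.var 5) (.var 6))).eval (s₁.setReg 6 (pairCode x)) =
        s.mem (n * n + pairCode x) := by
      simp [Expr.eval, Store.reg_setReg, e5, h3]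
    have hpos : 0 < (n * k) ^ w := Nat.pow_pos (by omega)
    refine Ok.ite ?_ (fun h5 => ?_) (fun h5 => ?_)
    · have := h.le_one (n * n + pairCode x)
      simp [Expr.Bdd, Expr.eval, Store.reg_setReg, e5, h3]
      omega
    · rw [hread, ← mem_listOf] at h5
      have hd : (Expr.div (.var 6) (.lit k)).eval (s₁.setReg 6 (pairCode x)) = x.1 := by
        simp [Expr.eval, Store.reg_setReg, pairCode_div]
      have hm : (Expr.mod (.var 6) (.lit k)).eval (s₁.setReg 6 (pairCode x)) = x.2 := by
        simp [Expr.eval, Store.reg_setReg, pairCode_mod]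
      refine Ok.write ?_ ?_ ?_
      · simp [Expr.Bdd, Store.reg_setReg]
        omega
      · simp [Expr.Bdd, Store.reg_setReg]
        omega
      · rw [hd, hm]
        have h6 := h1.setReg (r := 6) (by omega) (pairCode x)
        refine ⟨⟨h6.1, h6.2, h6.3, h6.4, h6.5, h6.6⟩, h2, fun a ha => ?_, fun c hc v hv => ?_⟩
        · have : (x.1 : ℕ) < n * n := x.1.isLt.trans_le (Nat.le_mul_self n)
          rw [Store.mem_setMem, if_neg (ha.trans_lt' this).ne', Store.mem_setReg, h3 a ha]
        · rw [Store.mem_setMem]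
          split_ifs with h7
          · rw [Fin.val_inj] at h7
            rw [h7, h.critical x hi h5 c hc]
          · refine h4 c hc v (lt_of_le_of_ne (Nat.lt_succ_iff.1 hv) fun heq => h7 ?_)
            have := pairCode_injective heq
            rw [← this]
    · rw [hread] at h5
      refine Ok.skip ⟨h1.setReg (by omega) _, h2, h3, fun c hc v hv => ?_⟩
      refine h4 c hc v (lt_of_le_of_ne (Nat.lt_succ_iff.1 hv) fun heq => ?_)
      have := (mem_listOf (x := (v, c v))).1 (hc.2 v)
      rw [heq] at this
      exact this h5
  · rintro s' ⟨-, h2, -, h4⟩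
    rw [Expr.eval, e1] at h4
    exact ⟨h2, fun c hc v => h4 c hc v (pairCode_lt _)⟩

/-- Compute the registers that describe the instance. -/
def setup (k : ℕ) : Cmd :=
  .seq (.assign 1 (.mul (.var 0) (.lit k))) <|
    -- With truncated subtraction, `a - (a - n)` is `min n a`.
    .seq (.assign 2 (.sub (.lit (pebbles k k)) (.sub (.lit (pebbles k k)) (.var 0)))) <|
    .seq (.assign 3 (.lit 1)) <| .seq (.forBelow 9 (.var 2) (.assign 3 (.mul (.var 3) (.var 1)))) <|
    .seq (.assign 5 (.mul (.var 0) (.var 0))) (.assign 4 (.add (.var 5) (.var 1)))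

theorem ok_setup (hB : Large n k w B) (hw : w = min n (pebbles k k)) (hp : pebbles k k ≤ B)
    (h0 : s.reg 0 = n) :
    Ok B (setup k) s (fun s' => Env n k w s' ∧ s'.mem = s.mem) := by
  have hT := hB.table_le
  have hk := hB.k_pos
  have hk' := hB.k_le
  have hn : n ≤ n * n := Nat.le_mul_self n
  have hpow : ∀ i ≤ w, (n * k) ^ i ≤ (n * k) ^ w := fun i hi =>
    pow_le_of_le (fun h => Nat.mul_pos (by omega) hk) hi
  have hone := hpow 0 (Nat.zero_le _)
  rw [pow_zero] at hone
  refine Ok.seq (Ok.assign ?_ (Ok.seq (Ok.assign ?_ (Ok.seq (Ok.assign ?_ ?_)))))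
  · simp only [Expr.Bdd, Expr.eval, h0]
    omega
  · simp [Expr.Bdd, Expr.eval, Store.reg_setReg, h0]
    omega
  · simp only [Expr.Bdd]
    omega
  set s₁ := Store.setReg _ 3 _ with hs₁
  have e0 : s₁.reg 0 = n := by simp [hs₁, Store.reg_setReg, h0]
  have e1 : s₁.reg 1 = n * k := by simp [hs₁, Store.reg_setReg, Expr.eval, h0]
  have e2 : s₁.reg 2 = w := by
    simp [hs₁, Store.reg_setReg, Expr.eval, h0]
    omega
  have e3 : s₁.reg 3 = 1 := by simp [hs₁, Store.reg_setReg, Expr.eval]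
  have m₁ : s₁.mem = s.mem := rfl
  refine Ok.seq (Ok.for_loop (fun i s' => s'.reg 0 = n ∧ s'.reg 1 = n * k ∧ s'.reg 2 = w ∧
    s'.reg 3 = (n * k) ^ i ∧ s'.mem = s.mem) ?_ ⟨e0, e1, e2, by rw [e3, pow_zero], m₁⟩ ?_ ?_)
  · simp only [Expr.Bdd, e2]
    omega
  · rintro i hi s₂ ⟨h1, h2, h3, h4, h5⟩
    rw [Expr.eval, e2] at hi
    have hi' := hpow i hi.le
    have hi'' := hpow (i + 1) hi
    rw [pow_succ] at hi''
    refine Ok.assign ?_ ?_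
    · simp [Expr.Bdd, Expr.eval, Store.reg_setReg, h2, h4]
      omega
    · simp [Expr.eval, Store.reg_setReg, h1, h2, h3, h4, h5, pow_succ]
  · rintro s₂ ⟨h1, h2, h3, h4, h5⟩
    rw [Expr.eval, e2] at h4
    refine Ok.seq (Ok.assign ?_ (Ok.assign ?_ ?_))
    · simp only [Expr.Bdd, Expr.eval, h1]
      omega
    · simp [Expr.Bdd, Expr.eval, Store.reg_setReg, h1, h2]
      omega
    · refine ⟨⟨?_, ?_, ?_, ?_, ?_, ?_⟩, h5⟩ <;>
        simp [Expr.eval, Store.reg_setReg, h1, h2, h3, h4]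

/-- Solve the instance. -/
def solve (k : ℕ) : Cmd :=
  -- The decision is repeated after filtering because register `8` may still hold the answer for an
  -- instance from which a needed color was removed.
  .seq (setup k) <| .seq (filter k) <| .seq (decideColorable k) <| .seq (output k) <|
    .assign 0 (.var 8)

theorem holdsGraph_inputStore : HoldsGraph G (inputStore G L).mem := by
  rintro ⟨u, v⟩
  have hlt := pairCode_lt (u, v)
  simp only [inputStore, ne_eq, ite_eq_right_iff, one_ne_zero, imp_false, not_not]
  constructor
  · rintro (⟨u', v', h, h'⟩ | ⟨v', i, h, -⟩)
    · have := pairCode_injective (a₁ := (u, v)) (a₂ := (u', v')) h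
      rw [Prod.mk.injEq] at this
      rwa [this.1, this.2]
    · omega
  · exact fun h => Or.inl ⟨u, v, rfl, h⟩

theorem listOf_inputStore : listOf n k (inputStore G L).mem = L := by
  funext v
  ext i
  rw [mem_listOf (x := (v, i))]
  simp only [inputStore, ne_eq, ite_eq_right_iff, one_ne_zero, imp_false, not_not]
  constructor
  · rintro (⟨u', v', h, h'⟩ | ⟨v', i', h, h'⟩)
    · have := pairCode_lt (u', v')
      simp only [pairCode] at this h
      omega
    · have := pairCode_injective (a₁ := (v, i)) (a₂ := (v', i')) (by simp only [pairCode] at h ⊢; omega)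
      rw [Prod.mk.injEq] at this
      rwa [this.1, this.2]
  · exact fun h => Or.inr ⟨v, i, by simp [pairCode, add_assoc], h⟩

theorem inputStore_le_one (a : ℕ) : (inputStore G L).mem a ≤ 1 := by
  simp only [inputStore]
  split_ifs <;> omega

theorem ok_solve (hB : Large n k w B) (hw : w = min n (pebbles k k)) (hp : pebbles k k ≤ B)
    (hG : BullChairFree G) : Ok B (solve k) (inputStore G L) (IsAnswer G L) := by
  have hT := hB.table_le
  have hpos : 0 < (n * k) ^ w := by
    rcases Nat.eq_zero_or_pos n with h | h
    · rw [show w = 0 by omega, pow_zero]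
      exact one_pos
    · exact Nat.pow_pos (Nat.mul_pos h hB.k_pos)
  have hwn : w ≤ n := by omega
  have hw' : n ≤ w ∨ pebbles k k ≤ w := by omega
  refine Ok.seq ((ok_setup hB hw hp rfl).mono ?_)
  rintro s₁ ⟨h1, h2⟩
  have hfil : Filtered n k w G L 0 s₁ := by
    refine ⟨h1, ?_, ?_, ?_, ?_, fun x hx => by omega⟩ <;> rw [h2]
    · exact inputStore_le_one
    · exact holdsGraph_inputStore
    · exact fun v => by rw [listOf_inputStore]
    · rw [listOf_inputStore]
      exact id
  refine Ok.seq ((ok_filter hB hG hwn hw' hfil).mono ?_)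
  intro s₂ h3
  refine Ok.seq ((ok_decide hB hG hwn hw' h3.env h3.le_one h3.graph).mono ?_)
  rintro s₃ ⟨h4, h5, h6⟩
  have l₃ := h4.listOf_eq
  have h7 : Filtered n k w G L (n * k) s₃ := by
    refine ⟨h4.env, h4.le_one, h4.holdsGraph h3.graph, ?_, ?_, ?_⟩ <;> rw [l₃]
    exacts [h3.subset, h3.colorable, h3.critical]
  rw [← l₃] at h6
  refine Ok.seq ((ok_output hB h7).mono ?_)
  rintro s₄ ⟨h8, h9⟩
  refine Ok.assign (by simp only [Expr.Bdd]; omega) ?_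
  by_cases h10 : s₃.reg 8 = 0
  · right
    refine ⟨by simp [Store.reg_setReg, Expr.eval, h8, h10], fun hc => ?_⟩
    exact h6.2 (h7.colorable hc) h10
  · left
    obtain ⟨c, hc⟩ := h6.1 h10
    exact ⟨by simp [Store.reg_setReg, Expr.eval, h8]; omega, c, hc.mono h7.subset,
      fun v => h9 c hc v⟩

theorem below_solve (k : ℕ) : (solve k).Below 18 := by
  simp [solve, setup, filter, filterStep, output, decideColorable, initTable, checkAll, checkTuple,
    checkRow, checkPair, kill, differ, rounds, round, lineStep, checkLine, checkVertex, killLine,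
    result, Cmd.Below, Expr.Below]

/-- Here `k` enters the command only through literals, whose weight does not depend on their value.
This makes the constant of the main theorem absolute. -/
theorem weight_solve (k : ℕ) : (solve k).weight = (solve 0).weight := rfl

theorem depth_solve (k : ℕ) : (solve k).depth = (solve 0).depth := rfl

end Algorithm

/-! ### The running time. -/

theorem IsAnswer.congr {n k d : ℕ} {G : SimpleGraph (Fin n)} {L : Fin n → Finset (Fin k)}
    {s s' : Store} (h : IsAnswer G L s') (hd : 0 < d) (hs : Agree d s s') : IsAnswer G L s := by
  rw [IsAnswer, hs.1, hs.2 0 hd]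
  exact h

theorem pebbles_le {k : ℕ} (hk : 3 ≤ k) : pebbles k k ≤ 16 * k ^ 2 := by
  simp only [pebbles]
  nlinarith

/-- All numbers that occur in the algorithm are polynomially bounded. -/
theorem size_le {n k w : ℕ} (hk : 3 ≤ k) (hw : w = min n (pebbles k k)) :
    n * n + n * k + (n * k) ^ w + k + pebbles k k + 1 ≤ max n 2 ^ (33 * k ^ 2) := by
  set x := max n 2 with hx
  have hnx : n ≤ x := le_max_left _ _
  have h2x : 2 ≤ x := le_max_right _ _
  have hp := pebbles_le hk
  have hkk : k ≤ k ^ 2 := Nat.le_self_pow two_ne_zero k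
  have h9 : 9 ≤ k ^ 2 := by nlinarith
  have hkx : k ≤ x ^ k := Nat.lt_two_pow_self.le.trans (Nat.pow_le_pow_left h2x k)
  have hmono : ∀ {a b : ℕ}, a ≤ b → x ^ a ≤ x ^ b := fun h => Nat.pow_le_pow_right (by omega) h
  have h1 : n * n ≤ x ^ (32 * k ^ 2) := by
    refine le_trans ?_ (hmono (show 2 ≤ 32 * k ^ 2 by omega))
    rw [sq]
    exact Nat.mul_le_mul hnx hnx
  have h2 : n * k ≤ x ^ (32 * k ^ 2) := by
    refine le_trans ?_ (hmono (show k + 1 ≤ 32 * k ^ 2 by omega))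
    rw [pow_succ, mul_comm]
    exact Nat.mul_le_mul hkx hnx
  -- For `n ≤ k` the exponent `w` is at most `k` and `k ≤ x ^ k`. For `k ≤ n` the base is at most `x
  -- ^ 2` and `w ≤ 16 * k ^ 2`, which gives the `32`.
  have h3 : (n * k) ^ w ≤ x ^ (32 * k ^ 2) := by
    rcases le_total n k with h | h
    · calc (n * k) ^ w ≤ (k * k) ^ w := Nat.pow_le_pow_left (Nat.mul_le_mul_right k h) w
        _ ≤ (k * k) ^ k := Nat.pow_le_pow_right (by positivity) (by omega)
        _ ≤ (x ^ k * x ^ k) ^ k := Nat.pow_le_pow_left (Nat.mul_le_mul hkx hkx) k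
        _ = x ^ (2 * k ^ 2) := by ring
        _ ≤ x ^ (32 * k ^ 2) := hmono (by omega)
    · calc (n * k) ^ w ≤ (x * x) ^ w :=
            Nat.pow_le_pow_left (Nat.mul_le_mul hnx (h.trans hnx)) w
        _ = x ^ (2 * w) := by ring
        _ ≤ x ^ (32 * k ^ 2) := hmono (by omega)
  have h4 : k ≤ x ^ (32 * k ^ 2) := hkx.trans (hmono (by omega))
  have h5 : pebbles k k ≤ x ^ (32 * k ^ 2) := by
    refine hp.trans ?_
    calc 16 * k ^ 2 ≤ x ^ 4 * (x ^ k) ^ 2 :=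
          Nat.mul_le_mul (Nat.pow_le_pow_left h2x 4) (Nat.pow_le_pow_left hkx 2)
      _ = x ^ (4 + 2 * k) := by ring
      _ ≤ x ^ (32 * k ^ 2) := hmono (by omega)
  -- One more factor `x ^ (k ^ 2)` absorbs the number of summands, which turns `32` into `33`.
  have h6 : 8 ≤ x ^ (k ^ 2) := (Nat.pow_le_pow_left h2x 3).trans (hmono (by omega))
  have h7 : 1 ≤ x ^ (32 * k ^ 2) := Nat.one_le_pow _ _ (by omega)
  calc _ ≤ 8 * x ^ (32 * k ^ 2) := by omega
    _ ≤ x ^ (k ^ 2) * x ^ (32 * k ^ 2) := Nat.mul_le_mul_right _ h6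
    _ = x ^ (33 * k ^ 2) := by ring

theorem mainTheorem4 :
    ∃ C : ℕ, ∀ k : ℕ, 3 ≤ k →
      ∃ p : Program, ∀ (n : ℕ) (G : SimpleGraph (Fin n)) (L : Fin n → Finset (Fin k)),
        BullChairFree G →
          ∃ (t : ℕ) (s : Store), Exec p (inputStore G L) t s ∧ IsAnswer G L s ∧
            t ≤ (max n 2) ^ (C * k ^ 2) := by
  -- The weight is absorbed by its own value as an exponent of a base at least `2`, and each level
  -- of loops costs a factor of at most `max n 2 ^ (33 * k ^ 2)`.
  refine ⟨(Algorithm.solve 0).weight + 33 * (Algorithm.solve 0).depth, fun k hk =>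
    ⟨(Algorithm.solve k).compile 18, fun n G L hG => ?_⟩⟩
  obtain ⟨w, hw⟩ : ∃ w, w = min n (pebbles k k) := ⟨_, rfl⟩
  have hsize := size_le (n := n) hk hw
  obtain ⟨t, s, s', h1, h2, h3, h4⟩ :=
    (Algorithm.ok_solve (B := n * n + n * k + (n * k) ^ w + k + pebbles k k) (L := L)
      ⟨by omega, by omega, by omega, by omega⟩ hw (by omega) hG).exists_exec
      (Algorithm.below_solve k)
  refine ⟨t, s, h1, h3.congr (by omega) h4, h2.trans ?_⟩
  rw [Algorithm.weight_solve, Algorithm.depth_solve, add_mul, pow_add]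
  have h2x : 2 ≤ max n 2 := le_max_right _ _
  refine Nat.mul_le_mul ?_ ?_
  · calc _ ≤ 2 ^ (Algorithm.solve 0).weight := Nat.lt_two_pow_self.le
      _ ≤ max n 2 ^ (Algorithm.solve 0).weight := Nat.pow_le_pow_left h2x _
      _ ≤ _ := Nat.pow_le_pow_right (by omega) (Nat.le_mul_of_pos_right _ (by positivity))
  · refine (Nat.pow_le_pow_left hsize _).trans_eq ?_
    rw [← pow_mul]
    congr 1
    ring
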